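/- **Setting.** All sets of leaves are nonempty finite sets $I$ (finite subsets of a fixed infinite set of labels). Vector spaces are over $\mathbb{Q}$, and the Koszul sign rule holds. A *tree* is a non-planar leaf-labeled rooted binary tree, and a *forest* on $I$ is a set of trees whose leaves are together labeled bijectively by $I$. $V(F)$ is the set of inner vertices of $F$. An *orientation* of a finite set $X$ is a generator of $\Lambda^{|X|}\mathbb{Z}X$. **The operad.** $\mathrm{Det}(I)=\Lambda^{|I|}\mathbb{Q}I$, in degree $|I|-1$, is the operad with composition $(x\wedge\star)\circ_\star y=x\wedge y$. $\mathrm{Gri}$ is the operad of trees under grafting, in degree $0$. $B=\mathrm{Det}\circ\mathrm{Gri}$ is the operad given by the distributive law $\omega_{i,\star}\circ_\star e_{j,k}=e_{j,\star}\circ_\star\omega_{i,k}-e_{k,\star}\circ_\star\omega_{i,j}$, where $e_{i,j}=i\wedge j$ and $\omega_{i,j}$ is the tree with two leaves $i,j$; $B(I)$ has a basis of forests, each with an orientation $\rho$ of its set of roots, in degree (number of roots) $-1$. Let $\mathrm{Bess}=\mathrm{Det}\otimes B$; $\mathrm{Bess}(I)$ is spanned by the elements $a\otimes\rho\otimes F$,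 where $a$ is an orientation of $I$. These elements are then given the degree $|V(F)|$ (same parity). Let $E_{i,j}=(j\wedge i)\otimes e_{i,j}$ and $\Omega_{i,j}=(i\wedge j)\otimes\omega_{i,j}$. **Inner orientations.** An inner-oriented forest $o\otimes F$ consists of a forest $F$, an orientation $o$ of $V(F)\sqcup\{R\}$ with an auxiliary element $R$, and (implicitly) for each $v\in V(F)$ an orientation $o_v$ of the three half-edges at $v$. It is identified with an element $a\otimes\rho\otimes F$ of $\mathrm{Bess}(I)$ as follows: in $R\wedge a\wedge\rho$ remove the pairs $\ell\wedge r$ for each leaf $\ell$ and root $r$ joined by an edge, and add the pairs $e^+\wedge e^-$ (upper and lower half-edge) for each edge $e$ between two inner vertices; the result is $o$ in which each $v$ is replaced by $o_v$ (a leaf or root label stands for the half-edge of its edge at the adjacent inner vertex). **The sets $\gamma(F,V)$.** For forests $F',F$ on $I$ and $V\subseteq V(F)$, say that $F'$ *appears in* $\gamma(F,V)$ if there is a topological map $F'\to F$ that is increasing towards the roots, is the identity on leaves, maps $V(F')$ bijectively onto $V$, and sends the two branches above each inner vertex of $F'$ into the two different branches above its image. Such a map is unique up to isotopy; it identifies $V(F')$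 with $V$ and the half-edges at each inner vertex of $F'$ with those at its image. **The dual product.** There is exactly one morphism of operads $\Delta:\mathrm{Bess}\to\mathrm{Bess}\otimes\mathrm{Bess}$ with $\Delta(E_{i,j})=E_{i,j}\otimes E_{i,j}$ and $\Delta(\Omega_{i,j})=E_{i,j}\otimes\Omega_{i,j}+\Omega_{i,j}\otimes E_{i,j}$. The dual space $\mathrm{Bess}^*(I)$ has the dual basis, also denoted by $o\otimes F$: $\langle o\otimes F,o'\otimes F'\rangle$ is $0$ if $F\neq F'$ and $1$ if $F=F'$, $o=o'$. The dual product of $f,g\in\mathrm{Bess}^*(I)$ is $(f\otimes g)\circ\Delta$, where $(f\otimes g)(x\otimes y)=(-1)^{|g||x|}f(x)g(y)$, and $f\times g$ denotes the opposite product, that is, the dual product of $g$ and $f$ in this order. **Proposition.** For all inner-oriented forests $o_1\otimes F_1$ and $o_2\otimes F_2$ on $I$, in $\mathrm{Bess}^*(I)$, $$(o_1\otimes F_1)\times(o_2\otimes F_2)=\sum_{(F,\,V_1\sqcup V_2)}o\otimes F .$$ The sum is over the set of pairs $(F,V_1\sqcup V_2)$ where $F$ is a forest on $I$ and $V(F)=V_1\sqcup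 V_2$ is a partition (ordered, possibly with empty parts) such that $F_1$ appears in $\gamma(F,V_1)$ and $F_2$ appears in $\gamma(F,V_2)$. The orientation of $F$ is determined by $o_1\wedge r\wedge o_2=o$ modulo $R_1\wedge r\wedge R_2=R$, where $R_i$ is the auxiliary element of $o_i$ and $r$ is a further auxiliary element; the local orientations are those of $F_1$ and $F_2$. -/

import Mathlib

open scoped TensorProduct

noncomputable section

namespace BesselForests

/-! ### Orientations

An orientation of a finite set is written as a sign times the wedge product of a list that
enumerates the set without repetition. -/

/-- If `l` and `m` enumerate the same finite set without repetition, then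
`l₁ ∧ ⋯ ∧ lₙ = orSign l m • (m₁ ∧ ⋯ ∧ mₙ)`: moving `a` to the front of `m` costs one sign for
each element of `m` before `a`. -/
def orSign {S : Type*} [DecidableEq S] : List S → List S → ℤˣ
  | [], _ => 1
  | a :: l, m => (-1) ^ (m.idxOf a) * orSign l (m.erase a)

/-! ### Forests

A forest on `I` of leaf-labeled rooted binary trees is encoded by the set `W` of its inner
vertices, an inner vertex being identified with the set of leaves above it (its ancestor leaves).
The leaf `i` is identified with `{i}`. The nodes are the leaves and the inner vertices; a node
stands at the same time for the edge that goes out of it towards the root. -/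

section Forests

variable {α : Type*} [DecidableEq α]

/-- Leaves and inner vertices. -/
def nodes (I : Finset α) (W : Finset (Finset α)) : Finset (Finset α) :=
  W ∪ I.image (fun i => {i})

/-- The nodes whose outgoing edge ends in the inner vertex `v`: the maximal nodes strictly
below `v` for inclusion. -/
def children (I : Finset α) (W : Finset (Finset α)) (v : Finset α) : Finset (Finset α) :=
  (nodes I W).filter (fun B => B ⊂ v ∧ ∀ C ∈ nodes I W, C ⊂ v → ¬ B ⊂ C)

/-- The maximal nodes, one for each tree: the edge going out of such a node ends in a root, and
the root is identified with this node. -/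
def roots (I : Finset α) (W : Finset (Finset α)) : Finset (Finset α) :=
  (nodes I W).filter (fun B => ∀ C ∈ nodes I W, ¬ B ⊂ C)

/-- `W` is the set of inner vertices of a forest of binary trees with leaf set `I`. -/
structure IsForest (I : Finset α) (W : Finset (Finset α)) : Prop where
  nonempty : I.Nonempty
  subset : ∀ A ∈ W, A ⊆ I
  laminar : ∀ A ∈ W, ∀ B ∈ W, A ⊆ B ∨ B ⊆ A ∨ Disjoint A B
  binary : ∀ A ∈ W, (children I W A).card = 2

/-- Forests on the (nonempty) finite set `I`. -/
@[ext]
structure Forest (I : Finset α) where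
  /-- the set of inner vertices -/
  verts : Finset (Finset α)
  isForest : IsForest I verts

instance (I : Finset α) : Finite (Forest I) :=
  Finite.of_injective
    (fun F : Forest I => (⟨F.verts, Finset.mem_powerset.2 fun A hA =>
      Finset.mem_powerset.2 (F.isForest.subset A hA)⟩ : {W // W ∈ I.powerset.powerset}))
    (fun _ _ h => Forest.ext (congrArg Subtype.val h))

instance (I : Finset α) : Fintype (Forest I) := Fintype.ofFinite _

/-! ### The operad `Bess = Det ⊗ B`

An outer-oriented forest is `a ⊗ ρ ⊗ F` with `a` an orientation of `I` and `ρ` an orientation of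
the set of roots of `F`. The lists `I.toList` and `(roots I F.verts).toList` serve as reference
orientations, so that `Bess I` has one basis vector for each forest. -/

/-- The component `Bess(I)`; the basis vector `F` stands for the outer-oriented forest with the
reference orientations. -/
abbrev Bess (I : Finset α) : Type _ := Forest I →₀ ℚ

open Classical in
/-- The outer-oriented forest `a ⊗ ρ ⊗ F`, where `W` is the set of inner vertices of `F`
(and zero if `W` is not the vertex set of a forest on `I`). -/
def outer (I : Finset α) (W : Finset (Finset α)) (a : List α) (ρ : List (Finset α)) : Bess I :=
  if h : IsForest I W then
    (orSign a I.toList * orSign ρ (roots I W).toList) • Finsupp.single (⟨W, h⟩ : Forest I) (1 : ℚ)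
  else 0

/-- The bilinear map with prescribed values on pairs of basis vectors. -/
def bilin {I J : Finset α} {M : Type*} [AddCommGroup M] [Module ℚ M]
    (c : Forest I → Forest J → M) : Bess I →ₗ[ℚ] Bess J →ₗ[ℚ] M :=
  Finsupp.linearCombination ℚ (fun F => Finsupp.linearCombination ℚ (c F))

/-- One use of the distributive law: a tree with leaf set `S` is grafted, by a new inner vertex, on
one of the trees of a root-oriented forest. The forest is given by the list of its roots and the
set of its inner vertices; all the possibilities are listed, and the root of the new tree takes
the place, in the orientation, of the root of the tree that was chosen. -/
def graft (S : Finset α) (p : List (Finset α) × Finset (Finset α)) :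
    List (List (Finset α) × Finset (Finset α)) :=
  (List.range p.1.length).map fun k =>
    (p.1.modify k (fun A => A ∪ S), insert (p.1.getD k ∅ ∪ S) p.2)

/-- The inner vertices on the path from the leaf `s` to the root, from top to bottom. -/
def path {I : Finset α} (F : Forest I) (s : α) : List (Finset α) :=
  (F.verts.filter (fun A => s ∈ A)).toList.insertionSort (fun A B => A.card ≤ B.card)

/-- The sets of leaves of the subtrees that are attached along the path from the leaf `s` to the
root, from top to bottom. -/
def siblings {I : Finset α} (F : Forest I) (s : α) : List (Finset α) :=
  (path F s).map fun A => ((children I F.verts A).filter (fun B => s ∉ B)).sup id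

/-- Substitution of a forest with list of roots `ρ` and inner vertices `W` for the leaf `s` in the
tree of `F` that contains it: the forest is moved down the path from `s` to the root by the
distributive law. Only the vertices on that path and those of `W` are recorded. -/
def subst {I : Finset α} (F : Forest I) (s : α) (ρ : List (Finset α)) (W : Finset (Finset α)) :
    List (List (Finset α) × Finset (Finset α)) :=
  (siblings F s).foldl (fun L S => L.flatMap (graft S)) [(ρ, W)]

/-- The partial composition at `s` of two basis vectors. After writing the orientations of `F` as
`a ∧ s` and `ρ ∧ τ`, with `τ` the root of the tree that contains `s`, both in `Det` and in `B` the
rule is `(x ∧ s) ∘ₛ y = x ∧ y`. The first sign is the Koszul sign of `Det ⊗ B`. -/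
def basisComp (I J : Finset α) (s : α) (F : Forest I) (G : Forest J) : Bess (I.erase s ∪ J) :=
  let a := I.toList.erase s
  let ρ := (roots I F.verts).toList.filter (fun A => s ∉ A)
  let τ := (roots I F.verts).toList.filter (fun A => s ∈ A)
  ((-1 : ℤˣ) ^ (((roots I F.verts).card - 1) * (J.card - 1)) *
      orSign I.toList (a ++ [s]) * orSign (roots I F.verts).toList (ρ ++ τ)) •
    ((subst F s (roots J G.verts).toList G.verts).map fun p =>
      outer (I.erase s ∪ J) (F.verts.filter (fun A => s ∉ A) ∪ p.2)
        (a ++ J.toList) (ρ ++ p.1)).sum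

/-- The partial composition `x ∘ₛ y` of the operad `Bess`, for `s ∈ I` and `I \ {s}` disjoint
from `J`. -/
def comp (I J : Finset α) (s : α) : Bess I →ₗ[ℚ] Bess J →ₗ[ℚ] Bess (I.erase s ∪ J) :=
  bilin (basisComp I J s)

/-- The unit of the operad, on a set with one element. -/
def unit (i : α) : Bess ({i} : Finset α) := outer {i} ∅ [i] [{i}]

/-- The generator `E_{i,j} = (j ∧ i) ⊗ e_{i,j}`. -/
def genE (i j : α) : Bess ({i, j} : Finset α) := outer {i, j} ∅ [j, i] [{i}, {j}]

/-- The generator `Ω_{i,j} = (i ∧ j) ⊗ ω_{i,j}`. -/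
def genOmega (i j : α) : Bess ({i, j} : Finset α) := outer {i, j} {{i, j}} [i, j] [{i, j}]

/-! ### The coproduct -/

/-- The degree: the number of inner vertices. -/
def deg {I : Finset α} (F : Forest I) : ℕ := F.verts.card

/-- The partial composition of the operad `Bess ⊗ Bess`:
`(x' ⊗ x'') ∘ₛ (y' ⊗ y'') = (-1)^{|x''| |y'|} (x' ∘ₛ y') ⊗ (x'' ∘ₛ y'')`. -/
def tensorComp (I J : Finset α) (s : α) :
    Bess I ⊗[ℚ] Bess I →ₗ[ℚ] Bess J ⊗[ℚ] Bess J →ₗ[ℚ]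
      Bess (I.erase s ∪ J) ⊗[ℚ] Bess (I.erase s ∪ J) :=
  TensorProduct.lift (bilin fun F' F'' => TensorProduct.lift (bilin fun G' G'' =>
    ((-1 : ℤˣ) ^ (deg F'' * deg G')) • (basisComp I J s F' G' ⊗ₜ[ℚ] basisComp I J s F'' G'')))

/-- `Δ` is a morphism of operads from `Bess` to `Bess ⊗ Bess` with the prescribed values on the
generators. A relabeling of leaves is a composition with units, so that equivariance is contained
in `map_comp` and `map_unit`. -/
structure IsBessCoproduct (Δ : ∀ I : Finset α, Bess I →ₗ[ℚ] Bess I ⊗[ℚ] Bess I) : Prop where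
  map_unit : ∀ i : α, Δ {i} (unit i) = unit i ⊗ₜ[ℚ] unit i
  map_comp : ∀ (I J : Finset α) (s : α), s ∈ I → Disjoint (I.erase s) J →
    ∀ (x : Bess I) (y : Bess J),
      Δ (I.erase s ∪ J) (comp I J s x y) = tensorComp I J s (Δ I x) (Δ J y)
  map_genE : ∀ i j : α, i ≠ j → Δ {i, j} (genE i j) = genE i j ⊗ₜ[ℚ] genE i j
  map_genOmega : ∀ i j : α, i ≠ j →
    Δ {i, j} (genOmega i j) = genE i j ⊗ₜ[ℚ] genOmega i j + genOmega i j ⊗ₜ[ℚ] genE i j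

/-! ### The dual product -/

/-- The operator `F' ⊗ F'' ↦ (-1)^{|F'| |F''|} F' ⊗ F''`. -/
def koszulTwist (I : Finset α) : Bess I ⊗[ℚ] Bess I →ₗ[ℚ] Bess I ⊗[ℚ] Bess I :=
  TensorProduct.lift (bilin fun F' F'' =>
    ((-1 : ℤˣ) ^ (deg F' * deg F'')) •
      (Finsupp.single F' (1 : ℚ) ⊗ₜ[ℚ] Finsupp.single F'' (1 : ℚ)))

/-- The product on the dual space `Bess*(I)` that is dual to the coproduct `δ` on `Bess(I)`: it is
`f g = (f ⊗ g) ∘ δ`, where `(f ⊗ g)(x ⊗ y) = (-1)^{|g| |x|} f(x) g(y)`. As `g(y)` vanishes unless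
`|g| = |y|`, the sign may be put on `x ⊗ y`. -/
def dualMul {I : Finset α} (δ : Bess I →ₗ[ℚ] Bess I ⊗[ℚ] Bess I)
    (f g : Module.Dual ℚ (Bess I)) : Module.Dual ℚ (Bess I) :=
  LinearMap.mul' ℚ ℚ ∘ₗ TensorProduct.map f g ∘ₗ koszulTwist I ∘ₗ δ

/-- The opposite of the dual product. -/
def oppDualMul {I : Finset α} (δ : Bess I →ₗ[ℚ] Bess I ⊗[ℚ] Bess I)
    (f g : Module.Dual ℚ (Bess I)) : Module.Dual ℚ (Bess I) :=
  dualMul δ g f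

/-! ### Inner orientations -/

variable (α) in
/-- Half-edges: `(A, true)` is the upper half and `(A, false)` the lower half of the edge that goes
out of the node `A`. The label of a leaf `i` is identified with `({i}, false)` and the root of a
tree with `(A, true)`, where `A` is the corresponding maximal node. -/
abbrev HalfEdge : Type _ := Finset α × Bool

variable (α) in
/-- The data of an inner orientation: a sign, a list of inner vertices and of the auxiliary element
`R` (here `none`), and a list of half-edges for each inner vertex. -/
structure InnerData where
  /-- a global sign -/
  sign : ℤˣ
  /-- the global orientation, as a wedge product -/
  glob : List (Option (Finset α))
  /-- the local orientations, as wedge products -/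
  loc : Finset α → List (HalfEdge α)

/-- `o` is an inner orientation of `F`: its global part enumerates `V(F) ⊔ {R}`, and its local part
enumerates, for each inner vertex, the three half-edges at this vertex. -/
structure InnerData.IsOrientationOf {I : Finset α} (o : InnerData α) (F : Forest I) : Prop where
  glob_nodup : o.glob.Nodup
  mem_glob : ∀ g, g ∈ o.glob ↔ g = none ∨ ∃ v ∈ F.verts, g = some v
  loc_nodup : ∀ v ∈ F.verts, (o.loc v).Nodup
  mem_loc : ∀ v ∈ F.verts, ∀ h, h ∈ o.loc v ↔
    h = (v, true) ∨ ∃ B ∈ children I F.verts v, h = (B, false)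

/-- `R ∧ a ∧ ρ`, followed by the pairs `e⁺ ∧ e⁻` for the edges `e` between two inner vertices.
Placing `R` between `a` and `ρ` would multiply all identifications by `(-1)^{|I|}`; with `R` in
front, the unit of the operad on one leaf is `R ⊗ |`. -/
def outerWord {I : Finset α} (F : Forest I) (a : List α) (ρ : List (Finset α)) :
    List (Option (HalfEdge α)) :=
  none :: (a.map (fun i => some ({i}, false)) ++ ρ.map (fun A => some (A, true)) ++
    (F.verts \ roots I F.verts).toList.flatMap (fun A => [some (A, true), some (A, false)]))

/-- The global orientation, where each inner vertex is replaced by its local orientation, followed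
by the pairs `ℓ ∧ r` for the leaves `ℓ` and the roots `r` that are related by an edge. -/
def innerWord {I : Finset α} (F : Forest I) (o : InnerData α) : List (Option (HalfEdge α)) :=
  o.glob.flatMap (fun g => match g with
    | none => [none]
    | some v => (o.loc v).map some) ++
  (roots I F.verts \ F.verts).toList.flatMap (fun A => [some (A, false), some (A, true)])

/-- The sign `ε` such that the inner orientation `o` is identified with the outer orientation
`ε • (a ⊗ ρ)`. -/
def innerSign {I : Finset α} (F : Forest I) (o : InnerData α) (a : List α)
    (ρ : List (Finset α)) : ℤˣ :=
  o.sign * orSign (innerWord F o) (outerWord F a ρ)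

/-- The inner-oriented forest `o ⊗ F` as an element of `Bess(I)`. -/
def innerForest {I : Finset α} (F : Forest I) (o : InnerData α) : Bess I :=
  innerSign F o I.toList (roots I F.verts).toList •
    outer I F.verts I.toList (roots I F.verts).toList

/-- The element `o ⊗ F` of the dual basis of `Bess*(I)`: its value on `F'` with any orientation is
zero if `F' ≠ F`, and its value on `o ⊗ F` is one. -/
def dualForest {I : Finset α} (F : Forest I) (o : InnerData α) : Module.Dual ℚ (Bess I) :=
  innerSign F o I.toList (roots I F.verts).toList • Finsupp.lapply F

/-! ### The poset of forests and the product formula -/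

/-- `φ` describes, on nodes, a topological map from `F'` to `F` which is increasing towards the
root, is injective from inner vertices to inner vertices, is the identity on leaves, and sends the
two branches above an inner vertex into the two different branches above its image. -/
structure IsForestMap {I : Finset α} (F' F : Forest I) (φ : Finset α → Finset α) : Prop where
  leaf : ∀ i ∈ I, φ {i} = {i}
  vertex : ∀ v ∈ F'.verts, φ v ∈ F.verts
  injOn : Set.InjOn φ (F'.verts : Set (Finset α))
  increasing : ∀ v ∈ F'.verts, ∀ B ∈ children I F'.verts v, φ B ⊂ φ v
  branches : ∀ v ∈ F'.verts, ∀ B ∈ children I F'.verts v, ∀ C ∈ children I F'.verts v, B ≠ C →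
    ∀ D ∈ children I F.verts (φ v), ¬ (φ B ⊆ D ∧ φ C ⊆ D)

/-- `F'` appears in `γ(F, V)`: one has `F' ≤ F` by a map that identifies the inner vertices of `F'`
with the elements of `V`. -/
def MemGamma {I : Finset α} (F : Forest I) (V : Finset (Finset α)) (F' : Forest I) : Prop :=
  ∃ φ : Finset α → Finset α, IsForestMap F' F φ ∧ F'.verts.image φ = V

open Classical in
/-- The map from the nodes of `F'` to the nodes of `F`, when `F'` appears in `γ(F, V)`. -/
def nodeMap {I : Finset α} (F : Forest I) (V : Finset (Finset α)) (F' : Forest I) :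
    Finset α → Finset α :=
  if h : MemGamma F V F' then h.choose else id

/-- The image at the inner vertex `v` of `F` of a local orientation at the vertex of `F'` that is
mapped to `v` by `φ`: outgoing half-edges correspond to each other, and the incoming half-edge from
the node `B` corresponds to the incoming half-edge at `v` through which one comes from `φ B`. -/
def transportLoc {I : Finset α} (F : Forest I) (φ : Finset α → Finset α) (v : Finset α)
    (l : List (HalfEdge α)) : List (HalfEdge α) :=
  l.map fun h => if h.2 then (v, true)
    else (((children I F.verts v).filter (fun D => φ h.1 ⊆ D)).sup id, false)

/-- Symbols for the global orientations that are glued: inner vertices, `R₁`, `r` and `R₂`. -/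
inductive GlueSymbol (β : Type*) where
  | vertex (v : β)
  | R₁
  | r
  | R₂
  deriving DecidableEq

/-- The word `o₁ ∧ r ∧ o₂` for the maps `φ₁`, `φ₂` of inner vertices. -/
def gluedWord (φ₁ φ₂ : Finset α → Finset α) (o₁ o₂ : InnerData α) :
    List (GlueSymbol (Finset α)) :=
  o₁.glob.map (fun g => match g with
    | none => .R₁
    | some v => .vertex (φ₁ v)) ++
  .r :: o₂.glob.map (fun g => match g with
    | none => .R₂
    | some v => .vertex (φ₂ v))

/-- Replacement of `R` by `R₁ ∧ r ∧ R₂` in a global orientation. -/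
def expandR (l : List (Option (Finset α))) : List (GlueSymbol (Finset α)) :=
  l.flatMap fun g => match g with
    | none => [.R₁, .r, .R₂]
    | some v => [.vertex v]

/-- The inner orientation `o` of `F` with `o₁ ∧ r ∧ o₂ = o` modulo `R₁ ∧ r ∧ R₂ = R`, where `o₁` and
`o₂` are inner orientations of `F₁ ∈ γ(F, V₁)` and `F₂ ∈ γ(F, V(F) \ V₁)`; local orientations are
unchanged. It is written as a sign times `R ∧ v₁ ∧ ⋯ ∧ vₙ` for a list of the inner vertices. -/
def glue {I : Finset α} (F₁ F₂ : Forest I) (o₁ o₂ : InnerData α) (F : Forest I)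
    (V₁ : Finset (Finset α)) : InnerData α :=
  let φ₁ := nodeMap F V₁ F₁
  let φ₂ := nodeMap F (F.verts \ V₁) F₂
  let w : List (Option (Finset α)) := none :: F.verts.toList.map some
  { sign := o₁.sign * o₂.sign * orSign (gluedWord φ₁ φ₂ o₁ o₂) (expandR w)
    glob := w
    loc := fun v =>
      if v ∈ V₁ then
        transportLoc F φ₁ v (o₁.loc (Function.invFunOn φ₁ (F₁.verts : Set (Finset α)) v))
      else
        transportLoc F φ₂ v (o₂.loc (Function.invFunOn φ₂ (F₂.verts : Set (Finset α)) v)) }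

open Classical in
/-- The pairs `(F, V(F) = V₁ ⊔ V₂)`, recorded as `(F, V₁)`, such that `F₁` appears in `γ(F, V₁)` and
`F₂` appears in `γ(F, V₂)`. -/
def gluingPairs {I : Finset α} (F₁ F₂ : Forest I) :
    Finset (Forest I × Finset (Finset α)) :=
  (Finset.univ ×ˢ I.powerset.powerset).filter fun p =>
    p.2 ⊆ p.1.verts ∧ MemGamma p.1 p.2 F₁ ∧ MemGamma p.1 (p.1.verts \ p.2) F₂

end Forests

end BesselForests

end

open scoped TensorProduct

noncomputable section

namespace BesselForests

/-! ### Signs of reorderings -/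

section Signs

variable {S T : Type*} [DecidableEq S] [DecidableEq T]

/-! The proof rests on the odd operators `joinOp B C` on `Bess I`, which join a tree with leaves in
`B` to a tree with leaves in `C` in all possible ways. Up to sign, every forest arises from
`oneForest I`, the forest without inner vertices, by successive joins of two trees. Statements about
forests can therefore be proved by removing root vertices one at a time. The sets `B` and `C` may be
larger than single trees because a substitution at `s` breaks the tree of `s` into several trees:
composition at `s` carries `joinOp B C` to the operator for the enlarged leaf sets (`comp_joinOp`),
which is a form of the distributive law. The factor `(-1) ^ I.card` in `joinOp` absorbs the Koszul
signs, so this commutation holds without a sign.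

Existence of the coproduct. On the tensor square, `joinOp₂` is the graded derivation `joinOp ⊗ 1 +
signOp ⊗ joinOp`. The coproduct is defined by requiring that `oneForest` is group-like and that the
coproduct intertwines `joinOp X Y` with `joinOp₂ X Y`. This recursion does not depend on the root
vertex that is removed, because operators for disjoint pairs anticommute on both levels
(`joinOp_anticomm`, `joinOp₂_anticomm`, `cop_eq`). Compatibility with composition follows by
stripping root vertices from the left factor until it is `oneForest`, and in that case from the
right factor (`coproduct_comp_one`, `coproduct_comp`).

Uniqueness. A forest with an inner vertex has one with two leaves as children, so it is a composite
of an element with fewer leaves and some `Ω_{i,j}` (`exists_comp_genOmega`). A forest without inner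
vertices is an iterated composite of the `E_{i,j}`. Induction on the number of leaves concludes.

Product formula. Both sides are evaluated on a forest `F`, by induction on its inner vertices
(`pairing_coproduct`). Let `F` be the join of the trees `X` and `Y` of `G`. On the left, the
derivation property moves the operator `joinOp X Y` to one of the two linear forms
(`pairing_comp_joinOp₂`), and the transpose of this operator deletes from `F₁` or `F₂` a root vertex
whose children lie in `X` and in `Y` (`dualForest_comp_joinOp`). On the right, the vertex `X ∪ Y`
belongs to `V₁` or to `V₂`, and the corresponding `Fᵢ` appears in `γ` exactly when such a root
vertex can be deleted and what remains appears for `G` (`memGamma_insert_iff`). So both sides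
satisfy the same recursion. As for signs, deleting a vertex from an inner orientation costs its
position in the global orientation and the sign of its local orientation (`wordsMatch_join`). In `o₁
∧ r ∧ o₂` a vertex of `o₂` stands behind the `|V(F₁)| + 2` letters of `o₁ ∧ r`, and this is the
Koszul sign of the derivation. -/

lemma units_neg_one_pow_eq {m n : ℕ} (h : m % 2 = n % 2) : (-1 : ℤˣ) ^ m = (-1) ^ n := by
  rw [← Nat.div_add_mod m 2, ← Nat.div_add_mod n 2, h, pow_add, pow_add, pow_mul, pow_mul]
  simp

lemma orSign_cons (a : S) (l m : List S) :
    orSign (a :: l) m = (-1) ^ (m.idxOf a) * orSign l (m.erase a) := rfl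

lemma orSign_cons_cons (a : S) (l m : List S) : orSign (a :: l) (a :: m) = orSign l m := by
  simp [orSign_cons]

@[simp] lemma orSign_self (l : List S) : orSign l l = 1 := by
  induction l with
  | nil => rfl
  | cons a l ih => rw [orSign_cons_cons, ih]

/-- Extracting `b` before `a` or `a` before `b` leaves the two letters in opposite orders, so the
two total shifts differ by one transposition. -/
lemma idxOf_erase_parity {n : List S} (hn : n.Nodup) {a b : S} (ha : a ∈ n) (hb : b ∈ n)
    (hab : a ≠ b) :
    (n.idxOf b + (n.erase b).idxOf a) % 2 = (n.idxOf a + 1 + (n.erase a).idxOf b) % 2 := by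
  induction n with
  | nil => simp at ha
  | cons c n ih =>
    rw [List.nodup_cons] at hn
    by_cases hca : c = a
    · subst hca
      have hb' : b ∈ n := by simpa [hab.symm] using hb
      rw [List.idxOf_cons_ne _ hab, List.erase_cons_tail (by simpa using hab),
        List.idxOf_cons_self, List.idxOf_cons_self, List.erase_cons_head]
      omega
    · by_cases hcb : c = b
      · subst hcb
        rw [List.idxOf_cons_ne _ hca, List.erase_cons_head, List.idxOf_cons_self,
          List.erase_cons_tail (by simpa using hca), List.idxOf_cons_self]
        omega
      · have ha' : a ∈ n := by simpa [Ne.symm hca] using ha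
        have hb' : b ∈ n := by simpa [Ne.symm hcb] using hb
        have := ih hn.2 ha' hb'
        rw [List.idxOf_cons_ne _ hca, List.idxOf_cons_ne _ hcb,
          List.erase_cons_tail (by simpa using hcb), List.erase_cons_tail (by simpa using hca),
          List.idxOf_cons_ne _ hca, List.idxOf_cons_ne _ hcb]
        omega

/-- The recursion of `orSign` only strips the head of the left word. This version removes any letter
from both words, at the price of its two positions. -/
lemma orSign_erase {m n : List S} (h : m.Perm n) (hn : n.Nodup) {a : S} (ha : a ∈ n) :
    orSign m n = (-1) ^ (m.idxOf a + n.idxOf a) * orSign (m.erase a) (n.erase a) := by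
  induction m generalizing n with
  | nil => simp [← h.mem_iff] at ha
  | cons b m ih =>
    by_cases hab : b = a
    · subst hab
      simp [orSign_cons]
    · have hb : b ∈ n := h.subset (by simp)
      have hp : m.Perm (n.erase b) := by simpa using h.erase b
      have ha' : a ∈ n.erase b := (List.mem_erase_of_ne (Ne.symm hab)).2 ha
      rw [orSign_cons, ih hp (hn.erase _) ha', List.idxOf_cons_ne _ hab,
        List.erase_cons_tail (by simpa using hab), orSign_cons, List.erase_comm, ← mul_assoc,
        ← mul_assoc, ← pow_add, ← pow_add]
      congr 1
      apply units_neg_one_pow_eq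
      have := idxOf_erase_parity hn ha hb (Ne.symm hab)
      omega

/-- After the head of `l` is removed from both `m` and `n`, its position in `m` occurs twice and
cancels. -/
lemma orSign_trans {l m n : List S} (h : l.Perm m) (h' : m.Perm n) (hn : n.Nodup) :
    orSign l m * orSign m n = orSign l n := by
  induction l generalizing m n with
  | nil =>
    have := h.symm.eq_nil
    subst this
    simp [orSign]
  | cons a l ih =>
    have hm : m.Nodup := h'.nodup_iff.2 hn
    have ham : a ∈ m := h.subset (by simp)
    have han : a ∈ n := h'.subset ham
    have h1 : l.Perm (m.erase a) := by simpa using h.erase a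
    rw [orSign_cons, orSign_cons, orSign_erase h' hn han, ← ih h1 (h'.erase a) (hn.erase _),
      pow_add]
    have : ((-1 : ℤˣ) ^ (m.idxOf a)) * (-1) ^ (m.idxOf a) = 1 := Int.units_mul_self _
    calc _ = (((-1 : ℤˣ) ^ (m.idxOf a)) * (-1) ^ (m.idxOf a)) * ((-1) ^ (n.idxOf a) *
          (orSign l (m.erase a) * orSign (m.erase a) (n.erase a))) := by
            simp only [mul_assoc, mul_comm, mul_left_comm]
      _ = _ := by rw [this, one_mul]

lemma orSign_symm {l m : List S} (h : l.Perm m) (hm : m.Nodup) : orSign l m = orSign m l := by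
  have h1 := orSign_trans h h.symm (h.nodup_iff.2 hm)
  rw [orSign_self] at h1
  calc orSign l m = orSign l m * (orSign m l * orSign m l) := by rw [Int.units_mul_self, mul_one]
    _ = _ := by rw [← mul_assoc, h1, one_mul]

lemma orSign_append {l₁ l₂ m₁ m₂ : List S} (h₁ : l₁.Perm m₁) :
    orSign (l₁ ++ l₂) (m₁ ++ m₂) = orSign l₁ m₁ * orSign l₂ m₂ := by
  induction l₁ generalizing m₁ with
  | nil =>
    have := h₁.symm.eq_nil
    subst this
    simp [orSign]
  | cons a l ih =>
    have ha : a ∈ m₁ := h₁.subset (by simp)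
    have h1 : l.Perm (m₁.erase a) := by simpa using h₁.erase a
    rw [List.cons_append, orSign_cons, orSign_cons, List.idxOf_append_of_mem ha,
      List.erase_append_left _ ha, ih h1, mul_assoc]

lemma orSign_append_left (l : List S) (l₂ m₂ : List S) :
    orSign (l ++ l₂) (l ++ m₂) = orSign l₂ m₂ := by
  rw [orSign_append (List.Perm.refl l), orSign_self, one_mul]

lemma orSign_append_right {l₁ m₁ : List S} (h : l₁.Perm m₁) (m : List S) :
    orSign (l₁ ++ m) (m₁ ++ m) = orSign l₁ m₁ := by
  rw [orSign_append h, orSign_self, mul_one]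

lemma orSign_cons_middle {a : S} {l : List S} (ha : a ∉ l) (m : List S) :
    orSign (a :: (l ++ m)) (l ++ a :: m) = (-1) ^ l.length := by
  rw [orSign_cons, List.idxOf_append_of_notMem ha, List.erase_append_right _ ha]
  simp

lemma orSign_middle_cons {a : S} {l m : List S} (h : (l ++ a :: m).Nodup) :
    orSign (l ++ a :: m) (a :: (l ++ m)) = (-1) ^ l.length := by
  rw [orSign_symm List.perm_middle (List.perm_middle.nodup_iff.1 h), orSign_cons_middle]
  intro ha
  exact (List.disjoint_of_nodup_append h) ha (by simp)

lemma orSign_swap {a b : S} (h : a ≠ b) (l : List S) : orSign (a :: b :: l) (b :: a :: l) = -1 := by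
  rw [orSign_cons, List.idxOf_cons_ne _ h.symm, List.erase_cons_tail (by simpa using h.symm)]
  simp

lemma orSign_append_comm {l m n : List S} (h : (l ++ m ++ n).Nodup) :
    orSign (l ++ m ++ n) (m ++ l ++ n) = (-1) ^ (l.length * m.length) := by
  induction l with
  | nil => simp
  | cons a l ih =>
    have h0 : (l ++ m ++ n).Nodup := by
      simp only [List.cons_append, List.nodup_cons] at h
      exact h.2
    have ha : a ∉ m := by
      simp only [List.cons_append, List.nodup_cons, List.mem_append, not_or] at h
      exact h.1.1.2
    have hp : (l ++ m ++ n).Perm (m ++ l ++ n) :=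
      List.Perm.append_right _ List.perm_append_comm
    have e1 : orSign (a :: (l ++ m ++ n)) (a :: (m ++ l ++ n)) = (-1) ^ (l.length * m.length) := by
      rw [orSign_cons_cons, ih h0]
    have e2 : orSign (a :: (m ++ (l ++ n))) (m ++ a :: (l ++ n)) = (-1) ^ m.length :=
      orSign_cons_middle ha _
    have hn : (m ++ a :: (l ++ n)).Nodup := by
      refine (List.Perm.nodup_iff ?_).1 h
      refine ((List.perm_append_comm (l₁ := a :: l) (l₂ := m)).append_right n).trans ?_
      simp
    have := orSign_trans (l := a :: (l ++ m ++ n)) (m := a :: (m ++ l ++ n))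
      (n := m ++ a :: (l ++ n)) (hp.cons a) (by simpa using List.perm_middle.symm) hn
    rw [e1, List.append_assoc m l n, e2] at this
    rw [List.length_cons, add_mul, one_mul, pow_add, this]
    simp

lemma idxOf_erase_map {f : S → T} {a : S} {m : List S} (ha : a ∈ m)
    (hf : Set.InjOn f {x | x ∈ m}) :
    (m.map f).idxOf (f a) = m.idxOf a ∧ (m.map f).erase (f a) = (m.erase a).map f := by
  induction m with
  | nil => simp at ha
  | cons b m ih =>
    by_cases hb : b = a
    · subst hb; simp
    · have hfb : f b ≠ f a := fun e => hb (hf (by simp) ha e)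
      obtain ⟨h1, h2⟩ := ih (by simpa [Ne.symm hb] using ha)
        (hf.mono fun x hx => List.mem_cons_of_mem _ hx)
      rw [List.map_cons, List.idxOf_cons_ne _ hfb, List.idxOf_cons_ne _ hb,
        List.erase_cons_tail (by simpa using hfb), List.erase_cons_tail (by simpa using hb),
        h1, h2]
      simp

lemma orSign_map {f : S → T} {l m : List S} (h : l.Perm m)
    (hf : Set.InjOn f {x | x ∈ m}) : orSign (l.map f) (m.map f) = orSign l m := by
  induction l generalizing m with
  | nil => rfl
  | cons a l ih =>
    have ha : a ∈ m := h.subset (by simp)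
    have h1 : l.Perm (m.erase a) := by simpa using h.erase a
    obtain ⟨e1, e2⟩ := idxOf_erase_map ha hf
    rw [List.map_cons, orSign_cons, orSign_cons, e1, e2,
      ih h1 (hf.mono fun x hx => List.mem_of_mem_erase hx)]

/-- Reversal of a word is a permutation whose sign depends only on the length, hence it contributes
equally on both sides. In the induction, the head of `l` becomes the last letter and passes the same
segment `p`, now from the other end. -/
lemma orSign_reverse {l m : List S} (h : l.Perm m) (hm : m.Nodup) :
    orSign l.reverse m.reverse = orSign l m := by
  induction l generalizing m with
  | nil =>
    have := h.symm.eq_nil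
    subst this
    rfl
  | cons a l ih =>
    obtain ⟨p, q, rfl⟩ := List.append_of_mem (h.subset (List.mem_cons_self))
    have h1 : l.Perm (p ++ q) := (h.trans List.perm_middle).cons_inv
    have hap : a ∉ p := fun hx => (List.disjoint_of_nodup_append hm) hx (by simp)
    have hpq : (p ++ q).Nodup := (List.nodup_cons.1 (List.perm_middle.nodup_iff.1 hm)).2
    have haq : a ∉ p ++ q := (List.nodup_cons.1 (List.perm_middle.nodup_iff.1 hm)).1
    rw [orSign_cons, List.idxOf_append_of_notMem hap, List.erase_append_right _ hap]
    simp only [List.idxOf_cons_self, List.erase_cons_head, add_zero]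
    rw [← ih h1 hpq]
    simp only [List.reverse_cons, List.reverse_append, List.append_assoc, List.cons_append,
      List.nil_append]
    have hr : (q.reverse ++ p.reverse).Nodup := by
      rw [← List.reverse_append]; exact List.nodup_reverse.2 hpq
    have hl1 : (l.reverse ++ [a]).Perm (q.reverse ++ (p.reverse ++ [a])) := by
      rw [← List.append_assoc, ← List.reverse_append]
      exact ((List.reverse_perm l).trans (h1.trans (List.reverse_perm _).symm)).append_right _
    have hl2 : (q.reverse ++ (p.reverse ++ [a])).Perm (q.reverse ++ a :: p.reverse) :=
      List.Perm.append_left _ List.perm_append_comm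
    have hn : (q.reverse ++ a :: p.reverse).Nodup := by
      rw [List.perm_middle.nodup_iff, List.nodup_cons]
      refine ⟨?_, hr⟩
      simpa [or_comm] using haq
    rw [← orSign_trans hl1 hl2 hn, ← List.append_assoc, ← List.reverse_append,
      orSign_append_right ((List.reverse_perm l).trans (h1.trans (List.reverse_perm _).symm)),
      List.reverse_append, List.append_assoc, orSign_append_left, mul_comm]
    congr 1
    have := orSign_middle_cons (a := a) (l := p.reverse) (m := []) (by
      rw [List.perm_middle.nodup_iff, List.nodup_cons]
      simp only [List.append_nil, List.mem_reverse, List.nodup_reverse]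
      exact ⟨hap, (List.nodup_append.1 hpq).1⟩)
    simpa using this

/-- A block of odd length commutes with other such blocks exactly as a single letter does. This
makes it possible to replace each inner vertex by its three half-edges without a sign. -/
lemma orSign_flatMap {g g' : List S} (h : g.Perm g') (L : S → List T)
    (hodd : ∀ x ∈ g', (L x).length % 2 = 1) (hnd : (g'.flatMap L).Nodup) :
    orSign (g.flatMap L) (g'.flatMap L) = orSign g g' := by
  have hlen : ∀ p : List S, (∀ x ∈ p, (L x).length % 2 = 1) →
      (p.flatMap L).length % 2 = p.length % 2 := by
    intro p hp
    induction p with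
    | nil => rfl
    | cons b p ih =>
      have h1 := hp b (by simp)
      have h2 := ih fun x hx => hp x (List.mem_cons_of_mem _ hx)
      simp only [List.flatMap_cons, List.length_append, List.length_cons]
      omega
  have hpos : ∀ x ∈ g', L x ≠ [] := fun x hx h0 => by simpa [h0] using hodd x hx
  induction g generalizing g' with
  | nil =>
    have := h.symm.eq_nil
    subst this
    rfl
  | cons a l ih =>
    obtain ⟨p, q, rfl⟩ := List.append_of_mem (h.subset (List.mem_cons_self))
    have h1 : l.Perm (p ++ q) := (h.trans List.perm_middle).cons_inv
    have hd : (p.flatMap L ++ (L a ++ q.flatMap L)).Nodup := by simpa using hnd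
    have hap : a ∉ p := by
      intro hx
      obtain ⟨t, ht⟩ := List.exists_mem_of_ne_nil _ (hpos a (by simp))
      exact (List.disjoint_of_nodup_append hd) (List.mem_flatMap.2 ⟨a, hx, ht⟩) (by simp [ht])
    have hperm : (L a ++ p.flatMap L ++ q.flatMap L).Perm
        (p.flatMap L ++ L a ++ q.flatMap L) := List.perm_append_comm.append_right _
    have hpq : ((p ++ q).flatMap L).Nodup := by
      have h3 := hperm.nodup_iff.2 (by simpa using hd)
      rw [List.append_assoc] at h3
      have := (List.nodup_append.1 h3).2.1
      simpa using this
    have e1 : orSign (L a ++ l.flatMap L) (L a ++ (p ++ q).flatMap L) = orSign l (p ++ q) := by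
      rw [orSign_append_left]
      refine ih h1 (fun x hx => hodd x ?_) hpq (fun x hx => hpos x ?_) <;>
      · simp only [List.mem_append, List.mem_cons] at hx ⊢
        tauto
    have e2 : orSign (L a ++ p.flatMap L ++ q.flatMap L) (p.flatMap L ++ L a ++ q.flatMap L) =
        (-1) ^ p.length := by
      rw [orSign_append_comm (hperm.nodup_iff.2 (by simpa using hd))]
      apply units_neg_one_pow_eq
      rw [Nat.mul_mod, hodd a (by simp), hlen p (fun x hx => hodd x (by simp [hx]))]
      simp
    have hp1 : (L a ++ l.flatMap L).Perm (L a ++ (p ++ q).flatMap L) :=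
      List.Perm.append_left _ (h1.flatMap_right L)
    have hp2 : (L a ++ (p ++ q).flatMap L).Perm ((p ++ a :: q).flatMap L) := by
      simpa using hperm
    rw [List.flatMap_cons, ← orSign_trans hp1 hp2 hnd, e1, orSign_cons,
      List.idxOf_append_of_notMem hap, List.erase_append_right _ hap]
    simp only [List.idxOf_cons_self, List.erase_cons_head, add_zero]
    rw [mul_comm]
    congr 1
    simpa using e2

end Signs

/-! ### Combinatorics of forests -/

section Combinatorics

variable {α : Type*} [DecidableEq α] {I : Finset α} {W : Finset (Finset α)}

lemma mem_nodes {A : Finset α} : A ∈ nodes I W ↔ A ∈ W ∨ ∃ i ∈ I, A = {i} := by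
  simp [nodes, eq_comm]

lemma mem_children {v B : Finset α} :
    B ∈ children I W v ↔ B ∈ nodes I W ∧ B ⊂ v ∧ ∀ C ∈ nodes I W, C ⊂ v → ¬ B ⊂ C := by
  simp [children]

lemma mem_roots {B : Finset α} :
    B ∈ roots I W ↔ B ∈ nodes I W ∧ ∀ C ∈ nodes I W, ¬ B ⊂ C := by
  simp [roots]

lemma singleton_mem_nodes {i : α} (hi : i ∈ I) : {i} ∈ nodes I W := mem_nodes.2 (Or.inr ⟨i, hi, rfl⟩)

lemma mem_nodes_of_mem {A : Finset α} (hA : A ∈ W) : A ∈ nodes I W := mem_nodes.2 (Or.inl hA)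

lemma exists_root_ge {A : Finset α} (hA : A ∈ nodes I W) : ∃ X ∈ roots I W, A ⊆ X := by
  obtain ⟨X, hX, hm⟩ := (nodes I W).exists_le_maximal hA
  exact ⟨X, mem_roots.2 ⟨hm.1, fun C hC hlt => hlt.2 (hm.2 hC hlt.1)⟩, hX⟩

lemma exists_root_mem {i : α} (hi : i ∈ I) : ∃ X ∈ roots I W, i ∈ X := by
  obtain ⟨X, hX, h⟩ := exists_root_ge (W := W) (singleton_mem_nodes hi)
  exact ⟨X, hX, by simpa using h⟩

lemma exists_child_ge {v A : Finset α} (hA : A ∈ nodes I W) (hv : A ⊂ v) :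
    ∃ D ∈ children I W v, A ⊆ D := by
  obtain ⟨X, hX, hm⟩ := ((nodes I W).filter (· ⊂ v)).exists_le_maximal (a := A) (by simp [hA, hv])
  have h1 := Finset.mem_filter.1 hm.1
  exact ⟨X, mem_children.2 ⟨h1.1, h1.2, fun C hC hlt hXC =>
    hXC.2 (hm.2 (Finset.mem_filter.2 ⟨hC, hlt⟩) hXC.1)⟩, hX⟩

namespace IsForest

variable (h : IsForest I W)
include h

/-- Children lie strictly below their vertex, so the empty set would have none, against `binary`.
Together with `singleton_notMem` this recovers that leaves and inner vertices are different nodes.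
-/
lemma empty_notMem : ∅ ∉ W := by
  intro h0
  have := h.binary ∅ h0
  have h1 : children I W ∅ = ∅ := by
    ext B
    simp [mem_children, Finset.not_ssubset_empty]
  simp [h1] at this

lemma nodes_nonempty {A : Finset α} (hA : A ∈ nodes I W) : A.Nonempty := by
  rcases mem_nodes.1 hA with hA | ⟨i, -, rfl⟩
  · rw [Finset.nonempty_iff_ne_empty]
    rintro rfl
    exact h.empty_notMem hA
  · simp

lemma singleton_notMem (i : α) : {i} ∉ W := by
  intro h0
  have := h.binary _ h0
  have h1 : children I W {i} = ∅ := by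
    ext B
    simp only [mem_children, Finset.notMem_empty, iff_false, not_and]
    intro hB hlt
    have := h.nodes_nonempty hB
    rw [Finset.ssubset_singleton_iff] at hlt
    simp [hlt] at this
  simp [h1] at this

lemma nodes_subset {A : Finset α} (hA : A ∈ nodes I W) : A ⊆ I := by
  rcases mem_nodes.1 hA with hA | ⟨i, hi, rfl⟩
  · exact h.subset A hA
  · simpa using hi

lemma nodes_laminar {A B : Finset α} (hA : A ∈ nodes I W) (hB : B ∈ nodes I W) :
    A ⊆ B ∨ B ⊆ A ∨ Disjoint A B := by
  rcases mem_nodes.1 hA with hA | ⟨i, hi, rfl⟩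
  · rcases mem_nodes.1 hB with hB | ⟨j, hj, rfl⟩
    · exact h.laminar A hA B hB
    · by_cases hjA : j ∈ A
      · exact Or.inr (Or.inl (by simpa using hjA))
      · exact Or.inr (Or.inr (by simpa using hjA))
  · by_cases hiB : i ∈ B
    · exact Or.inl (by simpa using hiB)
    · exact Or.inr (Or.inr (by simpa using hiB))

lemma roots_disjoint {X Y : Finset α} (hX : X ∈ roots I W) (hY : Y ∈ roots I W) (hXY : X ≠ Y) :
    Disjoint X Y := by
  rw [mem_roots] at hX hY
  rcases h.nodes_laminar hX.1 hY.1 with h1 | h1 | h1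
  · exact absurd (lt_of_le_of_ne h1 hXY) (hX.2 Y hY.1)
  · exact absurd (lt_of_le_of_ne h1 hXY.symm) (hY.2 X hX.1)
  · exact h1

lemma root_nonempty {X : Finset α} (hX : X ∈ roots I W) : X.Nonempty :=
  h.nodes_nonempty (mem_roots.1 hX).1

lemma root_subset {X : Finset α} (hX : X ∈ roots I W) : X ⊆ I :=
  h.nodes_subset (mem_roots.1 hX).1

lemma root_eq_of_mem {X Y : Finset α} (hX : X ∈ roots I W) (hY : Y ∈ roots I W) {i : α}
    (hiX : i ∈ X) (hiY : i ∈ Y) : X = Y := by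
  by_contra hne
  exact Finset.disjoint_left.1 (h.roots_disjoint hX hY hne) hiX hiY

lemma node_subset_or_disjoint_root {A X : Finset α} (hA : A ∈ nodes I W) (hX : X ∈ roots I W) :
    A ⊆ X ∨ Disjoint A X := by
  obtain ⟨Y, hY, hAY⟩ := exists_root_ge hA
  by_cases hXY : Y = X
  · exact Or.inl (hXY ▸ hAY)
  · exact Or.inr (Finset.disjoint_of_subset_left hAY (h.roots_disjoint hY hX hXY))

lemma children_disjoint {v X Y : Finset α} (hX : X ∈ children I W v)
    (hY : Y ∈ children I W v) (hXY : X ≠ Y) : Disjoint X Y := by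
  rw [mem_children] at hX hY
  rcases h.nodes_laminar hX.1 hY.1 with h1 | h1 | h1
  · exact absurd (lt_of_le_of_ne h1 hXY) (hX.2.2 Y hY.1 hY.2.1)
  · exact absurd (lt_of_le_of_ne h1 hXY.symm) (hY.2.2 X hX.1 hX.2.1)
  · exact h1

/-- No leaf of `v` is lost: as `v` is not a singleton, each of its leaves is a node strictly below
`v` and so lies below one of the maximal ones, which are the children. -/
lemma exists_children {v : Finset α} (hv : v ∈ W) :
    ∃ X Y, X ≠ Y ∧ children I W v = {X, Y} ∧ v = X ∪ Y ∧ Disjoint X Y := by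
  obtain ⟨X, Y, hne, he⟩ := Finset.card_eq_two.1 (h.binary v hv)
  have hX : X ∈ children I W v := by simp [he]
  have hY : Y ∈ children I W v := by simp [he]
  refine ⟨X, Y, hne, he, ?_, h.children_disjoint hX hY hne⟩
  apply Finset.Subset.antisymm
  · intro i hi
    have hlt : {i} ⊂ v := by
      refine lt_of_le_of_ne (by simpa using hi) ?_
      rintro rfl
      exact h.singleton_notMem i hv
    obtain ⟨D, hD, hiD⟩ := exists_child_ge (W := W) (singleton_mem_nodes (h.subset v hv hi)) hlt
    rw [he] at hD
    simp only [Finset.mem_insert, Finset.mem_singleton] at hD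
    simp only [Finset.singleton_subset_iff] at hiD
    rcases hD with rfl | rfl <;> simp [hiD]
  · exact Finset.union_subset (mem_children.1 hX).2.1.1 (mem_children.1 hY).2.1.1

end IsForest

/-! #### Joining two trees -/

lemma nodes_insert (v : Finset α) : nodes I (insert v W) = insert v (nodes I W) := by
  simp [nodes, Finset.insert_union]

/-- By laminarity a node that is not below the root `X` avoids `X`, which leaves only `Y`. -/
lemma node_ssubset_union {X Y : Finset α} (h : IsForest I W) (hX : X ∈ roots I W) {B : Finset α} (hB : B ∈ nodes I W) (hlt : B ⊂ X ∪ Y) : B ⊆ X ∨ B ⊆ Y := by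
  rcases h.node_subset_or_disjoint_root hB hX with h1 | h1
  · exact Or.inl h1
  · right
    intro i hi
    have := hlt.1 hi
    rw [Finset.mem_union] at this
    exact this.resolve_left fun hiX => Finset.disjoint_left.1 h1 hi hiX

section Join

variable {X Y : Finset α} (h : IsForest I W) (hX : X ∈ roots I W) (hY : Y ∈ roots I W) (hXY : X ≠ Y)
include h hX hY hXY

lemma left_ssubset_union : X ⊂ X ∪ Y := by
  refine lt_of_le_of_ne Finset.subset_union_left fun e => ?_
  have hd := h.roots_disjoint hX hY hXY
  obtain ⟨i, hi⟩ := h.root_nonempty hY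
  have : i ∈ X := by rw [e]; simp [hi]
  exact Finset.disjoint_left.1 hd this hi

lemma right_ssubset_union : Y ⊂ X ∪ Y := by
  rw [Finset.union_comm]
  exact left_ssubset_union h hY hX hXY.symm

lemma union_notMem_nodes : X ∪ Y ∉ nodes I W := fun hv =>
  (mem_roots.1 hX).2 _ hv (left_ssubset_union h hX hY hXY)

lemma union_notMem : X ∪ Y ∉ W := fun hv =>
  union_notMem_nodes h hX hY hXY (mem_nodes_of_mem hv)

lemma not_union_ssubset {u : Finset α} (hu : u ∈ nodes I W) : ¬ X ∪ Y ⊂ u := fun hlt =>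
  (mem_roots.1 hX).2 _ hu ((left_ssubset_union h hX hY hXY).trans hlt)

lemma children_insert_of_mem {u : Finset α} (hu : u ∈ nodes I W) :
    children I (insert (X ∪ Y) W) u = children I W u := by
  have hn := not_union_ssubset h hX hY hXY hu
  ext B
  simp only [mem_children, nodes_insert, Finset.mem_insert, forall_eq_or_imp]
  constructor
  · rintro ⟨rfl | hB, hlt, -, hC⟩
    · exact absurd hlt hn
    · exact ⟨hB, hlt, hC⟩
  · rintro ⟨hB, hlt, hC⟩
    exact ⟨Or.inr hB, hlt, fun h' => absurd h' hn, hC⟩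

lemma children_insert_self : children I (insert (X ∪ Y) W) (X ∪ Y) = {X, Y} := by
  have hX' := mem_roots.1 hX
  have hY' := mem_roots.1 hY
  have h1 := left_ssubset_union h hX hY hXY
  have h2 := right_ssubset_union h hX hY hXY
  ext B
  simp only [mem_children, nodes_insert, Finset.mem_insert, forall_eq_or_imp,
    Finset.mem_singleton]
  constructor
  · rintro ⟨rfl | hB, hlt, -, hC⟩
    · exact absurd hlt (lt_irrefl _)
    · rcases node_ssubset_union h hX hB hlt with hs | hs
      · left
        by_contra hne
        exact hC X hX'.1 h1 (lt_of_le_of_ne hs hne)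
      · right
        by_contra hne
        exact hC Y hY'.1 h2 (lt_of_le_of_ne hs hne)
  · rintro (rfl | rfl)
    · exact ⟨Or.inr hX'.1, h1, fun h' => absurd h' (lt_irrefl _), fun C hC _ => hX'.2 C hC⟩
    · exact ⟨Or.inr hY'.1, h2, fun h' => absurd h' (lt_irrefl _), fun C hC _ => hY'.2 C hC⟩

lemma mem_roots_insert {A : Finset α} :
    A ∈ roots I (insert (X ∪ Y) W) ↔ A = X ∪ Y ∨ (A ∈ roots I W ∧ A ≠ X ∧ A ≠ Y) := by
  simp only [mem_roots, nodes_insert, Finset.mem_insert, forall_eq_or_imp]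
  constructor
  · rintro ⟨rfl | hA, h1, h2⟩
    · exact Or.inl rfl
    · refine Or.inr ⟨⟨hA, h2⟩, ?_, ?_⟩
      · rintro rfl
        exact h1 (left_ssubset_union h hX hY hXY)
      · rintro rfl
        exact h1 (right_ssubset_union h hX hY hXY)
  · rintro (rfl | ⟨⟨hA, h1⟩, h2, h3⟩)
    · exact ⟨Or.inl rfl, lt_irrefl _, fun C hC => not_union_ssubset h hX hY hXY hC⟩
    · refine ⟨Or.inr hA, fun hlt => ?_, h1⟩
      rcases node_ssubset_union h hX hA hlt with hs | hs
      · exact h1 X (mem_roots.1 hX).1 (lt_of_le_of_ne hs h2)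
      · exact h1 Y (mem_roots.1 hY).1 (lt_of_le_of_ne hs h3)

lemma IsForest.join : IsForest I (insert (X ∪ Y) W) where
  nonempty := h.nonempty
  subset := by
    intro A hA
    rcases Finset.mem_insert.1 hA with rfl | hA
    · exact Finset.union_subset (h.root_subset hX) (h.root_subset hY)
    · exact h.subset A hA
  laminar := by
    have key : ∀ A ∈ W, A ⊆ X ∪ Y ∨ Disjoint A (X ∪ Y) := by
      intro A hA
      rcases h.node_subset_or_disjoint_root (mem_nodes_of_mem hA) hX with h1 | h1
      · exact Or.inl (h1.trans Finset.subset_union_left)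
      · rcases h.node_subset_or_disjoint_root (mem_nodes_of_mem hA) hY with h2 | h2
        · exact Or.inl (h2.trans Finset.subset_union_right)
        · exact Or.inr (Finset.disjoint_union_right.2 ⟨h1, h2⟩)
    intro A hA B hB
    rcases Finset.mem_insert.1 hA with rfl | hA <;> rcases Finset.mem_insert.1 hB with rfl | hB
    · exact Or.inl (Finset.Subset.refl _)
    · rcases key B hB with h1 | h1
      · exact Or.inr (Or.inl h1)
      · exact Or.inr (Or.inr h1.symm)
    · rcases key A hA with h1 | h1
      · exact Or.inl h1
      · exact Or.inr (Or.inr h1)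
    · exact h.laminar A hA B hB
  binary := by
    intro A hA
    rcases Finset.mem_insert.1 hA with rfl | hA
    · rw [children_insert_self h hX hY hXY, Finset.card_pair hXY]
    · rw [children_insert_of_mem h hX hY hXY (mem_nodes_of_mem hA)]
      exact h.binary A hA

end Join

/-! #### Removal of the top vertex of a tree -/

section Erase

variable {v : Finset α} (h : IsForest I W) (hv : v ∈ W) (hr : v ∈ roots I W)
include h hv hr

lemma mem_nodes_erase {A : Finset α} : A ∈ nodes I (W.erase v) ↔ A ∈ nodes I W ∧ A ≠ v := by
  simp only [mem_nodes, Finset.mem_erase]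
  constructor
  · rintro (⟨h1, h2⟩ | ⟨i, hi, rfl⟩)
    · exact ⟨Or.inl h2, h1⟩
    · refine ⟨Or.inr ⟨i, hi, rfl⟩, ?_⟩
      rintro rfl
      exact h.singleton_notMem i hv
  · rintro ⟨h1 | h1, h2⟩
    · exact Or.inl ⟨h2, h1⟩
    · exact Or.inr h1

lemma children_erase {u : Finset α} (hu : u ∈ nodes I W) :
    children I (W.erase v) u = children I W u := by
  have hn : ¬ v ⊂ u := (mem_roots.1 hr).2 u hu
  ext B
  simp only [mem_children, mem_nodes_erase h hv hr]
  constructor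
  · rintro ⟨⟨h1, h2⟩, h3, h4⟩
    refine ⟨h1, h3, fun C hC hlt => ?_⟩
    by_cases hCv : C = v
    · exact absurd (hCv ▸ hlt) hn
    · exact h4 C ⟨hC, hCv⟩ hlt
  · rintro ⟨h1, h3, h4⟩
    refine ⟨⟨h1, ?_⟩, h3, fun C hC hlt => h4 C hC.1 hlt⟩
    rintro rfl
    exact hn h3

lemma IsForest.erase : IsForest I (W.erase v) where
  nonempty := h.nonempty
  subset := fun A hA => h.subset A (Finset.mem_of_mem_erase hA)
  laminar := fun A hA B hB =>
    h.laminar A (Finset.mem_of_mem_erase hA) B (Finset.mem_of_mem_erase hB)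
  binary := fun A hA => by
    rw [children_erase h hv hr (mem_nodes_of_mem (Finset.mem_of_mem_erase hA))]
    exact h.binary A (Finset.mem_of_mem_erase hA)

lemma child_mem_roots_erase {X : Finset α} (hX : X ∈ children I W v) :
    X ∈ roots I (W.erase v) := by
  rw [mem_children] at hX
  refine mem_roots.2 ⟨(mem_nodes_erase h hv hr).2 ⟨hX.1, hX.2.1.ne⟩, fun C hC hlt => ?_⟩
  rw [mem_nodes_erase h hv hr] at hC
  rcases h.node_subset_or_disjoint_root hC.1 hr with h1 | h1
  · exact hX.2.2 C hC.1 (lt_of_le_of_ne h1 hC.2) hlt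
  · obtain ⟨i, hi⟩ := h.nodes_nonempty hX.1
    exact Finset.disjoint_left.1 h1 (hlt.1 hi) (hX.2.1.1 hi)

end Erase

/-- The root above an inner vertex cannot be a leaf, since a nonempty set below a singleton is that
singleton. -/
lemma IsForest.exists_top (h : IsForest I W) (hW : W.Nonempty) : ∃ v ∈ W, v ∈ roots I W := by
  obtain ⟨v, hv⟩ := hW
  obtain ⟨X, hX, hvX⟩ := exists_root_ge (I := I) (mem_nodes_of_mem hv)
  rcases mem_nodes.1 (mem_roots.1 hX).1 with hXW | ⟨i, -, rfl⟩
  · exact ⟨X, hXW, hX⟩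
  · have : v = {i} := by
      obtain ⟨j, hj⟩ := h.nodes_nonempty (mem_nodes_of_mem hv)
      exact Finset.Subset.antisymm hvX (by
        have : j = i := by simpa using hvX hj
        simpa using this ▸ hj)
    exact absurd (this ▸ hv) (h.singleton_notMem i)

lemma isForest_empty (hI : I.Nonempty) : IsForest I ∅ where
  nonempty := hI
  subset := by simp
  laminar := by simp
  binary := by simp

/-- Every forest is obtained from the forest without inner vertices by joining pairs of trees. -/
lemma IsForest.induction {P : Finset (Finset α) → Prop} (hempty : I.Nonempty → P ∅)
    (hjoin : ∀ W, IsForest I W → ∀ X ∈ roots I W, ∀ Y ∈ roots I W, X ≠ Y → P W →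
      P (insert (X ∪ Y) W)) (h : IsForest I W) : P W := by
  induction hn : W.card generalizing W with
  | zero =>
    rw [Finset.card_eq_zero] at hn
    subst hn
    exact hempty h.nonempty
  | succ n ih =>
    obtain ⟨v, hv, hr⟩ := h.exists_top (Finset.card_pos.1 (by omega))
    obtain ⟨X, Y, hne, hc, hu, -⟩ := h.exists_children hv
    have hX := child_mem_roots_erase h hv hr (X := X) (by simp [hc])
    have hY := child_mem_roots_erase h hv hr (X := Y) (by simp [hc])
    have := hjoin (W.erase v) (h.erase hv hr) X hX Y hY hne
      (ih (h.erase hv hr) (by rw [Finset.card_erase_of_mem hv, hn]; rfl))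
    rwa [← hu, Finset.insert_erase hv] at this

lemma roots_empty_iff {A : Finset α} : A ∈ roots I ∅ ↔ ∃ i ∈ I, A = {i} := by
  have hn : ∀ B : Finset α, B ∈ nodes I ∅ ↔ ∃ i ∈ I, B = {i} := fun B => by simp [mem_nodes]
  simp only [mem_roots, hn]
  constructor
  · exact fun h => h.1
  · rintro ⟨i, hi, rfl⟩
    refine ⟨⟨i, hi, rfl⟩, ?_⟩
    rintro C ⟨j, hj, rfl⟩ hlt
    rw [Finset.ssubset_singleton_iff] at hlt
    simp at hlt

end Combinatorics

/-! ### The operators that join two trees of a forest -/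

section JoinOp

variable {α : Type*} [DecidableEq α] {I : Finset α} {W : Finset (Finset α)}

/-- `ρ` enumerates the roots of the forest with vertex set `W`. -/
def IsRootList (I : Finset α) (W : Finset (Finset α)) (ρ : List (Finset α)) : Prop :=
  ρ.Nodup ∧ ∀ X, X ∈ ρ ↔ X ∈ roots I W

lemma isRootList_toList : IsRootList I W (roots I W).toList :=
  ⟨Finset.nodup_toList _, fun _ => Finset.mem_toList⟩

lemma IsRootList.perm {ρ ρ' : List (Finset α)} (h : IsRootList I W ρ) (h' : IsRootList I W ρ') :
    ρ.Perm ρ' :=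
  (List.perm_ext_iff_of_nodup h.1 h'.1).2 fun X => (h.2 X).trans (h'.2 X).symm

lemma IsRootList.of_perm {ρ ρ' : List (Finset α)} (h : IsRootList I W ρ) (h' : ρ.Perm ρ') :
    IsRootList I W ρ' :=
  ⟨h'.nodup_iff.1 h.1, fun X => h'.mem_iff.symm.trans (h.2 X)⟩

lemma IsRootList.perm_toList {ρ : List (Finset α)} (h : IsRootList I W ρ) :
    ρ.Perm (roots I W).toList := h.perm isRootList_toList

lemma IsRootList.length {ρ : List (Finset α)} (h : IsRootList I W ρ) :
    ρ.length = (roots I W).card := by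
  rw [h.perm_toList.length_eq, Finset.length_toList]

lemma outer_of_isForest (h : IsForest I W) (a : List α) (ρ : List (Finset α)) :
    outer I W a ρ = (orSign a I.toList * orSign ρ (roots I W).toList) •
      Finsupp.single (⟨W, h⟩ : Forest I) (1 : ℚ) := by
  rw [outer, dif_pos h]

lemma single_eq_outer (F : Forest I) :
    (Finsupp.single F 1 : Bess I) = outer I F.verts I.toList (roots I F.verts).toList := by
  rw [outer_of_isForest F.isForest]
  simp

lemma outer_perm (a : List α) {ρ ρ' : List (Finset α)}
    (hρ : IsRootList I W ρ) (hρ' : IsRootList I W ρ') :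
    outer I W a ρ = orSign ρ ρ' • outer I W a ρ' := by
  by_cases h : IsForest I W
  · rw [outer_of_isForest h, outer_of_isForest h, smul_smul,
      ← orSign_trans (hρ.perm hρ') hρ'.perm_toList (Finset.nodup_toList _)]
    congr 1
    simp only [mul_left_comm]
  · simp [outer, dif_neg h]

lemma outer_perm_left {a a' : List α} (ha : a.Perm a') (ha' : a'.Perm I.toList)
    (ρ : List (Finset α)) :
    outer I W a ρ = orSign a a' • outer I W a' ρ := by
  by_cases h : IsForest I W
  · rw [outer_of_isForest h, outer_of_isForest h, smul_smul,
      ← orSign_trans ha ha' (Finset.nodup_toList _), mul_assoc]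
  · simp [outer, dif_neg h]

lemma outer_eq_toList_left (a : List α) (ρ : List (Finset α)) :
    outer I W a ρ = orSign a I.toList • outer I W I.toList ρ := by
  by_cases h : IsForest I W
  · rw [outer_of_isForest h, outer_of_isForest h, smul_smul, orSign_self, one_mul]
  · simp [outer, dif_neg h]

lemma bess_hom_ext {M : Type*} [AddCommGroup M] [Module ℚ M] {f g : Bess I →ₗ[ℚ] M}
    (h : ∀ F : Forest I, f (Finsupp.single F 1) = g (Finsupp.single F 1)) : f = g := by
  ext F
  simpa using h F

lemma map_units_smul {M N : Type*} [AddCommGroup M] [Module ℚ M] [AddCommGroup N] [Module ℚ N]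
    (f : M →ₗ[ℚ] N) (u : ℤˣ) (x : M) : f (u • x) = u • f x :=
  f.map_smul_of_tower u x

/-- The sum of the forests obtained from `F` by joining a tree with leaves in `B` and a tree with
leaves in `C`. -/
def joinOp (B C : Finset α) : Bess I →ₗ[ℚ] Bess I :=
  Finsupp.linearCombination ℚ fun F : Forest I =>
    ∑ X ∈ (roots I F.verts).filter (· ⊆ B), ∑ Y ∈ (roots I F.verts).filter (· ⊆ C),
      ((-1) ^ I.card * orSign (roots I F.verts).toList
        (X :: Y :: ((roots I F.verts).toList.erase X).erase Y)) •
        outer I (insert (X ∪ Y) F.verts) I.toList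
          ((X ∪ Y) :: ((roots I F.verts).toList.erase X).erase Y)

lemma IsRootList.ne {X Y : Finset α} {ρ : List (Finset α)}
    (hρ : IsRootList I W (X :: Y :: ρ)) : X ≠ Y := by
  have := hρ.1
  simp only [List.nodup_cons, List.mem_cons, not_or] at this
  exact this.1.1

lemma IsRootList.head_mem {X : Finset α} {ρ : List (Finset α)} (hρ : IsRootList I W (X :: ρ)) :
    X ∈ roots I W := (hρ.2 X).1 (by simp)

lemma IsRootList.head₂_mem {X Y : Finset α} {ρ : List (Finset α)}
    (hρ : IsRootList I W (X :: Y :: ρ)) : Y ∈ roots I W := (hρ.2 Y).1 (by simp)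

lemma IsRootList.join {X Y : Finset α} {ρ : List (Finset α)} (h : IsForest I W)
    (hρ : IsRootList I W (X :: Y :: ρ)) :
    IsRootList I (insert (X ∪ Y) W) ((X ∪ Y) :: ρ) := by
  have hX := hρ.head_mem
  have hY := hρ.head₂_mem
  have hne := hρ.ne
  have hnd := hρ.1
  simp only [List.nodup_cons, List.mem_cons, not_or] at hnd
  refine ⟨List.nodup_cons.2 ⟨fun hm => ?_, hnd.2.2⟩, fun A => ?_⟩
  · exact union_notMem_nodes h hX hY hne (mem_roots.1 ((hρ.2 _).1 (by simp [hm]))).1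
  · rw [mem_roots_insert h hX hY hne, List.mem_cons, ← hρ.2 A]
    simp only [List.mem_cons]
    constructor
    · rintro (h1 | h1)
      · exact Or.inl h1
      · exact Or.inr ⟨Or.inr (Or.inr h1), by rintro rfl; tauto, by rintro rfl; tauto⟩
    · tauto

lemma IsRootList.cons_cons_erase {X Y : Finset α} {ρ : List (Finset α)}
    (hρ : IsRootList I W ρ) (hX : X ∈ roots I W) (hY : Y ∈ roots I W) (hXY : X ≠ Y) :
    IsRootList I W (X :: Y :: (ρ.erase X).erase Y) := by
  refine hρ.of_perm ?_
  refine (List.perm_cons_erase ((hρ.2 X).2 hX)).trans (List.Perm.cons _ ?_)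
  exact List.perm_cons_erase ((List.mem_erase_of_ne hXY.symm).2 ((hρ.2 Y).2 hY))

lemma exists_rootList {X Y : Finset α} (hX : X ∈ roots I W) (hY : Y ∈ roots I W) (hXY : X ≠ Y) :
    ∃ ρ, IsRootList I W (X :: Y :: ρ) :=
  ⟨_, isRootList_toList.cons_cons_erase hX hY hXY⟩

lemma filter_roots_subset_root {X : Finset α} (hX : X ∈ roots I W) :
    (roots I W).filter (· ⊆ X) = {X} := by
  ext A
  simp only [Finset.mem_filter, Finset.mem_singleton]
  constructor
  · rintro ⟨hA, hs⟩
    by_contra hne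
    exact (mem_roots.1 hA).2 X (mem_roots.1 hX).1 (lt_of_le_of_ne hs hne)
  · rintro rfl
    exact ⟨hX, Finset.Subset.refl _⟩

lemma joinOp_single (B C : Finset α) (F : Forest I) :
    joinOp B C (Finsupp.single F 1) =
    ∑ X ∈ (roots I F.verts).filter (· ⊆ B), ∑ Y ∈ (roots I F.verts).filter (· ⊆ C),
      ((-1) ^ I.card * orSign (roots I F.verts).toList
        (X :: Y :: ((roots I F.verts).toList.erase X).erase Y)) •
        outer I (insert (X ∪ Y) F.verts) I.toList
          ((X ∪ Y) :: ((roots I F.verts).toList.erase X).erase Y) := by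
  simp [joinOp]

/-- Joining two given trees. -/
lemma joinOp_outer (h : IsForest I W) (a : List α) {X Y : Finset α} {ρ : List (Finset α)}
    (hρ : IsRootList I W (X :: Y :: ρ)) :
    joinOp X Y (outer I W a (X :: Y :: ρ)) =
      (-1 : ℤˣ) ^ I.card • outer I (insert (X ∪ Y) W) a ((X ∪ Y) :: ρ) := by
  have hX := hρ.head_mem
  have hY := hρ.head₂_mem
  have hne := hρ.ne
  set ρ' := ((roots I W).toList.erase X).erase Y with hρ'
  have h1 : IsRootList I W (X :: Y :: ρ') := isRootList_toList.cons_cons_erase hX hY hne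
  rw [outer_eq_toList_left a, outer_eq_toList_left a,
    outer_perm I.toList hρ (isRootList_toList), map_units_smul, map_units_smul,
    ← single_eq_outer ⟨W, h⟩, joinOp_single]
  simp only [filter_roots_subset_root hX, filter_roots_subset_root hY, Finset.sum_singleton]
  rw [← hρ', outer_perm I.toList (hρ.join h) (h1.join h), smul_smul, smul_smul, smul_smul,
    smul_smul]
  congr 1
  have e : orSign ρ ρ' = orSign (X :: Y :: ρ) (X :: Y :: ρ') := by
    rw [orSign_cons_cons, orSign_cons_cons]
  rw [orSign_cons_cons, e, ← orSign_trans hρ.perm_toList h1.perm_toList.symm h1.1]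
  simp only [mul_comm, mul_left_comm, mul_assoc]

/-- The operator is a sum over pairs of trees. -/
lemma joinOp_single_eq_sum {B C : Finset α} (F : Forest I) :
    joinOp B C (Finsupp.single F 1) =
    ∑ X ∈ (roots I F.verts).filter (· ⊆ B), ∑ Y ∈ (roots I F.verts).filter (· ⊆ C),
      joinOp X Y (Finsupp.single F 1 : Bess I) := by
  rw [joinOp_single]
  refine Finset.sum_congr rfl fun X hX => Finset.sum_congr rfl fun Y hY => ?_
  rw [Finset.mem_filter] at hX hY
  rw [joinOp_single, filter_roots_subset_root hX.1,
    filter_roots_subset_root hY.1]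
  simp

lemma ne_of_roots_subset {B C X Y : Finset α} (hBC : Disjoint B C) (h : IsForest I W)
    (hX : X ∈ roots I W) (hXB : X ⊆ B) (hYC : Y ⊆ C) : X ≠ Y := by
  rintro rfl
  obtain ⟨i, hi⟩ := h.root_nonempty hX
  exact Finset.disjoint_left.1 hBC (hXB hi) (hYC hi)

/-- Joining two given trees gives a forest, up to a sign. -/
lemma exists_joinOp_single_eq (F : Forest I) {X Y : Finset α} (hX : X ∈ roots I F.verts)
    (hY : Y ∈ roots I F.verts) (hXY : X ≠ Y) :
    ∃ u : ℤˣ, joinOp X Y (Finsupp.single F 1 : Bess I) = u •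
      Finsupp.single (⟨_, F.isForest.join hX hY hXY⟩ : Forest I) 1 := by
  obtain ⟨ρ, hρ⟩ := exists_rootList hX hY hXY
  refine ⟨orSign (roots I F.verts).toList (X :: Y :: ρ) * ((-1 : ℤˣ) ^ I.card * orSign ((X ∪ Y) :: ρ)
    (roots I (insert (X ∪ Y) F.verts)).toList), ?_⟩
  rw [single_eq_outer, outer_perm _ isRootList_toList hρ, map_units_smul,
    joinOp_outer F.isForest _ hρ, outer_perm _ (hρ.join F.isForest) isRootList_toList,
    single_eq_outer, mul_smul, mul_smul]

/-- The joined tree is symmetric in `X` and `Y`. Only the order of the two letters at the front of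
the root orientation changes. -/
lemma joinOp_swap_single (F : Forest I) {X Y : Finset α} (hX : X ∈ roots I F.verts)
    (hY : Y ∈ roots I F.verts) (hXY : X ≠ Y) :
    joinOp Y X (Finsupp.single F 1 : Bess I) = - joinOp X Y (Finsupp.single F 1) := by
  obtain ⟨ρ, hρ⟩ := exists_rootList hX hY hXY
  have hρ' := hρ.of_perm (List.Perm.swap Y X ρ)
  have e : (Finsupp.single F 1 : Bess I) = orSign (roots I F.verts).toList (X :: Y :: ρ) •
      outer I F.verts I.toList (X :: Y :: ρ) := by
    rw [single_eq_outer, outer_perm _ isRootList_toList hρ]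
  have e' : outer I F.verts I.toList (X :: Y :: ρ) =
      - outer I F.verts I.toList (Y :: X :: ρ) := by
    rw [outer_perm _ hρ hρ', orSign_swap hXY, Units.neg_smul, one_smul]
  rw [e, map_units_smul, map_units_smul, joinOp_outer F.isForest _ hρ, e', map_neg,
    joinOp_outer F.isForest _ hρ', Finset.union_comm, smul_neg]

lemma joinOp_swap {B C : Finset α} (hBC : Disjoint B C) :
    joinOp C B = - (joinOp B C : Bess I →ₗ[ℚ] Bess I) := by
  refine bess_hom_ext fun F => ?_
  rw [joinOp_single_eq_sum, LinearMap.neg_apply, joinOp_single_eq_sum,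
    Finset.sum_comm, ← Finset.sum_neg_distrib]
  refine Finset.sum_congr rfl fun X hX => ?_
  rw [← Finset.sum_neg_distrib]
  refine Finset.sum_congr rfl fun Y hY => ?_
  rw [Finset.mem_filter] at hX hY
  exact joinOp_swap_single F hX.1 hY.1 (ne_of_roots_subset hBC F.isForest hX.1 hX.2 hY.2)

/-- The operator `F ↦ (-1)^{|F|} F`. -/
def signOp : Bess I →ₗ[ℚ] Bess I :=
  Finsupp.linearCombination ℚ fun F : Forest I => (-1 : ℤˣ) ^ deg F • Finsupp.single F (1 : ℚ)

lemma signOp_single (F : Forest I) :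
    signOp (Finsupp.single F 1 : Bess I) = (-1 : ℤˣ) ^ deg F • Finsupp.single F 1 := by
  simp [signOp]

lemma signOp_outer (a : List α) (ρ : List (Finset α)) :
    signOp (outer I W a ρ) = (-1 : ℤˣ) ^ W.card • outer I W a ρ := by
  by_cases h : IsForest I W
  · rw [outer_of_isForest h, map_units_smul, signOp_single, smul_comm]
    rfl
  · simp [outer, dif_neg h]

lemma signOp_comp_signOp : signOp ∘ₗ signOp = (LinearMap.id : Bess I →ₗ[ℚ] Bess I) := by
  refine bess_hom_ext fun F => ?_
  simp only [LinearMap.comp_apply, signOp_single, map_units_smul, smul_smul, LinearMap.id_apply]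
  rw [Int.units_mul_self, one_smul]

/-- A join adds exactly one inner vertex. Disjointness of `B` and `C` ensures that two different
trees are joined. -/
lemma joinOp_comp_signOp {B C : Finset α} (hBC : Disjoint B C) :
    joinOp B C ∘ₗ signOp = - (signOp ∘ₗ joinOp B C : Bess I →ₗ[ℚ] Bess I) := by
  refine bess_hom_ext fun F => ?_
  rw [LinearMap.comp_apply, signOp_single, map_units_smul, LinearMap.neg_apply,
    LinearMap.comp_apply, joinOp_single_eq_sum, Finset.smul_sum, map_sum,
    ← Finset.sum_neg_distrib]
  refine Finset.sum_congr rfl fun X hX => ?_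
  rw [Finset.smul_sum, map_sum, ← Finset.sum_neg_distrib]
  refine Finset.sum_congr rfl fun Y hY => ?_
  rw [Finset.mem_filter] at hX hY
  have hne := ne_of_roots_subset hBC F.isForest hX.1 hX.2 hY.2
  obtain ⟨u, hu⟩ := exists_joinOp_single_eq F hX.1 hY.1 hne
  rw [hu, map_units_smul, signOp_single, deg, deg,
    Finset.card_insert_of_notMem (union_notMem F.isForest hX.1 hY.1 hne), pow_succ]
  rw [smul_comm u, mul_smul, Units.neg_smul, one_smul, smul_neg, neg_neg]

/-- The trees `X`, `Y` and `X ∪ Y` are not contained in `B`, so the join changes nothing among the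
trees inside `B`. -/
lemma mem_filter_roots_join (F : Forest I) {X Y B : Finset α} (hX : X ∈ roots I F.verts)
    (hY : Y ∈ roots I F.verts) (hXY : X ≠ Y) (hXB : Disjoint X B) (hYB : Disjoint Y B) :
    (roots I (insert (X ∪ Y) F.verts)).filter (· ⊆ B) = (roots I F.verts).filter (· ⊆ B) := by
  have key : ∀ {A : Finset α}, A.Nonempty → Disjoint A B → ¬ A ⊆ B := by
    rintro A ⟨i, hi⟩ hd hs
    exact Finset.disjoint_left.1 hd hi (hs hi)
  ext A
  simp only [Finset.mem_filter, mem_roots_insert F.isForest hX hY hXY]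
  constructor
  · rintro ⟨rfl | h1, h2⟩
    · exact absurd (Finset.subset_union_left.trans h2) (key (F.isForest.root_nonempty hX) hXB)
    · exact ⟨h1.1, h2⟩
  · rintro ⟨h1, h2⟩
    refine ⟨Or.inr ⟨h1, ?_, ?_⟩, h2⟩
    · rintro rfl
      exact key (F.isForest.root_nonempty hX) hXB h2
    · rintro rfl
      exact key (F.isForest.root_nonempty hY) hYB h2

/-- Moving the pair `X ∧ Y` past `X' ∧ Y'`, or past a single root, is an even permutation. The two
orders of joining therefore differ only by the transposition of the new roots `X ∪ Y` and `X' ∪ Y'`.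
-/
lemma joinOp_joinOp_single (F : Forest I) {X Y X' Y' : Finset α} {ρ : List (Finset α)}
    (hρ : IsRootList I F.verts (X :: Y :: X' :: Y' :: ρ)) :
    joinOp X Y (joinOp X' Y' (Finsupp.single F 1 : Bess I)) =
      - joinOp X' Y' (joinOp X Y (Finsupp.single F 1)) := by
  have hp : (X :: Y :: X' :: Y' :: ρ).Perm (X' :: Y' :: X :: Y :: ρ) := by
    have := (List.perm_append_comm (l₁ := [X, Y]) (l₂ := [X', Y'])).append_right ρ
    simpa using this
  have hs : orSign (X :: Y :: X' :: Y' :: ρ) (X' :: Y' :: X :: Y :: ρ) = 1 := by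
    have := orSign_append_comm (l := [X, Y]) (m := [X', Y']) (n := ρ) (by simpa using hρ.1)
    simpa [pow_succ] using this
  have hρ' := hρ.of_perm hp
  have h1 := hρ.join F.isForest
  have h1' := hρ'.join F.isForest
  have hp2 : ((X ∪ Y) :: X' :: Y' :: ρ).Perm (X' :: Y' :: (X ∪ Y) :: ρ) := by
    have := (List.perm_append_comm (l₁ := [X ∪ Y]) (l₂ := [X', Y'])).append_right ρ
    simpa using this
  have hp2' : ((X' ∪ Y') :: X :: Y :: ρ).Perm (X :: Y :: (X' ∪ Y') :: ρ) := by
    have := (List.perm_append_comm (l₁ := [X' ∪ Y']) (l₂ := [X, Y])).append_right ρ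
    simpa using this
  have hs2 : orSign ((X ∪ Y) :: X' :: Y' :: ρ) (X' :: Y' :: (X ∪ Y) :: ρ) = 1 := by
    have := orSign_append_comm (l := [X ∪ Y]) (m := [X', Y']) (n := ρ) (by simpa using h1.1)
    simpa [pow_succ] using this
  have hs2' : orSign ((X' ∪ Y') :: X :: Y :: ρ) (X :: Y :: (X' ∪ Y') :: ρ) = 1 := by
    have := orSign_append_comm (l := [X' ∪ Y']) (m := [X, Y]) (n := ρ) (by simpa using h1'.1)
    simpa [pow_succ] using this
  have h2 := h1.of_perm hp2
  have h2' := h1'.of_perm hp2'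
  have hF := F.isForest.join hρ.head_mem hρ.head₂_mem hρ.ne
  have hF' := F.isForest.join hρ'.head_mem hρ'.head₂_mem hρ'.ne
  have e : (Finsupp.single F 1 : Bess I) = orSign (roots I F.verts).toList
      (X :: Y :: X' :: Y' :: ρ) • outer I F.verts I.toList (X :: Y :: X' :: Y' :: ρ) := by
    rw [single_eq_outer, outer_perm _ isRootList_toList hρ]
  have h3 := h2.join hF
  have h3' := h2'.join hF'
  rw [e, map_units_smul, map_units_smul, map_units_smul, map_units_smul,
    joinOp_outer F.isForest _ hρ, outer_perm _ hρ hρ', hs, one_smul,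
    joinOp_outer F.isForest _ hρ', map_units_smul, map_units_smul, outer_perm _ h1 h2, hs2,
    outer_perm _ h1' h2', hs2', one_smul, one_smul, joinOp_outer hF _ h2, joinOp_outer hF' _ h2']
  rw [Finset.insert_comm] at h3'
  rw [Finset.insert_comm (X ∪ Y), outer_perm _ h3' h3, orSign_swap (fun e => by
    have := h3.ne; exact this e.symm), Units.neg_smul, one_smul, smul_neg, smul_neg, smul_neg]

/-- Since the four sets are pairwise disjoint, a join inside `B'` and `C'` does not affect the trees
available in `B` and `C`. Both composites are thus sums over the same quadruples of trees, and the
claim is checked term by term. -/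
lemma joinOp_anticomm {B C B' C' : Finset α} (hBC : Disjoint B C) (hBC' : Disjoint B' C')
    (hBB : Disjoint B B') (hBC1 : Disjoint B C') (hCB : Disjoint C B') (hCC : Disjoint C C') :
    joinOp B C ∘ₗ joinOp B' C' = - (joinOp B' C' ∘ₗ joinOp B C : Bess I →ₗ[ℚ] Bess I) := by
  have key : ∀ {B C B' C' : Finset α}, Disjoint B C → Disjoint B' C' → Disjoint B B' →
      Disjoint B C' → Disjoint C B' → Disjoint C C' → ∀ F : Forest I,
      joinOp B C (joinOp B' C' (Finsupp.single F 1 : Bess I)) =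
      ∑ q ∈ (roots I F.verts).filter (· ⊆ B') ×ˢ (roots I F.verts).filter (· ⊆ C'),
        ∑ p ∈ (roots I F.verts).filter (· ⊆ B) ×ˢ (roots I F.verts).filter (· ⊆ C),
        joinOp p.1 p.2 (joinOp q.1 q.2 (Finsupp.single F 1 : Bess I)) := by
    intro B C B' C' hBC hBC' hBB hBC1 hCB hCC F
    rw [joinOp_single_eq_sum, map_sum, Finset.sum_product]
    refine Finset.sum_congr rfl fun X' hX' => ?_
    rw [map_sum]
    refine Finset.sum_congr rfl fun Y' hY' => ?_
    rw [Finset.mem_filter] at hX' hY'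
    have hne := ne_of_roots_subset hBC' F.isForest hX'.1 hX'.2 hY'.2
    obtain ⟨u, hu⟩ := exists_joinOp_single_eq F hX'.1 hY'.1 hne
    rw [hu, map_units_smul, joinOp_single_eq_sum, Finset.sum_product]
    simp only [map_units_smul, ← Finset.smul_sum]
    rw [mem_filter_roots_join F hX'.1 hY'.1 hne, mem_filter_roots_join F hX'.1 hY'.1 hne]
    · exact Finset.disjoint_of_subset_left hX'.2 hCB.symm
    · exact Finset.disjoint_of_subset_left hY'.2 hCC.symm
    · exact Finset.disjoint_of_subset_left hX'.2 hBB.symm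
    · exact Finset.disjoint_of_subset_left hY'.2 hBC1.symm
  refine bess_hom_ext fun F => ?_
  rw [LinearMap.neg_apply, LinearMap.comp_apply, LinearMap.comp_apply,
    key hBC hBC' hBB hBC1 hCB hCC, key hBC' hBC hBB.symm hCB.symm hBC1.symm hCC.symm]
  rw [Finset.sum_comm, ← Finset.sum_neg_distrib]
  refine Finset.sum_congr rfl fun p hp => ?_
  rw [← Finset.sum_neg_distrib]
  refine Finset.sum_congr rfl fun q hq => ?_
  simp only [Finset.mem_product, Finset.mem_filter] at hp hq
  obtain ⟨⟨hX, hXB⟩, hY, hYC⟩ := hp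
  obtain ⟨⟨hX', hXB'⟩, hY', hYC'⟩ := hq
  have hne := ne_of_roots_subset hBC F.isForest hX hXB hYC
  have hne' := ne_of_roots_subset hBC' F.isForest hX' hXB' hYC'
  have h1 := ne_of_roots_subset hBB F.isForest hX hXB hXB'
  have h2 := ne_of_roots_subset hBC1 F.isForest hX hXB hYC'
  have h3 := ne_of_roots_subset hCB F.isForest hY hYC hXB'
  have h4 := ne_of_roots_subset hCC F.isForest hY hYC hYC'
  obtain ⟨ρ, hρ⟩ := exists_rootList hX hY hne
  have hX'' : q.1 ∈ ρ := by
    have := (hρ.2 q.1).2 hX'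
    simpa [h1.symm, h3.symm] using this
  have hY'' : q.2 ∈ ρ.erase q.1 := by
    have := (hρ.2 q.2).2 hY'
    rw [List.mem_erase_of_ne hne'.symm]
    simpa [h2.symm, h4.symm] using this
  have hρ2 := hρ.of_perm ((((List.perm_cons_erase hX'').trans
    ((List.perm_cons_erase hY'').cons _)).cons _).cons _)
  exact joinOp_joinOp_single F hρ2

/-- Additivity of the operator in `B` and `C` on forests the trees of which do not overlap several
parts. -/
lemma joinOp_additive (F : Forest I) {B C : Finset α}
    {S T : Finset (Finset α)} (hS : ∀ X ∈ S, ∀ Y ∈ S, X ≠ Y → Disjoint X Y)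
    (hT : ∀ X ∈ T, ∀ Y ∈ T, X ≠ Y → Disjoint X Y)
    (hSB : ∀ X ∈ S, X ⊆ B) (hTC : ∀ Y ∈ T, Y ⊆ C)
    (hB : ∀ A ∈ roots I F.verts, A ⊆ B → ∃ X ∈ S, A ⊆ X)
    (hC : ∀ A ∈ roots I F.verts, A ⊆ C → ∃ Y ∈ T, A ⊆ Y) :
    joinOp B C (Finsupp.single F 1 : Bess I) =
      ∑ X ∈ S, ∑ Y ∈ T, joinOp X Y (Finsupp.single F 1) := by
  have key : ∀ {B : Finset α} {S : Finset (Finset α)},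
      (∀ X ∈ S, ∀ Y ∈ S, X ≠ Y → Disjoint X Y) → (∀ X ∈ S, X ⊆ B) →
      (∀ A ∈ roots I F.verts, A ⊆ B → ∃ X ∈ S, A ⊆ X) → ∀ f : Finset α → Bess I,
      ∑ A ∈ (roots I F.verts).filter (· ⊆ B), f A =
        ∑ X ∈ S, ∑ A ∈ (roots I F.verts).filter (· ⊆ X), f A := by
    intro B S hS hSB hB f
    rw [← Finset.sum_biUnion]
    · refine Finset.sum_congr ?_ fun _ _ => rfl
      ext A
      simp only [Finset.mem_filter, Finset.mem_biUnion]
      constructor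
      · rintro ⟨h1, h2⟩
        obtain ⟨X, hX, hAX⟩ := hB A h1 h2
        exact ⟨X, hX, h1, hAX⟩
      · rintro ⟨X, hX, h1, h2⟩
        exact ⟨h1, h2.trans (hSB X hX)⟩
    · intro X hX Y hY hne
      rw [Function.onFun, Finset.disjoint_left]
      intro A hA hA'
      rw [Finset.mem_filter] at hA hA'
      obtain ⟨i, hi⟩ := F.isForest.root_nonempty hA.1
      exact Finset.disjoint_left.1 (hS X hX Y hY hne) (hA.2 hi) (hA'.2 hi)
  rw [joinOp_single_eq_sum, key hS hSB hB]
  refine Finset.sum_congr rfl fun X hX => ?_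
  have : ∀ Y ∈ T, joinOp X Y (Finsupp.single F 1 : Bess I) =
      ∑ A ∈ (roots I F.verts).filter (· ⊆ X), ∑ A' ∈ (roots I F.verts).filter (· ⊆ Y),
        joinOp A A' (Finsupp.single F 1) := fun Y hY =>
    joinOp_single_eq_sum F
  refine Eq.trans ?_ (Finset.sum_congr rfl this).symm
  rw [Finset.sum_comm (s := T)]
  refine Finset.sum_congr rfl fun A hA => ?_
  rw [key hT hTC hC]

end JoinOp

/-! ### Substitution of a forest for a leaf -/

section Subst

variable {α : Type*} [DecidableEq α] {I J : Finset α} {W : Finset (Finset α)}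

lemma path_empty (h : IsForest I ∅) (s : α) : path (⟨∅, h⟩ : Forest I) s = [] := by
  simp [path]

lemma mem_path {F : Forest I} {s : α} {A : Finset α} : A ∈ path F s ↔ A ∈ F.verts ∧ s ∈ A := by
  rw [path, (List.perm_insertionSort _ _).mem_iff, Finset.mem_toList, Finset.mem_filter]

section

variable {X Y : Finset α} (h : IsForest I W) (hX : X ∈ roots I W) (hY : Y ∈ roots I W) (hXY : X ≠ Y)
include hX hY hXY

lemma path_join_of_notMem {s : α} (hs : s ∉ X ∪ Y) :
    path (⟨insert (X ∪ Y) W, h.join hX hY hXY⟩ : Forest I) s = path ⟨W, h⟩ s := by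
  simp [path, Finset.filter_insert, hs]

/-- The new vertex contains every other vertex on the path of `s`, so it is the one closest to the
root. -/
lemma path_join_of_mem {s : α} (hs : s ∈ X) :
    path (⟨insert (X ∪ Y) W, h.join hX hY hXY⟩ : Forest I) s = path ⟨W, h⟩ s ++ [X ∪ Y] := by
  have hF := h.join hX hY hXY
  have hsub : ∀ A ∈ W, s ∈ A → A ⊆ X := by
    intro A hA hsA
    rcases h.node_subset_or_disjoint_root (mem_nodes_of_mem hA) hX with h1 | h1
    · exact h1
    · exact absurd hs (Finset.disjoint_left.1 h1 hsA)
  have : Std.Total fun A B : Finset α => A.card ≤ B.card := ⟨fun A B => le_total _ _⟩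
  have : IsTrans (Finset α) fun A B : Finset α => A.card ≤ B.card := ⟨fun A B C => le_trans⟩
  -- Two lists with the same entries that are sorted by cardinality coincide here, because the
  -- vertices containing `s` form a chain, on which cardinality is injective.
  refine List.Perm.eq_of_pairwise (le := fun A B : Finset α => A.card ≤ B.card) ?_
    (List.pairwise_insertionSort _ _) ?_ ?_
  · intro A B hA hB h1 h2
    rw [mem_path] at hA
    have hB' : B ∈ insert (X ∪ Y) W ∧ s ∈ B := by
      rcases List.mem_append.1 hB with hB | hB
      · rw [mem_path] at hB
        exact ⟨Finset.mem_insert_of_mem hB.1, hB.2⟩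
      · rw [List.mem_singleton] at hB
        subst hB
        simp [hs]
    rcases hF.laminar A hA.1 B hB'.1 with h3 | h3 | h3
    · exact Finset.eq_of_subset_of_card_le h3 h2
    · exact (Finset.eq_of_subset_of_card_le h3 h1).symm
    · exact absurd hB'.2 (Finset.disjoint_left.1 h3 hA.2)
  · rw [List.pairwise_append]
    refine ⟨List.pairwise_insertionSort _ _, by simp, fun A hA B hB => ?_⟩
    rw [List.mem_singleton] at hB
    subst hB
    rw [mem_path] at hA
    exact Finset.card_le_card ((hsub A hA.1 hA.2).trans Finset.subset_union_left)
  · refine (List.perm_insertionSort _ _).trans ?_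
    have h1 : (insert (X ∪ Y) W).filter (fun A => s ∈ A) =
        insert (X ∪ Y) (W.filter (fun A => s ∈ A)) := by
      rw [Finset.filter_insert, if_pos (by simp [hs])]
    have h2 : X ∪ Y ∉ W.filter (fun A => s ∈ A) := fun hm =>
      union_notMem h hX hY hXY (Finset.mem_filter.1 hm).1
    show (Finset.filter (fun A => s ∈ A) (insert (X ∪ Y) W)).toList.Perm _
    rw [h1]
    refine (Finset.toList_insert h2).trans ?_
    refine ((List.perm_insertionSort (fun A B : Finset α => A.card ≤ B.card)
      (W.filter (fun A => s ∈ A)).toList).symm.cons _).trans ?_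
    exact (List.perm_append_comm (l₁ := [X ∪ Y]))

lemma siblings_join_of_notMem {s : α} (hs : s ∉ X ∪ Y) :
    siblings (⟨insert (X ∪ Y) W, h.join hX hY hXY⟩ : Forest I) s = siblings ⟨W, h⟩ s := by
  rw [siblings, siblings, path_join_of_notMem h hX hY hXY hs]
  refine List.map_congr_left fun A hA => ?_
  rw [mem_path] at hA
  rw [children_insert_of_mem h hX hY hXY (mem_nodes_of_mem hA.1)]

lemma siblings_join_of_mem {s : α} (hs : s ∈ X) :
    siblings (⟨insert (X ∪ Y) W, h.join hX hY hXY⟩ : Forest I) s = siblings ⟨W, h⟩ s ++ [Y] := by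
  have hsY : s ∉ Y := Finset.disjoint_left.1 (h.roots_disjoint hX hY hXY) hs
  rw [siblings, siblings, path_join_of_mem h hX hY hXY hs, List.map_append]
  congr 1
  · refine List.map_congr_left fun A hA => ?_
    rw [mem_path] at hA
    rw [children_insert_of_mem h hX hY hXY (mem_nodes_of_mem hA.1)]
  · simp [children_insert_self h hX hY hXY, Finset.filter_insert, Finset.filter_singleton, hs, hsY]

lemma subst_join_of_notMem {s : α} (hs : s ∉ X ∪ Y) (ρ : List (Finset α))
    (W' : Finset (Finset α)) :
    subst (⟨insert (X ∪ Y) W, h.join hX hY hXY⟩ : Forest I) s ρ W' = subst ⟨W, h⟩ s ρ W' := by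
  rw [subst, subst, siblings_join_of_notMem h hX hY hXY hs]

/-- The new vertex comes last on the path of `s`, so it contributes one final use of the
distributive law, with the tree `Y` hanging off the path. -/
lemma subst_join_of_mem {s : α} (hs : s ∈ X) (ρ : List (Finset α)) (W' : Finset (Finset α)) :
    subst (⟨insert (X ∪ Y) W, h.join hX hY hXY⟩ : Forest I) s ρ W' =
      (subst ⟨W, h⟩ s ρ W').flatMap (graft Y) := by
  rw [subst, subst, siblings_join_of_mem h hX hY hXY hs, List.foldl_append]
  rfl

end

lemma subst_empty (h : IsForest I ∅) (s : α) (ρ : List (Finset α)) (W' : Finset (Finset α)) :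
    subst (⟨∅, h⟩ : Forest I) s ρ W' = [(ρ, W')] := by
  simp [subst, siblings, path_empty]

lemma graft_get (S : Finset α) (p : List (Finset α) × Finset (Finset α)) {k : ℕ}
    (hk : k < p.1.length) :
    ∃ l₁ A l₂, p.1 = l₁ ++ A :: l₂ ∧ l₁.length = k ∧ p.1.getD k ∅ = A ∧
      p.1.modify k (fun A => A ∪ S) = l₁ ++ (A ∪ S) :: l₂ := by
  refine ⟨p.1.take k, p.1[k], p.1.drop (k + 1), by simp, by simp; omega, ?_, ?_⟩
  · simp [hk]
  · rw [List.modify_eq_take_cons_drop hk]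

lemma exists_of_mem_graft {S : Finset α} {p q : List (Finset α) × Finset (Finset α)}
    (hq : q ∈ graft S p) : ∃ l₁ A l₂, p.1 = l₁ ++ A :: l₂ ∧
      q = (l₁ ++ (A ∪ S) :: l₂, insert (A ∪ S) p.2) := by
  simp only [graft, List.mem_map, List.mem_range] at hq
  obtain ⟨k, hk, rfl⟩ := hq
  obtain ⟨l₁, A, l₂, h1, -, h2, h3⟩ := graft_get S p hk
  exact ⟨l₁, A, l₂, h1, by rw [h2, h3]⟩

/-! #### Enlarging the set of leaves -/

section Mono

variable {K : Finset α}

lemma mem_nodes_of_subset (hJK : J ⊆ K) {A : Finset α} :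
    A ∈ nodes K W ↔ A ∈ nodes J W ∨ ∃ i ∈ K \ J, A = {i} := by
  simp only [mem_nodes, Finset.mem_sdiff]
  constructor
  · rintro (h1 | ⟨i, hi, rfl⟩)
    · exact Or.inl (Or.inl h1)
    · by_cases hiJ : i ∈ J
      · exact Or.inl (Or.inr ⟨i, hiJ, rfl⟩)
      · exact Or.inr ⟨i, ⟨hi, hiJ⟩, rfl⟩
  · rintro ((h1 | ⟨i, hi, rfl⟩) | ⟨i, hi, rfl⟩)
    · exact Or.inl h1
    · exact Or.inr ⟨i, hJK hi, rfl⟩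
    · exact Or.inr ⟨i, hi.1, rfl⟩

variable (h : IsForest J W) (hJK : J ⊆ K)
include hJK

lemma children_of_subset {v : Finset α} (hv : v ⊆ J) : children K W v = children J W v := by
  have key : ∀ C ⊆ v, C ∈ nodes K W ↔ C ∈ nodes J W := by
    intro C hC
    rw [mem_nodes_of_subset hJK]
    refine ⟨fun h1 => h1.resolve_right ?_, Or.inl⟩
    rintro ⟨i, hi, rfl⟩
    exact (Finset.mem_sdiff.1 hi).2 (hv (by simpa using hC))
  ext B
  simp only [mem_children]
  constructor
  · rintro ⟨h1, h2, h3⟩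
    exact ⟨(key B h2.1).1 h1, h2, fun C hC hlt => h3 C ((key C hlt.1).2 hC) hlt⟩
  · rintro ⟨h1, h2, h3⟩
    exact ⟨(key B h2.1).2 h1, h2, fun C hC hlt => h3 C ((key C hlt.1).1 hC) hlt⟩

include h

lemma IsForest.mono : IsForest K W where
  nonempty := h.nonempty.mono hJK
  subset := fun A hA => (h.subset A hA).trans hJK
  laminar := h.laminar
  binary := fun A hA => by rw [children_of_subset hJK (h.subset A hA)]; exact h.binary A hA

lemma mem_roots_of_subset {A : Finset α} :
    A ∈ roots K W ↔ A ∈ roots J W ∨ ∃ i ∈ K \ J, A = {i} := by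
  simp only [mem_roots, mem_nodes_of_subset hJK]
  constructor
  · rintro ⟨h1 | h1, h2⟩
    · exact Or.inl ⟨h1, fun C hC => h2 C (Or.inl hC)⟩
    · exact Or.inr h1
  · rintro (⟨h1, h2⟩ | ⟨i, hi, rfl⟩)
    · refine ⟨Or.inl h1, ?_⟩
      rintro C (hC | ⟨i, hi, rfl⟩) hlt
      · exact h2 C hC hlt
      · rw [Finset.ssubset_singleton_iff] at hlt
        have := h.nodes_nonempty h1
        simp [hlt] at this
    · refine ⟨Or.inr ⟨i, hi, rfl⟩, ?_⟩
      rintro C (hC | ⟨j, hj, rfl⟩) hlt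
      · exact (Finset.mem_sdiff.1 hi).2 (h.nodes_subset hC (by simpa using hlt.1))
      · rw [Finset.ssubset_singleton_iff] at hlt
        simp at hlt

end Mono

/-! #### The forests that arise by substitution -/

/-- The conditions satisfied by the terms of a substitution of a forest on `J` for the leaf `s` of
the forest `W` on `I`. -/
structure IsSubstTerm (I J : Finset α) (s : α) (W : Finset (Finset α))
    (p : List (Finset α) × Finset (Finset α)) : Prop where
  isForest : IsForest (I.erase s ∪ J) (W.filter (fun A => s ∉ A) ∪ p.2)
  nodup : p.1.Nodup
  mem_roots_iff : ∀ X, X ∈ roots (I.erase s ∪ J) (W.filter (fun A => s ∉ A) ∪ p.2) ↔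
    (X ∈ roots I W ∧ s ∉ X) ∨ X ∈ p.1
  below : ∀ A ∈ p.1, ∀ X ∈ roots I W, s ∈ X → A ⊆ X.erase s ∪ J

/-- A tree produced by the substitution has its leaves in `J` or in the tree of `s`. Another tree
`X` of the original forest meets neither. -/
lemma IsSubstTerm.disjoint {s : α} (hd : Disjoint (I.erase s) J) (hs : s ∈ I)
    (h : IsForest I W) {p : List (Finset α) × Finset (Finset α)} (hp : IsSubstTerm I J s W p)
    {A : Finset α} (hA : A ∈ p.1) {X : Finset α} (hX : X ∈ roots I W) (hsX : s ∉ X) :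
    Disjoint A X := by
  obtain ⟨τ, hτ, hsτ⟩ := exists_root_mem (W := W) hs
  rw [Finset.disjoint_left]
  intro i hiA hiX
  have h1 := hp.below A hA τ hτ hsτ hiA
  rw [Finset.mem_union] at h1
  rcases h1 with h1 | h1
  · rw [h.root_eq_of_mem hτ hX (Finset.mem_of_mem_erase h1) hiX] at hsτ
    exact hsX hsτ
  · refine Finset.disjoint_left.1 hd (Finset.mem_erase.2 ⟨?_, h.root_subset hX hiX⟩) h1
    rintro rfl
    exact hsX hiX

lemma IsSubstTerm.notMem {s : α} (hd : Disjoint (I.erase s) J) (hs : s ∈ I)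
    (h : IsForest I W) {p : List (Finset α) × Finset (Finset α)} (hp : IsSubstTerm I J s W p)
    {X : Finset α} (hX : X ∈ roots I W) (hsX : s ∉ X) : X ∉ p.1 := by
  intro hXp
  obtain ⟨i, hi⟩ := h.root_nonempty hX
  exact Finset.disjoint_left.1 (hp.disjoint hd hs h hXp hX hsX) hi hi

/-- As `s ∈ X`, the vertex `X ∪ Y` lies on the path of `s` and is dropped by the filter. Its place
is taken by the vertex `A ∪ Y`, where `A` is the chosen tree of the substituted forest; so a graft
is a join of the roots `A` and `Y` of the composite forest. -/
lemma IsSubstTerm.of_graft {s : α} (hd : Disjoint (I.erase s) J) (hs : s ∈ I) (h : IsForest I W)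
    {X Y : Finset α} (hX : X ∈ roots I W) (hY : Y ∈ roots I W) (hXY : X ≠ Y) (hsX : s ∈ X)
    {p q : List (Finset α) × Finset (Finset α)} (hP : IsSubstTerm I J s W p)
    (hq : q ∈ graft Y p) : IsSubstTerm I J s (insert (X ∪ Y) W) q := by
  obtain ⟨l₁, A, l₂, h1, rfl⟩ := exists_of_mem_graft hq
  have hsY : s ∉ Y := Finset.disjoint_left.1 (h.roots_disjoint hX hY hXY) hsX
  have hAp : A ∈ p.1 := by simp [h1]
  have hAr := (hP.mem_roots_iff A).2 (Or.inr hAp)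
  have hYr := (hP.mem_roots_iff Y).2 (Or.inl ⟨hY, hsY⟩)
  have hYp : Y ∉ p.1 := hP.notMem hd hs h hY hsY
  have hAY : A ≠ Y := fun e => hYp (e ▸ hAp)
  have e1 : (insert (X ∪ Y) W).filter (fun A => s ∉ A) = W.filter (fun A => s ∉ A) := by
    rw [Finset.filter_insert, if_neg (by simp [hsX])]
  have e2 : W.filter (fun A => s ∉ A) ∪ insert (A ∪ Y) p.2 =
      insert (A ∪ Y) (W.filter (fun A => s ∉ A) ∪ p.2) := by
    rw [Finset.union_insert]
  have hnd := hP.nodup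
  rw [h1] at hnd
  have hnd' := List.nodup_cons.1 (List.perm_middle.nodup_iff.1 hnd)
  refine ⟨by rw [e1]; simpa only [e2] using hP.isForest.join hAr hYr hAY, ?_, fun Z => ?_, ?_⟩
  · simp only
    rw [List.perm_middle.nodup_iff, List.nodup_cons]
    refine ⟨fun hm => ?_, hnd'.2⟩
    refine union_notMem_nodes hP.isForest hAr hYr hAY (mem_roots.1 ((hP.mem_roots_iff _).2
      (Or.inr ?_))).1
    rw [h1]
    exact List.perm_middle.mem_iff.2 (List.mem_cons_of_mem _ hm)
  · simp only [e1, e2]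
    rw [mem_roots_insert hP.isForest hAr hYr hAY, mem_roots_insert h hX hY hXY, hP.mem_roots_iff]
    have hZY : Z ∈ p.1 → Z ≠ Y := fun hZ e => hYp (e ▸ hZ)
    have hZX : s ∉ Z → Z ≠ X := fun hZ e => hZ (e ▸ hsX)
    have hZA : Z ∈ roots I W → s ∉ Z → Z ≠ A := fun hZ hsZ e =>
      hP.notMem hd hs h hZ hsZ (e ▸ hAp)
    have hl : Z ∈ l₁ ++ (A ∪ Y) :: l₂ ↔ Z = A ∪ Y ∨ Z ∈ p.1 ∧ Z ≠ A := by
      rw [h1, List.perm_middle.mem_iff, List.perm_middle.mem_iff, List.mem_cons, List.mem_cons]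
      refine or_congr Iff.rfl ⟨fun hZ => ⟨Or.inr hZ, ?_⟩, fun hZ => hZ.1.resolve_left hZ.2⟩
      rintro rfl
      exact hnd'.1 hZ
    have hZv : s ∉ Z → Z ≠ X ∪ Y := fun hZ e => hZ (e ▸ by simp [hsX])
    rw [hl]
    constructor
    · rintro (h2 | ⟨⟨h2, h3⟩ | h2, h4, h5⟩)
      · exact Or.inr (Or.inl h2)
      · exact Or.inl ⟨Or.inr ⟨h2, hZX h3, h5⟩, h3⟩
      · exact Or.inr (Or.inr ⟨h2, h4⟩)
    · rintro (⟨h2 | ⟨h2, h3, h4⟩, h5⟩ | h2 | ⟨h2, h3⟩)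
      · exact absurd h2 (hZv h5)
      · exact Or.inr ⟨Or.inl ⟨h2, h5⟩, hZA h2 h5, h4⟩
      · exact Or.inl h2
      · exact Or.inr ⟨Or.inr h2, h3, hZY h2⟩
  · intro B hB τ hτ hsτ
    have hτ' : τ = X ∪ Y := (h.join hX hY hXY).root_eq_of_mem hτ
      ((mem_roots_insert h hX hY hXY).2 (Or.inl rfl)) hsτ (by simp [hsX])
    subst hτ'
    have hsub : X.erase s ∪ J ⊆ (X ∪ Y).erase s ∪ J :=
      Finset.union_subset_union (Finset.erase_subset_erase _ Finset.subset_union_left)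
        (Finset.Subset.refl _)
    have hb : ∀ B ∈ p.1, B ⊆ (X ∪ Y).erase s ∪ J := fun B hB =>
      (hP.below B hB X hX hsX).trans hsub
    simp only [List.mem_append, List.mem_cons] at hB
    rcases hB with hB | rfl | hB
    · exact hb B (by simp [h1, hB])
    · refine Finset.union_subset (hb A hAp) ?_
      intro i hi
      have : i ≠ s := fun e => hsY (e ▸ hi)
      simp [hi, this]
    · exact hb B (by simp [h1, hB])

/-- A vertex off the path of `s` survives the substitution, and its two subtrees are still roots of
the composite forest. -/
lemma IsSubstTerm.join_of_notMem {s : α} (hd : Disjoint (I.erase s) J) (hs : s ∈ I)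
    (h : IsForest I W) {X Y : Finset α} (hX : X ∈ roots I W) (hY : Y ∈ roots I W) (hXY : X ≠ Y)
    (hsv : s ∉ X ∪ Y) {p : List (Finset α) × Finset (Finset α)} (hP : IsSubstTerm I J s W p) :
    IsSubstTerm I J s (insert (X ∪ Y) W) p := by
  have hsX : s ∉ X := fun e => hsv (by simp [e])
  have hsY : s ∉ Y := fun e => hsv (by simp [e])
  have hXr := (hP.mem_roots_iff X).2 (Or.inl ⟨hX, hsX⟩)
  have hYr := (hP.mem_roots_iff Y).2 (Or.inl ⟨hY, hsY⟩)
  have e1 : (insert (X ∪ Y) W).filter (fun A => s ∉ A) ∪ p.2 =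
      insert (X ∪ Y) (W.filter (fun A => s ∉ A) ∪ p.2) := by
    rw [Finset.filter_insert, if_pos hsv, Finset.insert_union]
  refine ⟨by rw [e1]; exact hP.isForest.join hXr hYr hXY, hP.nodup, fun Z => ?_, ?_⟩
  · rw [e1, mem_roots_insert hP.isForest hXr hYr hXY, mem_roots_insert h hX hY hXY,
      hP.mem_roots_iff]
    have hZX : Z ∈ p.1 → Z ≠ X := fun hZ e => hP.notMem hd hs h hX hsX (e ▸ hZ)
    have hZY : Z ∈ p.1 → Z ≠ Y := fun hZ e => hP.notMem hd hs h hY hsY (e ▸ hZ)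
    have hZv : Z = X ∪ Y → s ∉ Z := fun e => e ▸ hsv
    tauto
  · intro A hA τ hτ hsτ
    rw [mem_roots_insert h hX hY hXY] at hτ
    rcases hτ with rfl | hτ
    · exact absurd hsτ hsv
    · exact hP.below A hA τ hτ.1 hsτ

/-- Induction over the joins that build `W`: a join off the path of `s` changes nothing in the list
of terms, a join on the path replaces each term by its grafts. In the base case the result is the
forest on `J` together with the other leaves of `I` as isolated trees. -/
lemma isSubstTerm_of_mem {s : α} (hd : Disjoint (I.erase s) J) (hs : s ∈ I) (G : Forest J)
    {ρ : List (Finset α)} (hρ : IsRootList J G.verts ρ) (h : IsForest I W) :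
    ∀ p ∈ subst ⟨W, h⟩ s ρ G.verts, IsSubstTerm I J s W p := by
  suffices H : ∀ (h : IsForest I W), ∀ p ∈ subst ⟨W, h⟩ s ρ G.verts, IsSubstTerm I J s W p from H h
  refine h.induction (P := fun W => ∀ h : IsForest I W, ∀ p ∈ subst ⟨W, h⟩ s ρ G.verts,
    IsSubstTerm I J s W p) ?_ ?_
  · intro hI h p hp
    rw [subst_empty, List.mem_singleton] at hp
    subst hp
    have hJK : J ⊆ I.erase s ∪ J := Finset.subset_union_right
    refine ⟨by simpa using G.isForest.mono hJK, hρ.1, fun X => ?_, fun A hA X _ _ => ?_⟩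
    · simp only [Finset.filter_empty, Finset.empty_union]
      rw [mem_roots_of_subset G.isForest hJK, hρ.2, or_comm]
      refine or_congr ?_ Iff.rfl
      rw [roots_empty_iff]
      constructor
      · rintro ⟨i, hi, rfl⟩
        simp only [Finset.mem_sdiff, Finset.mem_union, Finset.mem_erase] at hi
        obtain ⟨⟨h1, h2⟩ | h1, h3⟩ := hi
        · exact ⟨⟨i, h2, rfl⟩, by simpa using h1.symm⟩
        · exact absurd h1 h3
      · rintro ⟨⟨i, hi, rfl⟩, h2⟩
        have h3 : i ≠ s := fun e => h2 (by simp [e])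
        have h4 : i ∈ I.erase s := Finset.mem_erase.2 ⟨h3, hi⟩
        exact ⟨i, Finset.mem_sdiff.2 ⟨Finset.mem_union_left _ h4,
          Finset.disjoint_left.1 hd h4⟩, rfl⟩
    · exact (G.isForest.root_subset ((hρ.2 A).1 hA)).trans Finset.subset_union_right
  · intro W h X hX Y hY hXY ih h' p hp
    by_cases hsv : s ∈ X ∪ Y
    · rcases Finset.mem_union.1 hsv with hsX | hsY
      · rw [subst_join_of_mem h hX hY hXY hsX, List.mem_flatMap] at hp
        obtain ⟨p', hp', hp⟩ := hp
        exact (ih h p' hp').of_graft hd hs h hX hY hXY hsX hp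
      · simp only [Finset.union_comm X Y] at hp ⊢
        rw [subst_join_of_mem h hY hX hXY.symm hsY, List.mem_flatMap] at hp
        obtain ⟨p', hp', hp⟩ := hp
        exact (ih h p' hp').of_graft hd hs h hY hX hXY.symm hsY hp
    · rw [subst_join_of_notMem h hX hY hXY hsv] at hp
      exact (ih h p hp).join_of_notMem hd hs h hX hY hXY hsv

/-- A root list of a term of a substitution. -/
lemma IsSubstTerm.isRootList {s : α} (hd : Disjoint (I.erase s) J) (hs : s ∈ I)
    (h : IsForest I W) {p : List (Finset α) × Finset (Finset α)} (hp : IsSubstTerm I J s W p)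
    {ρ : List (Finset α)} {τ : Finset α} (hρ : IsRootList I W (ρ ++ [τ])) (hτ : s ∈ τ) :
    IsRootList (I.erase s ∪ J) (W.filter (fun A => s ∉ A) ∪ p.2) (ρ ++ p.1) := by
  have hτr : τ ∈ roots I W := (hρ.2 τ).1 (by simp)
  have hτn : τ ∉ ρ := by
    have := hρ.1
    rw [List.nodup_append] at this
    intro hm
    exact this.2.2 τ hm τ (by simp) rfl
  have key : ∀ X, X ∈ ρ ↔ X ∈ roots I W ∧ s ∉ X := by
    intro X
    rw [← hρ.2 X]
    constructor
    · intro hX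
      refine ⟨by simp [hX], fun hsX => ?_⟩
      have := h.root_eq_of_mem ((hρ.2 X).1 (by simp [hX])) hτr hsX hτ
      exact hτn (this ▸ hX)
    · rintro ⟨hX, hsX⟩
      rcases List.mem_append.1 hX with hX | hX
      · exact hX
      · rw [List.mem_singleton] at hX
        exact absurd (hX ▸ hτ) hsX
  refine ⟨List.nodup_append.2 ⟨(List.nodup_append.1 hρ.1).1, hp.nodup, ?_⟩, fun X => ?_⟩
  · rintro X hX Y hY rfl
    exact hp.notMem hd hs h ((key X).1 hX).1 ((key X).1 hX).2 hY
  · rw [List.mem_append, hp.mem_roots_iff, key]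

end Subst

/-! ### Composition and the joining operators -/

section Comp

variable {α : Type*} [DecidableEq α] {I J : Finset α} {W : Finset (Finset α)}

lemma bilin_single {M : Type*} [AddCommGroup M] [Module ℚ M] (c : Forest I → Forest J → M)
    (F : Forest I) (G : Forest J) :
    bilin c (Finsupp.single F 1) (Finsupp.single G 1) = c F G := by
  simp [bilin]

lemma comp_single (s : α) (F : Forest I) (G : Forest J) :
    comp I J s (Finsupp.single F 1) (Finsupp.single G 1) = basisComp I J s F G :=
  bilin_single _ F G

lemma smul_sum_map {M β : Type*} [AddCommGroup M] (u : ℤˣ) (l : List β) (f : β → M) :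
    u • (l.map f).sum = (l.map fun b => u • f b).sum := by
  induction l with
  | nil => simp
  | cons b l ih => simp [smul_add, ih]

lemma toList_union_perm {s : α} (hd : Disjoint (I.erase s) J) {a : List α}
    (ha : (a ++ [s]).Perm I.toList) : (a ++ J.toList).Perm (I.erase s ∪ J).toList := by
  have hnd : (a ++ [s]).Nodup := ha.nodup_iff.2 (Finset.nodup_toList _)
  have hmem : ∀ i, i ∈ a ↔ i ∈ I.erase s := by
    intro i
    have h1 := ha.mem_iff (a := i)
    rw [Finset.mem_toList] at h1
    rw [Finset.mem_erase, ← h1]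
    constructor
    · intro hi
      refine ⟨?_, by simp [hi]⟩
      rintro rfl
      exact (List.nodup_append.1 hnd).2.2 i hi i (by simp) rfl
    · rintro ⟨h2, h3⟩
      simpa [h2] using h3
  refine (List.perm_ext_iff_of_nodup ?_ (Finset.nodup_toList _)).2 fun i => ?_
  · refine List.nodup_append.2 ⟨(List.nodup_append.1 hnd).1, Finset.nodup_toList _, ?_⟩
    rintro i hi j hj rfl
    exact Finset.disjoint_left.1 hd ((hmem i).1 hi) (Finset.mem_toList.1 hj)
  · simp only [List.mem_append, Finset.mem_toList, hmem, Finset.mem_union]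

/-- The partial composition, for any orientations of the form `a ∧ s` and `ρ ∧ τ`. -/
lemma comp_outer {s : α} (hd : Disjoint (I.erase s) J) (hs : s ∈ I) (h : IsForest I W)
    (G : Forest J) {a : List α} (ha : (a ++ [s]).Perm I.toList) {ρ : List (Finset α)}
    {τ : Finset α} (hρ : IsRootList I W (ρ ++ [τ])) (hτ : s ∈ τ) :
    comp I J s (outer I W (a ++ [s]) (ρ ++ [τ])) (Finsupp.single G 1) =
      (-1 : ℤˣ) ^ (ρ.length * (J.card - 1)) •
        ((subst ⟨W, h⟩ s (roots J G.verts).toList G.verts).map fun p =>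
          outer (I.erase s ∪ J) (W.filter (fun A => s ∉ A) ∪ p.2) (a ++ J.toList)
            (ρ ++ p.1)).sum := by
  set a' := I.toList.erase s with ha'
  have ha1 : (a' ++ [s]).Perm I.toList :=
    List.perm_append_comm.trans (List.perm_cons_erase (Finset.mem_toList.2 hs)).symm
  have ha2 : a'.Perm a := by
    have : (s :: a').Perm (s :: a) :=
      ((List.perm_append_comm (l₁ := a')).symm.trans (ha1.trans ha.symm)).trans
        List.perm_append_comm
    exact this.cons_inv
  set ρ' := (roots I W).toList.filter (fun A => s ∉ A) with hρ'
  set τ' := (roots I W).toList.filter (fun A => s ∈ A) with hτ'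
  have hτr : τ ∈ roots I W := (hρ.2 τ).1 (by simp)
  -- Different trees are disjoint, so a single one contains `s`.
  have hτ1 : τ' = [τ] := by
    refine List.perm_singleton.1 ((List.perm_ext_iff_of_nodup
      ((Finset.nodup_toList _).filter _) (by simp)).2 fun X => ?_)
    simp only [List.mem_filter, Finset.mem_toList, decide_eq_true_eq, List.mem_singleton]
    constructor
    · rintro ⟨h1, h2⟩
      exact h.root_eq_of_mem h1 hτr h2 hτ
    · rintro rfl
      exact ⟨hτr, hτ⟩
  have hρ1 : (ρ' ++ τ').Perm (roots I W).toList := by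
    refine (List.perm_ext_iff_of_nodup ?_ (Finset.nodup_toList _)).2 fun X => ?_
    · refine List.nodup_append.2 ⟨(Finset.nodup_toList _).filter _,
        (Finset.nodup_toList _).filter _, ?_⟩
      rintro X hX Y hY rfl
      simp only [hρ', hτ', List.mem_filter, decide_eq_true_eq] at hX hY
      exact hX.2 hY.2
    · simp only [hρ', hτ', List.mem_append, List.mem_filter, decide_eq_true_eq]
      tauto
  rw [hτ1] at hρ1
  have hρ1' : IsRootList I W (ρ' ++ [τ]) := isRootList_toList.of_perm hρ1.symm
  have hρ2 : ρ'.Perm ρ := by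
    have : (τ :: ρ').Perm (τ :: ρ) :=
      ((List.perm_append_comm (l₁ := ρ')).symm.trans (hρ1'.perm hρ)).trans List.perm_append_comm
    exact this.cons_inv
  have hlen : (roots I W).card - 1 = ρ.length := by
    rw [← hρ.length]
    simp
  have hterm : ∀ p ∈ subst ⟨W, h⟩ s (roots J G.verts).toList G.verts,
      outer (I.erase s ∪ J) (W.filter (fun A => s ∉ A) ∪ p.2) (a' ++ J.toList) (ρ' ++ p.1) =
      (orSign a' a * orSign ρ' ρ) •
      outer (I.erase s ∪ J) (W.filter (fun A => s ∉ A) ∪ p.2) (a ++ J.toList) (ρ ++ p.1) := by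
    intro p hp
    have hP := isSubstTerm_of_mem hd hs G isRootList_toList h p hp
    rw [outer_perm_left (ha2.append_right _) (toList_union_perm hd ha),
      outer_perm _ (hP.isRootList hd hs h hρ1' hτ) (hP.isRootList hd hs h hρ hτ),
      orSign_append_right ha2, orSign_append_right hρ2, smul_smul]
  have e0 : outer I W (a ++ [s]) (ρ ++ [τ]) =
      (orSign (a ++ [s]) I.toList * orSign (ρ ++ [τ]) (roots I W).toList) •
        Finsupp.single (⟨W, h⟩ : Forest I) (1 : ℚ) := outer_of_isForest h _ _
  rw [e0, map_units_smul, LinearMap.smul_apply, comp_single]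
  unfold basisComp
  simp only
  rw [← ha', ← hρ', ← hτ', hτ1, hlen, List.map_congr_left hterm, ← smul_sum_map, smul_smul,
    smul_smul]
  congr 1
  -- The reorderings from `a` to the reference order, to `a'` and back to `a` form a closed loop,
  -- hence have trivial total sign. The same holds for the roots in `e2`.
  have e1 : orSign (a ++ [s]) I.toList * orSign I.toList (a' ++ [s]) * orSign a' a = 1 := by
    rw [orSign_trans ha ha1.symm (ha1.nodup_iff.2 (Finset.nodup_toList _)),
      orSign_append_right ha2.symm, orSign_symm ha2.symm ((List.nodup_append.1
        (ha1.nodup_iff.2 (Finset.nodup_toList _))).1), Int.units_mul_self]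
  have e2 : orSign (ρ ++ [τ]) (roots I W).toList * orSign (roots I W).toList (ρ' ++ [τ]) *
      orSign ρ' ρ = 1 := by
    rw [orSign_trans hρ.perm_toList hρ1.symm hρ1'.1, orSign_append_right hρ2.symm,
      orSign_symm hρ2.symm ((List.nodup_append.1 hρ1'.1).1), Int.units_mul_self]
  calc _ = (-1 : ℤˣ) ^ (ρ.length * (J.card - 1)) * (orSign (a ++ [s]) I.toList *
        orSign I.toList (a' ++ [s]) * orSign a' a) * (orSign (ρ ++ [τ]) (roots I W).toList *
        orSign (roots I W).toList (ρ' ++ [τ]) * orSign ρ' ρ) := by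
        simp only [mul_comm, mul_left_comm, mul_assoc]
    _ = _ := by rw [e1, e2, mul_one, mul_one]

/-- The set of leaves `X` after substitution of a forest on `J` for the leaf `s`. -/
def substSet (J : Finset α) (s : α) (X : Finset α) : Finset α :=
  if s ∈ X then X.erase s ∪ J else X

lemma joinOp_outer_eq_sum (h : IsForest I W) (a : List α) (ρ : List (Finset α))
    (B C : Finset α) : joinOp B C (outer I W a ρ) =
      ∑ X ∈ (roots I W).filter (· ⊆ B), ∑ Y ∈ (roots I W).filter (· ⊆ C),
        joinOp X Y (outer I W a ρ) := by
  simp only [outer_of_isForest h, map_units_smul, ← Finset.smul_sum]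
  rw [joinOp_single_eq_sum]

omit [DecidableEq α] in
lemma list_sum_map_eq_range {M : Type*} [AddCommMonoid M] (l : List (Finset α))
    (f : Finset α → M) :
    (l.map f).sum = ((List.range l.length).map fun k => f (l.getD k ∅)).sum := by
  congr 1
  apply List.ext_getElem
  · simp
  · intro n h1 h2
    simp only [List.length_map] at h1
    simp [h1]

lemma exists_perm_append_singleton {β : Type*} [DecidableEq β] {l : List β} {b : β} (hb : b ∈ l) :
    (l.erase b ++ [b]).Perm l :=
  List.perm_append_comm.trans (List.perm_cons_erase hb).symm

lemma card_erase_union {s : α} (hd : Disjoint (I.erase s) J) (hs : s ∈ I) :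
    (I.erase s ∪ J).card + 1 = I.card + J.card := by
  rw [Finset.card_union_of_disjoint hd]
  have := Finset.card_erase_add_one hs
  omega

/-- Joining the tree `Y` with one of the trees that result from a substitution. -/
lemma joinOp_substTerm {s : α} (hd : Disjoint (I.erase s) J) (hs : s ∈ I)
    (h : IsForest I W) {X Y : Finset α} {ρ : List (Finset α)}
    (hρ : IsRootList I W ((Y :: ρ) ++ [X])) (hsX : s ∈ X)
    {p : List (Finset α) × Finset (Finset α)} (hP : IsSubstTerm I J s W p) (b : List α) :
    joinOp (X.erase s ∪ J) Y (outer (I.erase s ∪ J) (W.filter (fun A => s ∉ A) ∪ p.2) b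
        (Y :: (ρ ++ p.1))) =
      (-(-1 : ℤˣ) ^ (I.erase s ∪ J).card) • ((graft Y p).map fun q =>
        outer (I.erase s ∪ J) (W.filter (fun A => s ∉ A) ∪ q.2) b (ρ ++ q.1)).sum := by
  have hX : X ∈ roots I W := (hρ.2 X).1 (by simp)
  have hY : Y ∈ roots I W := (hρ.2 Y).1 (by simp)
  have hXY : X ≠ Y := by
    rintro rfl
    have := hρ.1
    simp at this
  have hsY : s ∉ Y := Finset.disjoint_left.1 (h.roots_disjoint hX hY hXY) hsX
  have hYr := (hP.mem_roots_iff Y).2 (Or.inl ⟨hY, hsY⟩)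
  have hR : IsRootList (I.erase s ∪ J) (W.filter (fun A => s ∉ A) ∪ p.2) (Y :: (ρ ++ p.1)) :=
    hP.isRootList hd hs h hρ hsX
  -- The trees inside the enlarged leaf set of `X` are exactly those produced by the substitution;
  -- the old trees other than `X` avoid it. The sum in `joinOp` therefore runs over the same trees
  -- as the grafts.
  have hfil : (roots (I.erase s ∪ J) (W.filter (fun A => s ∉ A) ∪ p.2)).filter
      (· ⊆ X.erase s ∪ J) = p.1.toFinset := by
    ext A
    rw [Finset.mem_filter, hP.mem_roots_iff, List.mem_toFinset]
    constructor
    · rintro ⟨⟨h1, h2⟩ | h1, h3⟩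
      · exfalso
        have hAX : A ≠ X := fun e => h2 (e ▸ hsX)
        obtain ⟨i, hi⟩ := h.root_nonempty h1
        rcases Finset.mem_union.1 (h3 hi) with h4 | h4
        · exact Finset.disjoint_left.1 (h.roots_disjoint h1 hX hAX) hi (Finset.mem_of_mem_erase h4)
        · refine Finset.disjoint_left.1 hd (Finset.mem_erase.2 ⟨?_, h.root_subset h1 hi⟩) h4
          rintro rfl
          exact h2 hi
      · exact h1
    · exact fun h1 => ⟨Or.inr h1, hP.below A h1 X hX hsX⟩
  rw [joinOp_outer_eq_sum hP.isForest, hfil, filter_roots_subset_root hYr,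
    List.sum_toFinset _ hP.nodup, list_sum_map_eq_range, smul_sum_map, graft, List.map_map]
  congr 1
  refine List.map_congr_left fun k hk => ?_
  rw [List.mem_range] at hk
  obtain ⟨l₁, A, l₂, h1, -, h2, h3⟩ := graft_get Y p hk
  simp only [Function.comp, h2, h3, Finset.sum_singleton]
  have hperm : (Y :: (ρ ++ p.1)).Perm (A :: Y :: (ρ ++ (l₁ ++ l₂))) := by
    rw [h1]
    have := List.perm_middle (l₁ := Y :: (ρ ++ l₁)) (a := A) (l₂ := l₂)
    simpa using this
  -- On its way to the front `A` passes `Y`, `ρ` and `l₁`, while `A ∪ Y` returns past `ρ` and `l₁`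
  -- only. The one extra letter is the minus sign in the statement.
  have hsgn : orSign (Y :: (ρ ++ p.1)) (A :: Y :: (ρ ++ (l₁ ++ l₂))) =
      (-1) ^ (ρ.length + l₁.length + 1) := by
    have := orSign_middle_cons (l := Y :: (ρ ++ l₁)) (a := A) (m := l₂)
      (by have := hR.1; rw [h1] at this; simpa using this)
    rw [h1]
    simpa using this
  have hR1 := hR.of_perm hperm
  have hR2 := hR1.join hP.isForest
  have hperm2 : ((A ∪ Y) :: (ρ ++ (l₁ ++ l₂))).Perm (ρ ++ (l₁ ++ (A ∪ Y) :: l₂)) := by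
    have := (List.perm_middle (l₁ := ρ ++ l₁) (a := A ∪ Y) (l₂ := l₂)).symm
    simpa using this
  have hR3 := hR2.of_perm hperm2
  have hsgn2 : orSign ((A ∪ Y) :: (ρ ++ (l₁ ++ l₂))) (ρ ++ (l₁ ++ (A ∪ Y) :: l₂)) =
      (-1) ^ (ρ.length + l₁.length) := by
    have := orSign_cons_middle (l := ρ ++ l₁) (a := A ∪ Y) (m := l₂) (by
      have := (List.nodup_cons.1 hR2.1).1
      simp only [List.mem_append] at this ⊢
      tauto)
    simpa using this
  rw [outer_perm b hR hR1, map_units_smul, joinOp_outer hP.isForest b hR1,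
    outer_perm b hR2 hR3, hsgn, hsgn2, Finset.union_insert, smul_smul, smul_smul]
  congr 1
  rw [pow_succ]
  calc _ = -((-1 : ℤˣ) ^ (I.erase s ∪ J).card * ((-1 : ℤˣ) ^ (ρ.length + l₁.length) *
      (-1 : ℤˣ) ^ (ρ.length + l₁.length))) := by
        simp only [mul_neg, one_mul, neg_mul, mul_assoc, mul_comm]
    _ = _ := by rw [Int.units_mul_self, mul_one]

lemma sum_flatMap_map {M β γ : Type*} [AddCommMonoid M] (l : List β) (g : β → List γ)
    (f : γ → M) : ((l.flatMap g).map f).sum = (l.map fun b => ((g b).map f).sum).sum := by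
  induction l with
  | nil => simp
  | cons b l ih => simp [ih]

/-- Substitution pushes the forest down through the vertex `X ∪ Y` last of all. This grafts `Y` on
each tree that has replaced `X`, which is what the joining operator for the enlarged leaf set does.
-/
lemma comp_joinOp_of_mem {s : α} (hd : Disjoint (I.erase s) J) (hs : s ∈ I) (F : Forest I)
    (G : Forest J) {X Y : Finset α} (hX : X ∈ roots I F.verts) (hY : Y ∈ roots I F.verts)
    (hXY : X ≠ Y) (hsX : s ∈ X) :
    comp I J s (joinOp X Y (Finsupp.single F 1)) (Finsupp.single G 1) =
      joinOp (X.erase s ∪ J) Y (comp I J s (Finsupp.single F 1) (Finsupp.single G 1)) := by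
  obtain ⟨W, h⟩ := F
  obtain ⟨ρ, hρ⟩ := exists_rootList hX hY hXY
  set a := I.toList.erase s with ha
  have ha1 : (a ++ [s]).Perm I.toList := exists_perm_append_singleton (Finset.mem_toList.2 hs)
  have hp : (X :: Y :: ρ).Perm ((Y :: ρ) ++ [X]) := by
    have := List.perm_append_comm (l₁ := [X]) (l₂ := Y :: ρ)
    simpa using this
  have hρ' := hρ.of_perm hp
  have hF := h.join hX hY hXY
  have hρ2 := hρ.join h
  have hp2 : ((X ∪ Y) :: ρ).Perm (ρ ++ [X ∪ Y]) := by
    have := List.perm_append_comm (l₁ := [X ∪ Y]) (l₂ := ρ)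
    simpa using this
  have hρ3 := hρ2.of_perm hp2
  have hsv : s ∈ X ∪ Y := by simp [hsX]
  have hc := card_erase_union hd hs
  have hJ : 1 ≤ J.card := Finset.card_pos.2 G.isForest.nonempty
  have e1 : orSign (X :: Y :: ρ) ((Y :: ρ) ++ [X]) = (-1) ^ (ρ.length + 1) := by
    have := orSign_cons_middle (l := Y :: ρ) (a := X) (m := []) (by
      have := hρ.1
      rw [List.nodup_cons] at this
      exact this.1)
    simpa using this
  have e2 : orSign ((X ∪ Y) :: ρ) (ρ ++ [X ∪ Y]) = (-1) ^ ρ.length := by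
    have := orSign_cons_middle (l := ρ) (a := X ∪ Y) (m := []) (by
      have := hρ2.1
      rw [List.nodup_cons] at this
      exact this.1)
    simpa using this
  have hfil : (insert (X ∪ Y) W).filter (fun A => s ∉ A) = W.filter (fun A => s ∉ A) := by
    rw [Finset.filter_insert, if_neg (by simp [hsX])]
  have key : comp I J s (joinOp X Y (outer I W (a ++ [s]) (X :: Y :: ρ))) (Finsupp.single G 1) =
      joinOp (X.erase s ∪ J) Y (comp I J s (outer I W (a ++ [s]) (X :: Y :: ρ))
        (Finsupp.single G 1)) := by
    rw [joinOp_outer h _ hρ, outer_perm _ hρ2 hρ3, outer_perm _ hρ hρ', map_units_smul,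
      map_units_smul, map_units_smul, LinearMap.smul_apply, LinearMap.smul_apply,
      LinearMap.smul_apply, comp_outer hd hs hF G ha1 hρ3 hsv, comp_outer hd hs h G ha1 hρ' hsX,
      map_units_smul, map_units_smul, map_list_sum, List.map_map,
      subst_join_of_mem h hX hY hXY hsX, sum_flatMap_map]
    have : ∀ p ∈ subst ⟨W, h⟩ s (roots J G.verts).toList G.verts,
        ((joinOp (X.erase s ∪ J) Y : Bess (I.erase s ∪ J) →ₗ[ℚ] Bess (I.erase s ∪ J)) ∘ fun p =>
          outer (I.erase s ∪ J) (W.filter (fun A => s ∉ A) ∪ p.2) (a ++ J.toList)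
            ((Y :: ρ) ++ p.1)) p =
        (-(-1 : ℤˣ) ^ (I.erase s ∪ J).card) • ((graft Y p).map fun q =>
          outer (I.erase s ∪ J) (W.filter (fun A => s ∉ A) ∪ q.2) (a ++ J.toList)
            (ρ ++ q.1)).sum := fun p hp =>
      joinOp_substTerm hd hs h hρ' hsX (isSubstTerm_of_mem hd hs G isRootList_toList h p hp) _
    rw [List.map_congr_left this, ← smul_sum_map, e1, e2, hfil, smul_smul, smul_smul, smul_smul,
      smul_smul, List.length_cons]
    congr 1
    -- Only parities remain. The Koszul exponents `ρ.length * (J.card - 1)` and `(ρ.length + 1) *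
    -- (J.card - 1)` differ by `J.card - 1`, and so do the cardinalities of `I` and of the new leaf
    -- set. The factor `(-1) ^ I.card` in `joinOp` is there for this balance.
    rw [← neg_one_mul ((-1 : ℤˣ) ^ (I.erase s ∪ J).card), ← pow_succ', ← pow_add, ← pow_add,
      ← pow_add, ← pow_add]
    apply units_neg_one_pow_eq
    have : (ρ.length + 1) * (J.card - 1) = ρ.length * (J.card - 1) + (J.card - 1) := by ring
    rw [this]
    omega
  have e : (Finsupp.single (⟨W, h⟩ : Forest I) 1 : Bess I) =
      (orSign (a ++ [s]) I.toList * orSign (X :: Y :: ρ) (roots I W).toList) •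
        outer I W (a ++ [s]) (X :: Y :: ρ) := by
    rw [outer_of_isForest h, smul_smul, Int.units_mul_self, one_smul]
  rw [e]
  simp only [map_units_smul, LinearMap.smul_apply]
  rw [key]

/-- Here both trees are untouched by the substitution and the terms correspond one to one. The sign
balances as in the case `s ∈ X`: joining shortens the root list by one, and the leaf set grows by
`J.card - 1`. -/
lemma comp_joinOp_of_notMem {s : α} (hd : Disjoint (I.erase s) J) (hs : s ∈ I) (F : Forest I)
    (G : Forest J) {X Y : Finset α} (hX : X ∈ roots I F.verts) (hY : Y ∈ roots I F.verts)
    (hXY : X ≠ Y) (hsX : s ∉ X) (hsY : s ∉ Y) :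
    comp I J s (joinOp X Y (Finsupp.single F 1)) (Finsupp.single G 1) =
      joinOp X Y (comp I J s (Finsupp.single F 1) (Finsupp.single G 1)) := by
  obtain ⟨W, h⟩ := F
  obtain ⟨ρ₀, hρ₀⟩ := exists_rootList hX hY hXY
  obtain ⟨τ, hτ, hsτ⟩ := exists_root_mem (W := W) hs
  have hτρ : τ ∈ ρ₀ := by
    have := (hρ₀.2 τ).2 hτ
    simp only [List.mem_cons] at this
    rcases this with rfl | rfl | h1
    · exact absurd hsτ hsX
    · exact absurd hsτ hsY
    · exact h1
  set ρ := ρ₀.erase τ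
  have hρ : IsRootList I W ((X :: Y :: ρ) ++ [τ]) :=
    hρ₀.of_perm (((exists_perm_append_singleton hτρ).symm.cons _).cons _)
  have hρc : IsRootList I W (X :: Y :: (ρ ++ [τ])) := hρ
  set a := I.toList.erase s with ha
  have ha1 : (a ++ [s]).Perm I.toList := exists_perm_append_singleton (Finset.mem_toList.2 hs)
  have hF := h.join hX hY hXY
  have hρ2 : IsRootList I (insert (X ∪ Y) W) (((X ∪ Y) :: ρ) ++ [τ]) := hρc.join h
  have hsv : s ∉ X ∪ Y := by simp [hsX, hsY]
  have hc := card_erase_union hd hs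
  have hJ : 1 ≤ J.card := Finset.card_pos.2 G.isForest.nonempty
  have hfil : (insert (X ∪ Y) W).filter (fun A => s ∉ A) =
      insert (X ∪ Y) (W.filter (fun A => s ∉ A)) := by
    rw [Finset.filter_insert, if_pos hsv]
  have key : comp I J s (joinOp X Y (outer I W (a ++ [s]) ((X :: Y :: ρ) ++ [τ])))
      (Finsupp.single G 1) = joinOp X Y (comp I J s (outer I W (a ++ [s]) ((X :: Y :: ρ) ++ [τ]))
        (Finsupp.single G 1)) := by
    rw [comp_outer hd hs h G ha1 hρ hsτ, List.cons_append, List.cons_append,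
      joinOp_outer h _ hρc, ← List.cons_append, map_units_smul, LinearMap.smul_apply,
      comp_outer hd hs hF G ha1 hρ2 hsτ, map_units_smul, map_list_sum, List.map_map,
      subst_join_of_notMem h hX hY hXY hsv]
    have : ∀ p ∈ subst ⟨W, h⟩ s (roots J G.verts).toList G.verts,
        ((joinOp X Y : Bess (I.erase s ∪ J) →ₗ[ℚ] Bess (I.erase s ∪ J)) ∘ fun p =>
          outer (I.erase s ∪ J) (W.filter (fun A => s ∉ A) ∪ p.2) (a ++ J.toList)
            ((X :: Y :: ρ) ++ p.1)) p =
        ((-1 : ℤˣ) ^ (I.erase s ∪ J).card) •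
          outer (I.erase s ∪ J) ((insert (X ∪ Y) W).filter (fun A => s ∉ A) ∪ p.2)
            (a ++ J.toList) (((X ∪ Y) :: ρ) ++ p.1) := fun p hp => by
      have hP := isSubstTerm_of_mem hd hs G isRootList_toList h p hp
      have hR : IsRootList (I.erase s ∪ J) (W.filter (fun A => s ∉ A) ∪ p.2)
          (X :: Y :: (ρ ++ p.1)) := hP.isRootList hd hs h hρ hsτ
      rw [hfil, Finset.insert_union]
      exact joinOp_outer hP.isForest _ hR
    rw [List.map_congr_left this, ← smul_sum_map, smul_smul, smul_smul, List.length_cons,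
      List.length_cons, List.length_cons]
    congr 1
    rw [← pow_add, ← pow_add]
    apply units_neg_one_pow_eq
    have e1 : (ρ.length + 1) * (J.card - 1) = ρ.length * (J.card - 1) + (J.card - 1) := by ring
    have e2 : (ρ.length + 1 + 1) * (J.card - 1) =
      ρ.length * (J.card - 1) + (J.card - 1) + (J.card - 1) := by ring
    rw [e1, e2]
    omega
  have e : (Finsupp.single (⟨W, h⟩ : Forest I) 1 : Bess I) =
      (orSign (a ++ [s]) I.toList * orSign ((X :: Y :: ρ) ++ [τ]) (roots I W).toList) •
        outer I W (a ++ [s]) ((X :: Y :: ρ) ++ [τ]) := by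
    rw [outer_of_isForest h, smul_smul, Int.units_mul_self, one_smul]
  rw [e]
  simp only [map_units_smul, LinearMap.smul_apply]
  rw [key]

lemma substSet_disjoint {s : α} (hd : Disjoint (I.erase s) J) {X Y : Finset α} (hX : X ⊆ I)
    (hY : Y ⊆ I) (hXY : Disjoint X Y) : Disjoint (substSet J s X) (substSet J s Y) := by
  rw [Finset.disjoint_left] at hXY hd ⊢
  intro i hiX hiY
  have h1 : i ∈ X → s ∉ X → i ∈ I.erase s := fun h1 h2 =>
    Finset.mem_erase.2 ⟨fun e => h2 (e ▸ h1), hX h1⟩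
  have h2 : i ∈ Y → s ∉ Y → i ∈ I.erase s := fun h1 h2 =>
    Finset.mem_erase.2 ⟨fun e => h2 (e ▸ h1), hY h1⟩
  unfold substSet at hiX hiY
  split_ifs at hiX hiY with hsX hsY hsY
  · exact hXY hsX hsY
  · rcases Finset.mem_union.1 hiX with h3 | h3
    · exact hXY (Finset.mem_of_mem_erase h3) hiY
    · exact hd (h2 hiY hsY) h3
  · rcases Finset.mem_union.1 hiY with h3 | h3
    · exact hXY hiX (Finset.mem_of_mem_erase h3)
    · exact hd (h1 hiX hsX) h3
  · exact hXY hiX hiY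

/-- Partial composition commutes with joining two trees on the left. -/
lemma comp_joinOp_roots {s : α} (hd : Disjoint (I.erase s) J) (hs : s ∈ I) (F : Forest I)
    (G : Forest J) {X Y : Finset α} (hX : X ∈ roots I F.verts) (hY : Y ∈ roots I F.verts)
    (hXY : X ≠ Y) :
    comp I J s (joinOp X Y (Finsupp.single F 1)) (Finsupp.single G 1) =
      joinOp (substSet J s X) (substSet J s Y)
        (comp I J s (Finsupp.single F 1) (Finsupp.single G 1)) := by
  have hdXY := F.isForest.roots_disjoint hX hY hXY
  by_cases hsX : s ∈ X
  · have hsY : s ∉ Y := Finset.disjoint_left.1 hdXY hsX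
    rw [substSet, substSet, if_pos hsX, if_neg hsY]
    exact comp_joinOp_of_mem hd hs F G hX hY hXY hsX
  · by_cases hsY : s ∈ Y
    -- The case `s ∈ Y` is reduced to `s ∈ X` by antisymmetry on both sides.
    · rw [joinOp_swap (substSet_disjoint hd (F.isForest.root_subset hY)
        (F.isForest.root_subset hX) hdXY.symm), joinOp_swap hdXY.symm, substSet, substSet,
        if_neg hsX, if_pos hsY, LinearMap.neg_apply, LinearMap.neg_apply, map_neg,
        LinearMap.neg_apply, comp_joinOp_of_mem hd hs F G hY hX hXY.symm hsY]
    · rw [substSet, substSet, if_neg hsX, if_neg hsY]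
      exact comp_joinOp_of_notMem hd hs F G hX hY hXY hsX hsY

end Comp

/-! ### Forests that refine a family of leaf sets. -/

section Refinement

variable {α : Type*} [DecidableEq α] {I J : Finset α} {W : Finset (Finset α)}

/-- Every tree of `F` has its leaves in a member of `R`. -/
def Refines (F : Forest I) (R : Finset (Finset α)) : Prop :=
  ∀ A ∈ roots I F.verts, ∃ B ∈ R, A ⊆ B

lemma refines_roots (F : Forest I) : Refines F (roots I F.verts) := fun A hA =>
  ⟨A, hA, Finset.Subset.refl _⟩

/-- The span of the forests that refine `R`. -/
def refSpan (I : Finset α) (R : Finset (Finset α)) : Submodule ℚ (Bess I) :=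
  Submodule.span ℚ ((fun F : Forest I => Finsupp.single F (1 : ℚ)) '' {F | Refines F R})

/-- The span of the tensor products of forests that refine `R`. -/
def refSpan₂ (I : Finset α) (R : Finset (Finset α)) : Submodule ℚ (Bess I ⊗[ℚ] Bess I) :=
  Submodule.span ℚ ((fun p : Forest I × Forest I =>
    Finsupp.single p.1 (1 : ℚ) ⊗ₜ[ℚ] Finsupp.single p.2 (1 : ℚ)) ''
      {p | Refines p.1 R ∧ Refines p.2 R})

lemma units_smul_mem {M : Type*} [AddCommGroup M] [Module ℚ M] (S : Submodule ℚ M) (u : ℤˣ) {x : M}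
    (hx : x ∈ S) : u • x ∈ S := by
  rcases Int.units_eq_one_or u with rfl | rfl
  · simpa using hx
  · simpa using hx

lemma single_mem_refSpan {F : Forest I} {R : Finset (Finset α)} (h : Refines F R) :
    Finsupp.single F 1 ∈ refSpan I R :=
  Submodule.subset_span ⟨F, h, rfl⟩

lemma single_mem_refSpan₂ {F G : Forest I} {R : Finset (Finset α)} (h : Refines F R)
    (h' : Refines G R) :
    (Finsupp.single F 1 ⊗ₜ[ℚ] Finsupp.single G 1 : Bess I ⊗[ℚ] Bess I) ∈ refSpan₂ I R :=
  Submodule.subset_span ⟨(F, G), ⟨h, h'⟩, rfl⟩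

/-- Additivity of the joining operators in their leaf sets fails for trees that overlap several
parts. Identities that use it are proved only on forests refining the parts, and extended to their
span. -/
lemma refSpan_hom_ext {M : Type*} [AddCommGroup M] [Module ℚ M] {R : Finset (Finset α)}
    {f g : Bess I →ₗ[ℚ] M}
    (h : ∀ F : Forest I, Refines F R → f (Finsupp.single F 1) = g (Finsupp.single F 1)) {x : Bess I}
    (hx : x ∈ refSpan I R) : f x = g x := by
  refine LinearMap.eqOn_span ?_ hx
  rintro _ ⟨F, hF, rfl⟩
  exact h F hF

lemma refSpan₂_hom_ext {M : Type*} [AddCommGroup M] [Module ℚ M] {R : Finset (Finset α)}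
    {f g : Bess I ⊗[ℚ] Bess I →ₗ[ℚ] M}
    (h : ∀ F G : Forest I, Refines F R → Refines G R →
      f (Finsupp.single F 1 ⊗ₜ Finsupp.single G 1) = g (Finsupp.single F 1 ⊗ₜ Finsupp.single G 1))
    {x : Bess I ⊗[ℚ] Bess I} (hx : x ∈ refSpan₂ I R) : f x = g x := by
  refine LinearMap.eqOn_span ?_ hx
  rintro _ ⟨p, hp, rfl⟩
  exact h p.1 p.2 hp.1 hp.2

lemma bess₂_hom_ext {M : Type*} [AddCommGroup M] [Module ℚ M]
    {f g : Bess I ⊗[ℚ] Bess I →ₗ[ℚ] M}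
    (h : ∀ F G : Forest I, f (Finsupp.single F 1 ⊗ₜ Finsupp.single G 1) =
      g (Finsupp.single F 1 ⊗ₜ Finsupp.single G 1)) : f = g := by
  refine TensorProduct.ext (bess_hom_ext fun F => bess_hom_ext fun G => ?_)
  simpa using h F G

lemma substSet_mono {s : α} {X Y : Finset α} (h : X ⊆ Y) : substSet J s X ⊆ substSet J s Y := by
  unfold substSet
  split_ifs with h1 h2 h2
  · exact Finset.union_subset_union (Finset.erase_subset_erase _ h) (Finset.Subset.refl _)
  · exact absurd (h h1) h2
  · intro i hi
    exact Finset.mem_union_left _ (Finset.mem_erase.2 ⟨fun e => h1 (e ▸ hi), h hi⟩)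
  · exact h

/-- A substitution may split the tree of `s` but never merges trees, so each resulting tree lies in
the enlarged leaf set of one tree of `F`. -/
lemma comp_mem_refSpan {s : α} (hd : Disjoint (I.erase s) J) (hs : s ∈ I) (F : Forest I)
    (G : Forest J) {R : Finset (Finset α)} (hF : Refines F R) :
    comp I J s (Finsupp.single F 1) (Finsupp.single G 1) ∈
      refSpan (I.erase s ∪ J) (R.image (substSet J s)) := by
  rw [comp_single]
  unfold basisComp
  refine units_smul_mem _ _ (list_sum_mem fun x hx => ?_)
  rw [List.mem_map] at hx
  obtain ⟨p, hp, rfl⟩ := hx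
  have hP := isSubstTerm_of_mem hd hs G isRootList_toList F.isForest p hp
  rw [outer_of_isForest hP.isForest]
  refine units_smul_mem _ _ (single_mem_refSpan fun A hA => ?_)
  rw [hP.mem_roots_iff] at hA
  obtain ⟨τ, hτ, hsτ⟩ := exists_root_mem (W := F.verts) hs
  have : ∃ X ∈ roots I F.verts, A ⊆ substSet J s X := by
    rcases hA with ⟨h1, h2⟩ | h1
    · exact ⟨A, h1, by rw [substSet, if_neg h2]⟩
    · exact ⟨τ, hτ, by rw [substSet, if_pos hsτ]; exact hP.below A h1 τ hτ hsτ⟩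
  obtain ⟨X, hX, hAX⟩ := this
  obtain ⟨B, hB, hXB⟩ := hF X hX
  exact ⟨_, Finset.mem_image_of_mem _ hB, hAX.trans (substSet_mono hXB)⟩

/-- Partial composition commutes with the joining operators on the left. -/
lemma comp_joinOp {s : α} (hd : Disjoint (I.erase s) J) (hs : s ∈ I) (F : Forest I)
    (G : Forest J) {R : Finset (Finset α)} (hR : ∀ B ∈ R, ∀ C ∈ R, B ≠ C → Disjoint B C)
    (hRI : ∀ B ∈ R, B ⊆ I) (hF : Refines F R) {B C : Finset α} (hB : B ∈ R) (hC : C ∈ R)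
    (hBC : B ≠ C) :
    comp I J s (joinOp B C (Finsupp.single F 1)) (Finsupp.single G 1) =
      joinOp (substSet J s B) (substSet J s C)
        (comp I J s (Finsupp.single F 1) (Finsupp.single G 1)) := by
  have hz := comp_mem_refSpan hd hs F G (refines_roots F)
  set z := comp I J s (Finsupp.single F 1) (Finsupp.single G 1)
  have hne : ∀ X ∈ roots I F.verts, ∀ Y ∈ roots I F.verts, X ≠ Y →
      Disjoint (substSet J s X) (substSet J s Y) := fun X hX Y hY hXY =>
    substSet_disjoint hd (F.isForest.root_subset hX) (F.isForest.root_subset hY)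
      (F.isForest.roots_disjoint hX hY hXY)
  have hnonempty : ∀ X ∈ roots I F.verts, (substSet J s X).Nonempty := by
    intro X hX
    unfold substSet
    split_ifs
    · exact G.isForest.nonempty.mono Finset.subset_union_right
    · exact F.isForest.root_nonempty hX
  have hinj : Set.InjOn (substSet J s) (roots I F.verts : Set (Finset α)) := by
    intro X hX Y hY hXY
    by_contra hne'
    have := hne X hX Y hY hne'
    rw [hXY, disjoint_self] at this
    exact (hnonempty Y hY).ne_empty this
  have hcover : ∀ {B}, B ∈ R → ∀ (F' : Forest (I.erase s ∪ J)),
      Refines F' ((roots I F.verts).image (substSet J s)) →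
      ∀ A ∈ roots (I.erase s ∪ J) F'.verts, A ⊆ substSet J s B →
      ∃ X ∈ ((roots I F.verts).filter (· ⊆ B)).image (substSet J s), A ⊆ X := by
    intro B hB F' hF' A hA hAB
    obtain ⟨X', hX', hAX⟩ := hF' A hA
    obtain ⟨X, hX, rfl⟩ := Finset.mem_image.1 hX'
    obtain ⟨B', hB', hXB⟩ := hF X hX
    by_cases hBB : B' = B
    · subst hBB
      exact ⟨_, Finset.mem_image_of_mem _ (Finset.mem_filter.2 ⟨hX, hXB⟩), hAX⟩
    · exfalso
      have h1 := substSet_disjoint hd (hRI B' hB') (hRI B hB) (hR B' hB' B hB hBB)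
      obtain ⟨i, hi⟩ := F'.isForest.root_nonempty hA
      exact Finset.disjoint_left.1 h1 (hAX.trans (substSet_mono hXB) hi) (hAB hi)
  have hpd : ∀ {B : Finset α}, ∀ X ∈ ((roots I F.verts).filter (· ⊆ B)).image (substSet J s),
      ∀ Y ∈ ((roots I F.verts).filter (· ⊆ B)).image (substSet J s), X ≠ Y → Disjoint X Y := by
    intro B X hX Y hY hXY
    obtain ⟨X, hX', rfl⟩ := Finset.mem_image.1 hX
    obtain ⟨Y, hY', rfl⟩ := Finset.mem_image.1 hY
    exact hne X (Finset.mem_filter.1 hX').1 Y (Finset.mem_filter.1 hY').1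
      fun e => hXY (by rw [e])
  have hsub : ∀ {B : Finset α}, ∀ X ∈ ((roots I F.verts).filter (· ⊆ B)).image (substSet J s),
      X ⊆ substSet J s B := by
    intro B X hX
    obtain ⟨X, hX', rfl⟩ := Finset.mem_image.1 hX
    exact substSet_mono (Finset.mem_filter.1 hX').2
  -- All forests in the composite `z` refine the enlarged trees of `F`. On them the operator for the
  -- enlarged `B` and `C` splits into the operators for the enlarged trees inside `B` and `C`, to
  -- which `comp_joinOp_roots` applies.
  have e1 : joinOp (substSet J s B) (substSet J s C) z =
      (∑ X ∈ ((roots I F.verts).filter (· ⊆ B)).image (substSet J s),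
        ∑ Y ∈ ((roots I F.verts).filter (· ⊆ C)).image (substSet J s),
          (joinOp X Y : Bess (I.erase s ∪ J) →ₗ[ℚ] Bess (I.erase s ∪ J))) z := by
    refine refSpan_hom_ext (fun F' hF' => ?_) hz
    rw [joinOp_additive F' hpd hpd hsub hsub (hcover hB F' hF') (hcover hC F' hF')]
    simp only [LinearMap.sum_apply]
  rw [e1, joinOp_single_eq_sum]
  simp only [map_sum, LinearMap.sum_apply]
  have hinj' : ∀ {B : Finset α}, Set.InjOn (substSet J s)
      ((roots I F.verts).filter (· ⊆ B) : Set (Finset α)) := fun {B} =>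
    hinj.mono fun X hX => (Finset.mem_filter.1 hX).1
  rw [Finset.sum_image (f := fun X => ∑ Y ∈ ((roots I F.verts).filter (· ⊆ C)).image (substSet J s),
    joinOp X Y z) hinj']
  refine Finset.sum_congr rfl fun X hX => ?_
  rw [Finset.sum_image (f := fun Y => joinOp (substSet J s X) Y z) hinj']
  refine Finset.sum_congr rfl fun Y hY => ?_
  rw [Finset.mem_filter] at hX hY
  exact comp_joinOp_roots hd hs F G hX.1 hY.1
    (ne_of_roots_subset (hR B hB C hC hBC) F.isForest hX.1 hX.2 hY.2)

/-- Composition adds numbers of inner vertices. Instead of counting vertices in each term, the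
induction over joins uses that a join anticommutes with `signOp` on both sides of
`comp_joinOp_roots`. -/
lemma signOp_comp {s : α} (hd : Disjoint (I.erase s) J) (hs : s ∈ I) (F : Forest I)
    (G : Forest J) :
    signOp (comp I J s (Finsupp.single F 1) (Finsupp.single G 1)) =
      (-1 : ℤˣ) ^ (deg F + deg G) • comp I J s (Finsupp.single F 1) (Finsupp.single G 1) := by
  obtain ⟨W, h⟩ := F
  suffices H : ∀ h : IsForest I W, signOp (comp I J s (Finsupp.single ⟨W, h⟩ 1)
      (Finsupp.single G 1)) = (-1 : ℤˣ) ^ (W.card + G.verts.card) •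
        comp I J s (Finsupp.single ⟨W, h⟩ 1) (Finsupp.single G 1) from H h
  refine h.induction (P := fun W => ∀ h : IsForest I W, signOp (comp I J s (Finsupp.single ⟨W, h⟩ 1)
      (Finsupp.single G 1)) = (-1 : ℤˣ) ^ (W.card + G.verts.card) •
        comp I J s (Finsupp.single ⟨W, h⟩ 1) (Finsupp.single G 1)) ?_ ?_
  · intro _ h
    rw [comp_single]
    unfold basisComp
    rw [subst_empty, map_units_smul, List.map_singleton, List.sum_singleton, signOp_outer,
      smul_comm]
    simp
  · intro W h X hX Y hY hXY ih h'
    obtain ⟨u, hu⟩ := exists_joinOp_single_eq ⟨W, h⟩ hX hY hXY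
    have hu' : (Finsupp.single (⟨insert (X ∪ Y) W, h'⟩ : Forest I) 1 : Bess I) =
        u • joinOp X Y (Finsupp.single ⟨W, h⟩ 1) := by
      rw [hu, smul_smul, Int.units_mul_self, one_smul]
    have hdis := substSet_disjoint hd (h.root_subset hX) (h.root_subset hY)
      (h.roots_disjoint hX hY hXY)
    have hsw := LinearMap.congr_fun (joinOp_comp_signOp hdis)
      (comp I J s (Finsupp.single ⟨W, h⟩ 1) (Finsupp.single G 1))
    simp only [LinearMap.comp_apply, LinearMap.neg_apply] at hsw
    rw [hu', map_units_smul, LinearMap.smul_apply, map_units_smul,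
      comp_joinOp_roots hd hs ⟨W, h⟩ G hX hY hXY, ← neg_eq_iff_eq_neg.2 hsw, ih h, map_units_smul,
      Finset.card_insert_of_notMem (union_notMem h hX hY hXY)]
    rw [show W.card + 1 + G.verts.card = W.card + G.verts.card + 1 by ring, pow_succ,
      mul_neg_one, Units.neg_smul, smul_neg, smul_comm u]

/-! ### Operators on tensor products -/

/-- The operator on the tensor product that corresponds to the coproduct of `Ω`. -/
def joinOp₂ (B C : Finset α) : Bess I ⊗[ℚ] Bess I →ₗ[ℚ] Bess I ⊗[ℚ] Bess I :=
  TensorProduct.map (joinOp B C) LinearMap.id + TensorProduct.map signOp (joinOp B C)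

lemma joinOp₂_tmul (B C : Finset α) (x y : Bess I) :
    joinOp₂ B C (x ⊗ₜ y) = joinOp B C x ⊗ₜ y + signOp x ⊗ₜ joinOp B C y := by
  simp [joinOp₂]

lemma units_smul_tmul (u : ℤˣ) (x y : Bess I) : (u • x) ⊗ₜ[ℚ] y = u • (x ⊗ₜ[ℚ] y) := by
  rcases Int.units_eq_one_or u with rfl | rfl
  · simp
  · simp [TensorProduct.neg_tmul]

lemma units_tmul_smul (u : ℤˣ) (x y : Bess I) : x ⊗ₜ[ℚ] (u • y) = u • (x ⊗ₜ[ℚ] y) := by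
  rcases Int.units_eq_one_or u with rfl | rfl
  · simp
  · simp [TensorProduct.tmul_neg]

lemma joinOp₂_swap {B C : Finset α} (hBC : Disjoint B C) :
    joinOp₂ C B = - (joinOp₂ B C : Bess I ⊗[ℚ] Bess I →ₗ[ℚ] Bess I ⊗[ℚ] Bess I) := by
  refine bess₂_hom_ext fun F G => ?_
  rw [LinearMap.neg_apply, joinOp₂_tmul, joinOp₂_tmul, joinOp_swap hBC, LinearMap.neg_apply,
    LinearMap.neg_apply, TensorProduct.neg_tmul, TensorProduct.tmul_neg, neg_add]

/-- The terms where both operators act on the same factor anticommute by `joinOp_anticomm`. The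
mixed terms do so because `signOp` anticommutes with each joining operator, as is the rule for odd
derivations of a graded tensor product. -/
lemma joinOp₂_anticomm {B C B' C' : Finset α} (hBC : Disjoint B C) (hBC' : Disjoint B' C')
    (hBB : Disjoint B B') (hBC1 : Disjoint B C') (hCB : Disjoint C B') (hCC : Disjoint C C')
    (x : Bess I ⊗[ℚ] Bess I) :
    joinOp₂ B C (joinOp₂ B' C' x) = - joinOp₂ B' C' (joinOp₂ B C x) := by
  have h0 : ∀ y : Bess I, joinOp B C (joinOp B' C' y) = - joinOp B' C' (joinOp B C y) := fun y =>
    LinearMap.congr_fun (joinOp_anticomm hBC hBC' hBB hBC1 hCB hCC) y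
  have h1 : ∀ y : Bess I, joinOp B C (signOp y) = - signOp (joinOp B C y) := fun y =>
    LinearMap.congr_fun (joinOp_comp_signOp hBC) y
  have h2 : ∀ y : Bess I, joinOp B' C' (signOp y) = - signOp (joinOp B' C' y) := fun y =>
    LinearMap.congr_fun (joinOp_comp_signOp hBC') y
  have h3 : ∀ y : Bess I, signOp (signOp y) = y := fun y =>
    LinearMap.congr_fun signOp_comp_signOp y
  induction x with
  | zero => simp
  | add x y hx hy => rw [map_add, map_add, map_add, map_add, hx, hy, neg_add]
  | tmul x y =>
    simp only [joinOp₂_tmul, map_add, h0, h1, h2, h3, TensorProduct.neg_tmul,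
      TensorProduct.tmul_neg]
    abel

lemma signOp_pow_single (n : ℕ) (F : Forest I) :
    ((signOp : Bess I →ₗ[ℚ] Bess I) ^ n) (Finsupp.single F 1) =
      (-1 : ℤˣ) ^ (deg F * n) • Finsupp.single F 1 := by
  induction n with
  | zero => simp
  | succ n ih =>
    rw [pow_succ', Module.End.mul_apply, ih, map_units_smul, signOp_single, smul_smul, ← pow_add]
    rfl

/-- Writing the Koszul sign as a power of `signOp` acting on `y` frees `x` and `y` from being
homogeneous. -/
lemma tensorComp_tmul (s : α) (x y : Bess I) (G : Forest J) (z : Bess J) :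
    tensorComp I J s (x ⊗ₜ y) (Finsupp.single G 1 ⊗ₜ z) =
      comp I J s x (Finsupp.single G 1) ⊗ₜ
        comp I J s (((signOp : Bess I →ₗ[ℚ] Bess I) ^ deg G) y) z := by
  induction x using Finsupp.induction_linear with
  | zero => simp
  | add x x' h1 h2 => simp only [TensorProduct.add_tmul, map_add, LinearMap.add_apply, h1, h2]
  | single F c =>
    induction y using Finsupp.induction_linear with
    | zero => simp
    | add x x' h1 h2 =>
      simp only [TensorProduct.tmul_add, map_add, LinearMap.add_apply, h1, h2]
    | single F' c' =>
      induction z using Finsupp.induction_linear with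
      | zero => simp
      | add x x' h1 h2 => simp only [TensorProduct.tmul_add, map_add, h1, h2]
      | single G' d =>
        have e : ∀ {K : Finset α} (F : Forest K) (c : ℚ), (Finsupp.single F c : Bess K) =
          c • Finsupp.single F 1 := fun F c => by simp
        have hb : tensorComp I J s (Finsupp.single F 1 ⊗ₜ Finsupp.single F' 1)
            (Finsupp.single G 1 ⊗ₜ Finsupp.single G' 1) =
            comp I J s (Finsupp.single F 1) (Finsupp.single G 1) ⊗ₜ
            comp I J s (((signOp : Bess I →ₗ[ℚ] Bess I) ^ deg G) (Finsupp.single F' 1))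
              (Finsupp.single G' 1) := by
          rw [signOp_pow_single, map_units_smul, LinearMap.smul_apply, comp_single, comp_single,
            units_tmul_smul]
          simp only [tensorComp, TensorProduct.lift.tmul, bilin_single]
        rw [e F c, e F' c', e G' d]
        simp only [← TensorProduct.smul_tmul', TensorProduct.tmul_smul, map_smul,
          LinearMap.smul_apply]
        rw [hb]

/-- In each factor this is `comp_joinOp`. When the operator acts on the second factor it crosses
`F`, by the definition of `joinOp₂`, and `G`, by the Koszul sign of the composition; on the other
side it crosses their composite, whose degree is the sum by `signOp_comp`. -/
lemma tensorComp_joinOp₂ {s : α} (hd : Disjoint (I.erase s) J) (hs : s ∈ I)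
    {R : Finset (Finset α)} (hR : ∀ B ∈ R, ∀ C ∈ R, B ≠ C → Disjoint B C)
    (hRI : ∀ B ∈ R, B ⊆ I) {B C : Finset α} (hB : B ∈ R) (hC : C ∈ R)
    (hBC : B ≠ C) {x : Bess I ⊗[ℚ] Bess I} (hx : x ∈ refSpan₂ I R) (y : Bess J ⊗[ℚ] Bess J) :
    tensorComp I J s (joinOp₂ B C x) y =
      joinOp₂ (substSet J s B) (substSet J s C) (tensorComp I J s x y) := by
  have key : ((tensorComp I J s).flip y ∘ₗ joinOp₂ B C) x =
      (joinOp₂ (substSet J s B) (substSet J s C) ∘ₗ (tensorComp I J s).flip y) x := by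
    refine refSpan₂_hom_ext (fun F F' hF hF' => ?_) hx
    simp only [LinearMap.comp_apply, LinearMap.flip_apply]
    suffices H : tensorComp I J s (joinOp₂ B C (Finsupp.single F 1 ⊗ₜ Finsupp.single F' 1)) =
        joinOp₂ (substSet J s B) (substSet J s C) ∘ₗ
          tensorComp I J s (Finsupp.single F 1 ⊗ₜ Finsupp.single F' 1) from
      LinearMap.congr_fun H y
    refine bess₂_hom_ext fun G G' => ?_
    have hsw : joinOp B C (((signOp : Bess I →ₗ[ℚ] Bess I) ^ deg G) (Finsupp.single F' 1)) =
        (-1 : ℤˣ) ^ deg G • ((signOp : Bess I →ₗ[ℚ] Bess I) ^ deg G)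
          (joinOp B C (Finsupp.single F' 1)) := by
      generalize deg G = n
      induction n with
      | zero => simp
      | succ n ih =>
        rw [pow_succ', Module.End.mul_apply, Module.End.mul_apply]
        have := LinearMap.congr_fun (joinOp_comp_signOp (hR B hB C hC hBC))
          (((signOp : Bess I →ₗ[ℚ] Bess I) ^ n) (Finsupp.single F' 1))
        simp only [LinearMap.comp_apply, LinearMap.neg_apply] at this
        rw [this, ih, map_units_smul, pow_succ, mul_neg_one, Units.neg_smul]
    have hsw' : ((signOp : Bess I →ₗ[ℚ] Bess I) ^ deg G) (joinOp B C (Finsupp.single F' 1)) =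
        (-1 : ℤˣ) ^ deg G • joinOp B C
          (((signOp : Bess I →ₗ[ℚ] Bess I) ^ deg G) (Finsupp.single F' 1)) := by
      rw [hsw, smul_smul, Int.units_mul_self, one_smul]
    simp only [LinearMap.comp_apply, joinOp₂_tmul, map_add,
      LinearMap.add_apply, tensorComp_tmul]
    rw [comp_joinOp hd hs F G hR hRI hF hB hC hBC, signOp_comp hd hs, hsw', signOp_single,
      signOp_pow_single]
    simp only [map_units_smul, LinearMap.smul_apply]
    rw [comp_joinOp hd hs F' G' hR hRI hF' hB hC hBC]
    simp only [units_smul_tmul, units_tmul_smul, smul_smul, pow_add]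
    congr 2
    simp only [mul_assoc, mul_comm]
  exact key

end Refinement

/-! ### Compositions with the forest without inner vertices. -/

section One

variable {α : Type*} [DecidableEq α] {I J : Finset α}

/-- The commutative product of the leaves: the forest without inner vertices. -/
def oneForest (I : Finset α) : Bess I :=
  outer I ∅ I.toList.reverse (I.toList.map fun i => {i})

lemma isRootList_singletons {l : List α} (hl : l.Perm I.toList) :
    IsRootList I ∅ (l.map fun i => {i}) := by
  refine ⟨(hl.nodup_iff.2 (Finset.nodup_toList _)).map Finset.singleton_injective, fun X => ?_⟩
  rw [roots_empty_iff]
  simp only [List.mem_map, hl.mem_iff, Finset.mem_toList, eq_comm]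

/-- A change of the order of the leaves changes the orientation of `I` and that of the roots by the
same sign. The reversal of the leaf word is compatible with this and with `E_{i,j} = (j ∧ i) ⊗
e_{i,j}`. -/
lemma oneForest_eq {l : List α} (hl : l.Perm I.toList) :
    oneForest I = outer I ∅ l.reverse (l.map fun i => {i}) := by
  have hnd := hl.nodup_iff.2 (Finset.nodup_toList _)
  have hr : I.toList.reverse.Perm l.reverse :=
    (List.reverse_perm _).trans (hl.symm.trans (List.reverse_perm _).symm)
  rw [oneForest, outer_perm_left hr ((List.reverse_perm _).trans hl),
    outer_perm _ (isRootList_singletons (List.Perm.refl _)) (isRootList_singletons hl),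
    orSign_reverse hl.symm hnd,
    orSign_map hl.symm Finset.singleton_injective.injOn, smul_smul, Int.units_mul_self, one_smul]

lemma isRootList_singletons_append {s : α} (hd : Disjoint (I.erase s) J) {l : List α}
    (hl : (s :: l).Perm I.toList) (G : Forest J) {ρ : List (Finset α)}
    (hρ : IsRootList J G.verts ρ) :
    IsRootList (I.erase s ∪ J) G.verts ((l.map fun i => {i}) ++ ρ) := by
  have hs : s ∈ I := Finset.mem_toList.1 (hl.subset (by simp))
  have hI : IsForest I ∅ := isForest_empty ⟨s, hs⟩
  have hP : IsSubstTerm I J s ∅ (ρ, G.verts) :=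
    isSubstTerm_of_mem hd hs G hρ hI _ (by rw [subst_empty]; simp)
  have h1 : IsRootList I ∅ ((l.map fun i => {i}) ++ [{s}]) :=
    (isRootList_singletons hl).of_perm (List.perm_append_comm (l₁ := [{s}]))
  simpa using hP.isRootList hd hs hI h1 (by simp)

/-- Without inner vertices there is no path to descend: the forest on `J` is placed next to the
remaining leaves. So the whole content is the sign. -/
lemma comp_one_outer {s : α} (hd : Disjoint (I.erase s) J) {l : List α}
    (hl : (s :: l).Perm I.toList) (G : Forest J) {a : List α} (ha : a.Perm J.toList)
    {ρ : List (Finset α)} (hρ : IsRootList J G.verts ρ) :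
    comp I J s (oneForest I) (outer J G.verts a ρ) = (-1 : ℤˣ) ^ (l.length * J.card) •
      outer (I.erase s ∪ J) G.verts (l.reverse ++ a) ((l.map fun i => {i}) ++ ρ) := by
  have hs : s ∈ I := Finset.mem_toList.1 (hl.subset (by simp))
  have hI : IsForest I ∅ := isForest_empty ⟨s, hs⟩
  have hJ : 1 ≤ J.card := Finset.card_pos.2 G.isForest.nonempty
  have hnd := hl.nodup_iff.2 (Finset.nodup_toList _)
  have hsl : ({s} : Finset α) ∉ l.map fun i => ({i} : Finset α) := by
    simpa using (List.nodup_cons.1 hnd).1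
  have h0 : IsRootList I ∅ ({s} :: l.map fun i => {i}) := isRootList_singletons hl
  have h1 : IsRootList I ∅ ((l.map fun i => {i}) ++ [{s}]) :=
    h0.of_perm (List.perm_append_comm (l₁ := [{s}]))
  have e1 : orSign ({s} :: l.map fun i => ({i} : Finset α)) ((l.map fun i => {i}) ++ [{s}]) =
      (-1) ^ l.length := by
    have := orSign_cons_middle hsl []
    simpa using this
  have hlr : (l.reverse ++ [s]).Perm I.toList := by
    rw [← List.reverse_cons]
    exact (List.reverse_perm _).trans hl
  have hK := toList_union_perm hd hlr
  have eG : outer J G.verts a ρ = (orSign a J.toList * orSign ρ (roots J G.verts).toList) •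
      Finsupp.single G (1 : ℚ) := outer_of_isForest G.isForest _ _
  rw [oneForest_eq hl, List.map_cons, List.reverse_cons, outer_perm _ h0 h1, eG, map_units_smul,
    map_units_smul, LinearMap.smul_apply,
    comp_outer hd hs hI G hlr h1 (by simp), subst_empty, List.map_singleton, List.sum_singleton, e1]
  simp only [Finset.filter_empty, Finset.empty_union]
  rw [outer_perm _ (isRootList_singletons_append hd hl G hρ)
      (isRootList_singletons_append hd hl G isRootList_toList),
    outer_perm_left (ha.append_left l.reverse) hK, orSign_append_left, orSign_append_left,
    smul_smul, smul_smul, smul_smul, smul_smul, List.length_map]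
  congr 1
  -- Moving the root `{s}` to the end costs `l.length`, the Koszul sign costs `l.length * (J.card -
  -- 1)`.
  have : (-1 : ℤˣ) ^ l.length * (-1 : ℤˣ) ^ (l.length * (J.card - 1)) =
      (-1) ^ (l.length * J.card) := by
    rw [← pow_add]
    congr 1
    obtain ⟨n, hn⟩ := Nat.exists_eq_add_of_le hJ
    rw [hn, Nat.add_sub_cancel_left]
    ring
  rw [← this]
  simp only [mul_assoc, mul_comm]

lemma exists_cons_perm {s : α} (hs : s ∈ I) : ∃ l : List α, (s :: l).Perm I.toList :=
  ⟨_, (List.perm_cons_erase (Finset.mem_toList.2 hs)).symm⟩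

/-- The sign of `comp_one_outer` is also the cost of moving the roots of `J` in front of those of
`l`. The leaf word needs no move, since reversal already places `l` before `J`. -/
lemma comp_one_one {s : α} (hd : Disjoint (I.erase s) J) (hs : s ∈ I) (hJ : J.Nonempty) :
    comp I J s (oneForest I) (oneForest J) = oneForest (I.erase s ∪ J) := by
  obtain ⟨l, hl⟩ := exists_cons_perm hs
  have hperm : (J.toList ++ l).Perm (I.erase s ∪ J).toList := by
    have := toList_union_perm hd (a := l) (List.perm_append_comm.trans hl)
    exact List.perm_append_comm.trans this
  have hr := isRootList_singletons hperm
  rw [List.map_append] at hr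
  have hr2 := hr.of_perm List.perm_append_comm
  have e : orSign ((l.map fun i => ({i} : Finset α)) ++ J.toList.map fun i => {i})
      ((J.toList.map fun i => {i}) ++ l.map fun i => {i}) = (-1) ^ (l.length * J.card) := by
    have := orSign_append_comm (l := l.map fun i => ({i} : Finset α))
      (m := J.toList.map fun i => {i}) (n := []) (by simpa using hr2.1)
    simpa using this
  rw [oneForest_eq (List.Perm.refl J.toList), comp_one_outer hd hl ⟨∅, isForest_empty hJ⟩
    (List.reverse_perm _) (isRootList_singletons (List.Perm.refl _)), oneForest_eq hperm,
    List.map_append, List.reverse_append]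
  show _ • outer _ ∅ _ _ = _
  rw [outer_perm _ hr2 hr, e, smul_smul, Int.units_mul_self, one_smul]

/-- The pair of roots `X`, `Y` passes the singleton roots without a sign, whereas the joined root `X
∪ Y` passes them with sign `(-1) ^ l.length`. This is the ratio of the normalizing factors of
`joinOp` on the two leaf sets, which differ by `l.length` elements. -/
lemma comp_one_joinOp_roots {s : α} (hd : Disjoint (I.erase s) J) (hs : s ∈ I) (G : Forest J)
    {X Y : Finset α} (hX : X ∈ roots J G.verts) (hY : Y ∈ roots J G.verts) (hXY : X ≠ Y) :
    comp I J s (oneForest I) (joinOp X Y (Finsupp.single G 1)) =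
      joinOp X Y (comp I J s (oneForest I) (Finsupp.single G 1)) := by
  obtain ⟨l, hl⟩ := exists_cons_perm hs
  obtain ⟨ρ, hρ⟩ := exists_rootList hX hY hXY
  have hF : IsForest J (insert (X ∪ Y) G.verts) := G.isForest.join hX hY hXY
  have hK : IsForest (I.erase s ∪ J) G.verts := G.isForest.mono Finset.subset_union_right
  have hρ1 := isRootList_singletons_append hd hl G hρ
  have hρj := hρ.join G.isForest
  have hρ2 : IsRootList (I.erase s ∪ J) (insert (X ∪ Y) G.verts) _ :=
    isRootList_singletons_append hd hl ⟨_, hF⟩ hρj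
  have hp1 : ((l.map fun i => ({i} : Finset α)) ++ X :: Y :: ρ).Perm
      (X :: Y :: ((l.map fun i => {i}) ++ ρ)) := by
    have := (List.perm_append_comm (l₁ := l.map fun i => ({i} : Finset α))
      (l₂ := [X, Y])).append_right ρ
    simpa using this
  have e1 : orSign ((l.map fun i => ({i} : Finset α)) ++ X :: Y :: ρ)
      (X :: Y :: ((l.map fun i => {i}) ++ ρ)) = 1 := by
    have := orSign_append_comm (l := l.map fun i => ({i} : Finset α)) (m := [X, Y]) (n := ρ)
      (by simpa using hρ1.1)
    simpa using this
  have hp2 : ((l.map fun i => ({i} : Finset α)) ++ (X ∪ Y) :: ρ).Perm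
      ((X ∪ Y) :: ((l.map fun i => {i}) ++ ρ)) := List.perm_middle
  have e2 : orSign ((l.map fun i => ({i} : Finset α)) ++ (X ∪ Y) :: ρ)
      ((X ∪ Y) :: ((l.map fun i => {i}) ++ ρ)) = (-1) ^ l.length := by
    rw [orSign_middle_cons hρ2.1, List.length_map]
  have hc := card_erase_union hd hs
  have hlc : l.length + 1 = I.card := by
    rw [← Finset.length_toList, ← hl.length_eq, List.length_cons]
  have eG : (Finsupp.single G 1 : Bess J) = orSign (X :: Y :: ρ) (roots J G.verts).toList •
      outer J G.verts J.toList (X :: Y :: ρ) := by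
    rw [single_eq_outer, outer_perm _ isRootList_toList hρ, orSign_symm hρ.perm_toList
      (Finset.nodup_toList _)]
  have key := comp_one_outer hd hl ⟨_, hF⟩ (List.Perm.refl _) hρj
  rw [eG]
  simp only [map_units_smul]
  rw [joinOp_outer G.isForest _ hρ, map_units_smul, key, comp_one_outer hd hl G (List.Perm.refl _)
    hρ, map_units_smul, outer_perm _ hρ1 (hρ1.of_perm hp1), e1, one_smul,
    joinOp_outer hK _ (hρ1.of_perm hp1), outer_perm _ hρ2 (hρ2.of_perm hp2), e2]
  simp only [smul_smul, ← pow_add]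
  congr 2
  apply units_neg_one_pow_eq
  have : l.length + J.card = (I.erase s ∪ J).card := by omega
  rw [← this]
  congr 1
  ring

lemma comp_one_single {s : α} (hd : Disjoint (I.erase s) J) (hs : s ∈ I) (G : Forest J) :
    ∃ u : ℤˣ, comp I J s (oneForest I) (Finsupp.single G 1) = u •
      Finsupp.single (⟨G.verts, G.isForest.mono Finset.subset_union_right⟩ :
        Forest (I.erase s ∪ J)) 1 := by
  obtain ⟨l, hl⟩ := exists_cons_perm hs
  rw [single_eq_outer, comp_one_outer hd hl G (List.Perm.refl _) isRootList_toList,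
    outer_of_isForest (G.isForest.mono Finset.subset_union_right), smul_smul]
  exact ⟨_, rfl⟩

/-- The trees added by the composition are leaves outside `J`, so they do not enter the sums over
trees inside `B` and `C`. -/
lemma comp_one_joinOp {s : α} (hd : Disjoint (I.erase s) J) (hs : s ∈ I) {B C : Finset α}
    (hBJ : B ⊆ J) (hCJ : C ⊆ J) (hBC : Disjoint B C) (y : Bess J) :
    comp I J s (oneForest I) (joinOp B C y) = joinOp B C (comp I J s (oneForest I) y) := by
  suffices H : comp I J s (oneForest I) ∘ₗ joinOp B C =
      joinOp B C ∘ₗ comp I J s (oneForest I) from LinearMap.congr_fun H y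
  refine bess_hom_ext fun G => ?_
  have hfil : ∀ {B : Finset α}, B ⊆ J → (roots (I.erase s ∪ J) G.verts).filter (· ⊆ B) =
      (roots J G.verts).filter (· ⊆ B) := by
    intro B hB
    ext A
    simp only [Finset.mem_filter, mem_roots_of_subset G.isForest
      (Finset.subset_union_right (s₁ := I.erase s) (s₂ := J))]
    constructor
    · rintro ⟨h1 | ⟨i, hi, rfl⟩, h2⟩
      · exact ⟨h1, h2⟩
      · exact absurd (hB (by simpa using h2)) (Finset.mem_sdiff.1 hi).2
    · rintro ⟨h1, h2⟩
      exact ⟨Or.inl h1, h2⟩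
  obtain ⟨u, hu⟩ := comp_one_single hd hs G
  simp only [LinearMap.comp_apply]
  have e : joinOp B C (comp I J s (oneForest I) (Finsupp.single G 1)) =
      ∑ X ∈ (roots J G.verts).filter (· ⊆ B), ∑ Y ∈ (roots J G.verts).filter (· ⊆ C),
        joinOp X Y (comp I J s (oneForest I) (Finsupp.single G 1)) := by
    rw [hu]
    simp only [map_units_smul, ← Finset.smul_sum]
    rw [joinOp_single_eq_sum, hfil hBJ, hfil hCJ]
  rw [e, joinOp_single_eq_sum]
  simp only [map_sum]
  refine Finset.sum_congr rfl fun X hX => Finset.sum_congr rfl fun Y hY => ?_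
  rw [Finset.mem_filter] at hX hY
  exact comp_one_joinOp_roots hd hs G hX.1 hY.1
    (ne_of_roots_subset hBC G.isForest hX.1 hX.2 hY.2)

lemma signOp_one : signOp (oneForest I) = oneForest I := by
  rw [oneForest, signOp_outer]
  simp

/-- All copies of `oneForest` have degree zero, so the composition acts on each factor separately
and without signs. -/
lemma tensorComp_one_joinOp₂ {s : α} (hd : Disjoint (I.erase s) J) (hs : s ∈ I) {B C : Finset α}
    (hBJ : B ⊆ J) (hCJ : C ⊆ J) (hBC : Disjoint B C) (y : Bess J ⊗[ℚ] Bess J) :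
    tensorComp I J s (oneForest I ⊗ₜ oneForest I) (joinOp₂ B C y) =
      joinOp₂ B C (tensorComp I J s (oneForest I ⊗ₜ oneForest I) y) := by
  have hp : ∀ n, ((signOp : Bess I →ₗ[ℚ] Bess I) ^ n) (oneForest I) = oneForest I := by
    intro n
    induction n with
    | zero => simp
    | succ n ih => rw [pow_succ', Module.End.mul_apply, ih, signOp_one]
  have htc : ∀ x y : Bess J, tensorComp I J s (oneForest I ⊗ₜ oneForest I) (x ⊗ₜ y) =
      comp I J s (oneForest I) x ⊗ₜ comp I J s (oneForest I) y := by
    intro x y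
    suffices H : tensorComp I J s (oneForest I ⊗ₜ oneForest I) =
        TensorProduct.map (comp I J s (oneForest I)) (comp I J s (oneForest I)) from by
      rw [H, TensorProduct.map_tmul]
    refine bess₂_hom_ext fun G G' => ?_
    rw [tensorComp_tmul, hp, TensorProduct.map_tmul]
  suffices H : tensorComp I J s (oneForest I ⊗ₜ oneForest I) ∘ₗ joinOp₂ B C =
      joinOp₂ B C ∘ₗ tensorComp I J s (oneForest I ⊗ₜ oneForest I) from
    LinearMap.congr_fun H y
  refine bess₂_hom_ext fun G G' => ?_
  have hsg : signOp (comp I J s (oneForest I) (Finsupp.single G 1)) =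
      comp I J s (oneForest I) (signOp (Finsupp.single G 1)) := by
    obtain ⟨u, hu⟩ := comp_one_single hd hs G
    rw [signOp_single, map_units_smul, hu, map_units_smul, signOp_single, smul_comm]
    rfl
  simp only [LinearMap.comp_apply, joinOp₂_tmul, map_add, htc, hsg,
    comp_one_joinOp hd hs hBJ hCJ hBC]

lemma tensorComp_one_one {s : α} (hd : Disjoint (I.erase s) J) (hs : s ∈ I) (hJ : J.Nonempty) :
    tensorComp I J s (oneForest I ⊗ₜ oneForest I) (oneForest J ⊗ₜ oneForest J) =
      oneForest (I.erase s ∪ J) ⊗ₜ oneForest (I.erase s ∪ J) := by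
  have e : oneForest J = (orSign J.toList.reverse J.toList * orSign (J.toList.map fun i => {i})
      (roots J ∅).toList) • Finsupp.single (⟨∅, isForest_empty hJ⟩ : Forest J) (1 : ℚ) :=
    outer_of_isForest _ _ _
  have e2 : comp I J s (oneForest I) (oneForest J) = _ := comp_one_one hd hs hJ
  have : ∀ (x y : Bess I) (z : Bess J), tensorComp I J s (x ⊗ₜ y) (oneForest J ⊗ₜ z) =
      comp I J s x (oneForest J) ⊗ₜ comp I J s y z := by
    intro x y z
    rw [e, units_smul_tmul, map_units_smul, tensorComp_tmul, map_units_smul, units_smul_tmul]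
    simp [deg]
  rw [this, e2]

end One

/-! ### Construction of the coproduct -/

section Coproduct

variable {α : Type*} [DecidableEq α] {I J : Finset α} {W : Finset (Finset α)}

/-- `F` is obtained from `F'` by joining the trees `X` and `Y`, with sign `u`. -/
structure IsTopDecomp (F F' : Forest I) (X Y : Finset α) (u : ℤˣ) : Prop where
  left_mem : X ∈ roots I F'.verts
  right_mem : Y ∈ roots I F'.verts
  ne : X ≠ Y
  verts_eq : F.verts = insert (X ∪ Y) F'.verts
  join_eq : joinOp X Y (Finsupp.single F' 1) = u • (Finsupp.single F 1 : Bess I)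

lemma exists_isTopDecomp_join (F' : Forest I) {X Y : Finset α} (hX : X ∈ roots I F'.verts)
    (hY : Y ∈ roots I F'.verts) (hXY : X ≠ Y) :
    ∃ u, IsTopDecomp ⟨_, F'.isForest.join hX hY hXY⟩ F' X Y u := by
  obtain ⟨u, hu⟩ := exists_joinOp_single_eq F' hX hY hXY
  exact ⟨u, hX, hY, hXY, rfl, hu⟩

lemma exists_isTopDecomp (F : Forest I) {v : Finset α} (hv : v ∈ F.verts)
    (hr : v ∈ roots I F.verts) {X Y : Finset α} (hXY : X ≠ Y)
    (hc : children I F.verts v = {X, Y}) (hu : v = X ∪ Y) :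
    ∃ u, IsTopDecomp F ⟨F.verts.erase v, F.isForest.erase hv hr⟩ X Y u := by
  have hX := child_mem_roots_erase F.isForest hv hr (X := X) (by simp [hc])
  have hY := child_mem_roots_erase F.isForest hv hr (X := Y) (by simp [hc])
  have e : F.verts = insert (X ∪ Y) (F.verts.erase v) := by rw [← hu, Finset.insert_erase hv]
  obtain ⟨u, hu⟩ := exists_joinOp_single_eq ⟨F.verts.erase v, F.isForest.erase hv hr⟩ hX hY hXY
  refine ⟨u, hX, hY, hXY, e, ?_⟩
  rw [hu]
  congr 3
  exact e.symm

namespace IsTopDecomp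

variable {F F' : Forest I} {X Y : Finset α} {u : ℤˣ} (h : IsTopDecomp F F' X Y u)
include h

lemma disjoint : Disjoint X Y := F'.isForest.roots_disjoint h.left_mem h.right_mem h.ne

lemma notMem : X ∪ Y ∉ F'.verts := union_notMem F'.isForest h.left_mem h.right_mem h.ne

lemma card_eq : F.verts.card = F'.verts.card + 1 := by
  rw [h.verts_eq, Finset.card_insert_of_notMem h.notMem]

lemma verts_eq_erase : F'.verts = F.verts.erase (X ∪ Y) := by
  rw [h.verts_eq, Finset.erase_insert h.notMem]

lemma mem_verts : X ∪ Y ∈ F.verts := by rw [h.verts_eq]; simp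

lemma mem_roots : X ∪ Y ∈ roots I F.verts := by
  rw [h.verts_eq]
  exact (mem_roots_insert F'.isForest h.left_mem h.right_mem h.ne).2 (Or.inl rfl)

lemma children_eq : children I F.verts (X ∪ Y) = {X, Y} := by
  rw [h.verts_eq]
  exact children_insert_self F'.isForest h.left_mem h.right_mem h.ne

lemma single_eq : (Finsupp.single F 1 : Bess I) = u • joinOp X Y (Finsupp.single F' 1) := by
  rw [h.join_eq, smul_smul, Int.units_mul_self, one_smul]

lemma swap : IsTopDecomp F F' Y X (-u) where
  left_mem := h.right_mem
  right_mem := h.left_mem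
  ne := h.ne.symm
  verts_eq := by rw [h.verts_eq, Finset.union_comm]
  join_eq := by
    rw [joinOp_swap_single F' h.left_mem h.right_mem h.ne, h.join_eq, Units.neg_smul]

end IsTopDecomp

lemma single_smul_inj {F : Forest I} {u v : ℤˣ}
    (h : u • (Finsupp.single F 1 : Bess I) = v • Finsupp.single F 1) : u = v := by
  have := DFunLike.congr_fun h F
  rcases Int.units_eq_one_or u with rfl | rfl <;> rcases Int.units_eq_one_or v with rfl | rfl <;>
    first | rfl | (exfalso; norm_num at this)

lemma IsTopDecomp.unique {F F' : Forest I} {X Y : Finset α} {u v : ℤˣ}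
    (h : IsTopDecomp F F' X Y u) (h' : IsTopDecomp F F' X Y v) : u = v :=
  single_smul_inj (h.join_eq.symm.trans h'.join_eq)

open Classical in
/-- The value of the coproduct on a basis vector. -/
def cop (F : Forest I) : Bess I ⊗[ℚ] Bess I :=
  if h : ∃ p : Forest I × (Finset α × Finset α) × ℤˣ, IsTopDecomp F p.1 p.2.1.1 p.2.1.2 p.2.2 then
    h.choose.2.2 • joinOp₂ h.choose.2.1.1 h.choose.2.1.2 (cop h.choose.1)
  else
    (orSign I.toList.reverse I.toList * orSign (I.toList.map fun i => {i}) (roots I ∅).toList) •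
      (oneForest I ⊗ₜ oneForest I)
termination_by F.verts.card
decreasing_by
  have := h.choose_spec.card_eq
  omega

/-- The recursive definition picks an arbitrary root vertex and an order of its children; the value
is the same for every choice. Interchanging the children changes both the sign `u` and the operator
`joinOp₂` by a sign. For two different root vertices, both are removed and the anticommutation
relations are compared. -/
lemma cop_eq {F F' : Forest I} {X Y : Finset α} {u : ℤˣ} (h : IsTopDecomp F F' X Y u) :
    cop F = u • joinOp₂ X Y (cop F') := by
  induction hn : F.verts.card using Nat.strong_induction_on generalizing F F' X Y u with
  | h n ih =>
  have hex : ∃ p : Forest I × (Finset α × Finset α) × ℤˣ,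
    IsTopDecomp F p.1 p.2.1.1 p.2.1.2 p.2.2 := ⟨⟨F', (X, Y), u⟩, h⟩
  rw [cop, dif_pos hex]
  have h₁ := hex.choose_spec
  set F₁ := hex.choose.1
  set X₁ := hex.choose.2.1.1
  set Y₁ := hex.choose.2.1.2
  set u₁ := hex.choose.2.2
  by_cases hv : X ∪ Y = X₁ ∪ Y₁
  · have hF : F₁ = F' := Forest.ext (by rw [h₁.verts_eq_erase, h.verts_eq_erase, hv])
    have hc := h.children_eq
    rw [hv, h₁.children_eq] at hc
    have hX : X₁ = X ∨ X₁ = Y := by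
      have : X₁ ∈ ({X, Y} : Finset (Finset α)) := hc ▸ (by simp)
      simpa using this
    have hY : Y₁ = X ∨ Y₁ = Y := by
      have : Y₁ ∈ ({X, Y} : Finset (Finset α)) := hc ▸ (by simp)
      simpa using this
    have hne := h₁.ne
    rcases hX with hX | hX <;> rcases hY with hY | hY
    · exact absurd (hX.trans hY.symm) hne
    · rw [hF, hX, hY] at h₁ ⊢
      rw [h₁.unique h]
    · rw [hF, hX, hY] at h₁ ⊢
      rw [h₁.unique h.swap, joinOp₂_swap h.disjoint, LinearMap.neg_apply, Units.neg_smul, smul_neg,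
        neg_neg]
    · exact absurd (hX.trans hY.symm) hne
  -- The two root vertices differ, so each survives the removal of the other. The removals in either
  -- order lead to the same forest `F''`, and the induction hypothesis applies to `F'` and to `F₁`.
  · have h1 : X₁ ∪ Y₁ ∈ F'.verts := by
      rw [h.verts_eq_erase]
      exact Finset.mem_erase.2 ⟨Ne.symm hv, h₁.mem_verts⟩
    have h1r : X₁ ∪ Y₁ ∈ roots I F'.verts := by
      have := h₁.mem_roots
      rw [h.verts_eq, mem_roots_insert F'.isForest h.left_mem h.right_mem h.ne] at this
      exact (this.resolve_left (Ne.symm hv)).1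
    have h1c : children I F'.verts (X₁ ∪ Y₁) = {X₁, Y₁} := by
      rw [← h₁.children_eq, h.verts_eq,
        children_insert_of_mem F'.isForest h.left_mem h.right_mem h.ne (mem_nodes_of_mem h1)]
    have h2 : X ∪ Y ∈ F₁.verts := by
      rw [h₁.verts_eq_erase]
      exact Finset.mem_erase.2 ⟨hv, h.mem_verts⟩
    have h2r : X ∪ Y ∈ roots I F₁.verts := by
      have := h.mem_roots
      rw [h₁.verts_eq, mem_roots_insert F₁.isForest h₁.left_mem h₁.right_mem h₁.ne] at this
      exact (this.resolve_left hv).1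
    have h2c : children I F₁.verts (X ∪ Y) = {X, Y} := by
      rw [← h.children_eq, h₁.verts_eq,
        children_insert_of_mem F₁.isForest h₁.left_mem h₁.right_mem h₁.ne (mem_nodes_of_mem h2)]
    obtain ⟨a, ha⟩ := exists_isTopDecomp F' h1 h1r h₁.ne h1c rfl
    obtain ⟨b, hb⟩ := exists_isTopDecomp F₁ h2 h2r h.ne h2c rfl
    have hFF : (⟨F₁.verts.erase (X ∪ Y), F₁.isForest.erase h2 h2r⟩ : Forest I) =
        ⟨F'.verts.erase (X₁ ∪ Y₁), F'.isForest.erase h1 h1r⟩ := by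
      apply Forest.ext
      simp only [h.verts_eq_erase, h₁.verts_eq_erase]
      exact Finset.erase_right_comm
    rw [hFF] at hb
    set F'' : Forest I := ⟨F'.verts.erase (X₁ ∪ Y₁), F'.isForest.erase h1 h1r⟩
    have c1 := h.card_eq
    have c2 := h₁.card_eq
    rw [ih _ (by omega) ha rfl, ih _ (by omega) hb rfl]
    have hXX : Disjoint (X₁ ∪ Y₁) (X ∪ Y) := F.isForest.roots_disjoint h₁.mem_roots h.mem_roots
      (Ne.symm hv)
    rw [Finset.disjoint_union_left, Finset.disjoint_union_right, Finset.disjoint_union_right] at hXX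
    -- Anticommutation applied to `F''` relates the four signs of the removals. The same relation
    -- for `joinOp₂` then produces exactly the sign needed.
    have hop := LinearMap.congr_fun (joinOp_anticomm h₁.disjoint h.disjoint hXX.1.1 hXX.1.2
      hXX.2.1 hXX.2.2) (Finsupp.single F'' (1 : ℚ))
    simp only [LinearMap.comp_apply, LinearMap.neg_apply] at hop
    rw [ha.join_eq, hb.join_eq, map_units_smul, map_units_smul, h₁.join_eq, h.join_eq, smul_smul,
      smul_smul, ← Units.neg_smul] at hop
    have hs := single_smul_inj hop
    rw [map_units_smul, map_units_smul, joinOp₂_anticomm h₁.disjoint h.disjoint hXX.1.1 hXX.1.2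
      hXX.2.1 hXX.2.2, smul_neg, smul_neg, smul_smul, smul_smul, ← Units.neg_smul]
    congr 1
    rw [mul_comm u₁, hs, neg_neg, mul_comm]

/-- The coproduct. -/
def coproduct (I : Finset α) : Bess I →ₗ[ℚ] Bess I ⊗[ℚ] Bess I :=
  Finsupp.linearCombination ℚ cop

lemma coproduct_single (F : Forest I) : coproduct I (Finsupp.single F 1) = cop F := by
  simp [coproduct]

lemma oneForest_eq_smul (hI : I.Nonempty) : oneForest I =
    (orSign I.toList.reverse I.toList * orSign (I.toList.map fun i => {i}) (roots I ∅).toList) •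
      Finsupp.single (⟨∅, isForest_empty hI⟩ : Forest I) (1 : ℚ) :=
  outer_of_isForest _ _ _

lemma exists_single_empty_eq (h : IsForest I ∅) :
    ∃ u : ℤˣ, (Finsupp.single (⟨∅, h⟩ : Forest I) 1 : Bess I) = u • oneForest I := by
  refine ⟨orSign I.toList.reverse I.toList *
    orSign (I.toList.map fun i => {i}) (roots I ∅).toList, ?_⟩
  rw [oneForest_eq_smul h.nonempty, smul_smul, Int.units_mul_self, one_smul]

lemma coproduct_one : coproduct I (oneForest I) = oneForest I ⊗ₜ oneForest I := by
  rcases I.eq_empty_or_nonempty with rfl | hI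
  · have : oneForest (∅ : Finset α) = 0 := by
      rw [oneForest, outer, dif_neg]
      intro h
      exact Finset.not_nonempty_empty h.nonempty
    rw [this]
    simp
  · have h0 : cop (⟨∅, isForest_empty hI⟩ : Forest I) = (orSign I.toList.reverse I.toList *
        orSign (I.toList.map fun i => {i}) (roots I ∅).toList) •
        (oneForest I ⊗ₜ oneForest I) := by
      rw [cop, dif_neg]
      rintro ⟨p, hp⟩
      have := hp.card_eq
      simp at this
    nth_rewrite 1 [oneForest_eq_smul hI]
    rw [map_units_smul, coproduct_single, h0, smul_smul, Int.units_mul_self, one_smul]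

/-- This is the recursion behind `cop`, restated without the auxiliary sign; together with
`coproduct_one` it is all that is used about the coproduct. -/
lemma coproduct_joinOp_roots (F : Forest I) {X Y : Finset α} (hX : X ∈ roots I F.verts)
    (hY : Y ∈ roots I F.verts) (hXY : X ≠ Y) :
    coproduct I (joinOp X Y (Finsupp.single F 1)) =
      joinOp₂ X Y (coproduct I (Finsupp.single F 1)) := by
  obtain ⟨u, hu⟩ := exists_isTopDecomp_join F hX hY hXY
  rw [hu.join_eq, map_units_smul, coproduct_single, coproduct_single, cop_eq hu, smul_smul,
    Int.units_mul_self, one_smul]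

lemma tmul_mem_refSpan₂ {R : Finset (Finset α)} {x y : Bess I} (hx : x ∈ refSpan I R)
    (hy : y ∈ refSpan I R) : x ⊗ₜ[ℚ] y ∈ refSpan₂ I R := by
  induction hx using Submodule.span_induction with
  | zero => simp
  | add a b _ _ ha hb => rw [TensorProduct.add_tmul]; exact Submodule.add_mem _ ha hb
  | smul c a _ ha => rw [← TensorProduct.smul_tmul']; exact Submodule.smul_mem _ _ ha
  | mem a ha =>
    obtain ⟨F, hF, rfl⟩ := ha
    induction hy using Submodule.span_induction with
    | zero => simp
    | add a b _ _ ha hb => rw [TensorProduct.tmul_add]; exact Submodule.add_mem _ ha hb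
    | smul c a _ ha => rw [TensorProduct.tmul_smul]; exact Submodule.smul_mem _ _ ha
    | mem a ha =>
      obtain ⟨F', hF', rfl⟩ := ha
      exact single_mem_refSpan₂ hF hF'

lemma refines_mono {F : Forest I} {R R' : Finset (Finset α)} (h : Refines F R)
    (hRR : ∀ B ∈ R, ∃ B' ∈ R', B ⊆ B') : Refines F R' := by
  intro A hA
  obtain ⟨B, hB, hAB⟩ := h A hA
  obtain ⟨B', hB', hBB⟩ := hRR B hB
  exact ⟨B', hB', hAB.trans hBB⟩

lemma joinOp_single_mem {R R' : Finset (Finset α)} (hRR : ∀ B ∈ R, ∃ B' ∈ R', B ⊆ B')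
    {X Y : Finset α} (hXY : Disjoint X Y) (hXYR : ∃ B' ∈ R', X ∪ Y ⊆ B') {F : Forest I}
    (hF : Refines F R) : joinOp X Y (Finsupp.single F 1 : Bess I) ∈ refSpan I R' := by
  rw [joinOp_single_eq_sum]
  refine Submodule.sum_mem _ fun A hA => Submodule.sum_mem _ fun B hB => ?_
  rw [Finset.mem_filter] at hA hB
  have hne := ne_of_roots_subset hXY F.isForest hA.1 hA.2 hB.2
  obtain ⟨u, hu⟩ := exists_joinOp_single_eq F hA.1 hB.1 hne
  rw [hu]
  refine units_smul_mem _ _ (single_mem_refSpan fun C hC => ?_)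
  rw [mem_roots_insert F.isForest hA.1 hB.1 hne] at hC
  rcases hC with rfl | ⟨hC, -⟩
  · obtain ⟨B', hB', hs⟩ := hXYR
    exact ⟨B', hB', (Finset.union_subset_union hA.2 hB.2).trans hs⟩
  · exact refines_mono hF hRR C hC

lemma joinOp_mem {R R' : Finset (Finset α)} (hRR : ∀ B ∈ R, ∃ B' ∈ R', B ⊆ B')
    {X Y : Finset α} (hXY : Disjoint X Y) (hXYR : ∃ B' ∈ R', X ∪ Y ⊆ B') {x : Bess I}
    (hx : x ∈ refSpan I R) : joinOp X Y x ∈ refSpan I R' := by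
  induction hx using Submodule.span_induction with
  | zero => simp
  | add a b _ _ ha hb => rw [map_add]; exact Submodule.add_mem _ ha hb
  | smul c a _ ha => rw [map_smul]; exact Submodule.smul_mem _ _ ha
  | mem a ha =>
    obtain ⟨F, hF, rfl⟩ := ha
    exact joinOp_single_mem hRR hXY hXYR hF

lemma joinOp₂_mem {R R' : Finset (Finset α)} (hRR : ∀ B ∈ R, ∃ B' ∈ R', B ⊆ B')
    {X Y : Finset α} (hXY : Disjoint X Y) (hXYR : ∃ B' ∈ R', X ∪ Y ⊆ B') {x : Bess I ⊗[ℚ] Bess I}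
    (hx : x ∈ refSpan₂ I R) : joinOp₂ X Y x ∈ refSpan₂ I R' := by
  induction hx using Submodule.span_induction with
  | zero => simp
  | add a b _ _ ha hb => rw [map_add]; exact Submodule.add_mem _ ha hb
  | smul c a _ ha => rw [map_smul]; exact Submodule.smul_mem _ _ ha
  | mem a ha =>
    obtain ⟨p, hp, rfl⟩ := ha
    simp only [joinOp₂_tmul]
    refine Submodule.add_mem _ (tmul_mem_refSpan₂ (joinOp_single_mem hRR hXY hXYR hp.1)
      (single_mem_refSpan (refines_mono hp.2 hRR))) (tmul_mem_refSpan₂ ?_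
      (joinOp_single_mem hRR hXY hXYR hp.2))
    rw [signOp_single]
    exact units_smul_mem _ _ (single_mem_refSpan (refines_mono hp.1 hRR))

/-- In each factor a join either takes place or not, so no tree can grow beyond the tree of `F` that
contains it. This is needed for additivity of `joinOp₂` in its leaf sets. -/
lemma cop_mem (F : Forest I) : cop F ∈ refSpan₂ I (roots I F.verts) := by
  obtain ⟨W, h⟩ := F
  suffices H : ∀ h : IsForest I W, coproduct I (Finsupp.single ⟨W, h⟩ 1) ∈
      refSpan₂ I (roots I W) from by
    rw [← coproduct_single]
    exact H h
  refine h.induction (P := fun W => ∀ h : IsForest I W, coproduct I (Finsupp.single ⟨W, h⟩ 1) ∈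
      refSpan₂ I (roots I W)) ?_ ?_
  · intro _ h
    obtain ⟨u, hu⟩ := exists_single_empty_eq h
    have hone : oneForest I ∈ refSpan I (roots I ∅) := by
      rw [oneForest_eq_smul h.nonempty]
      exact units_smul_mem _ _ (single_mem_refSpan (refines_roots _))
    rw [hu, map_units_smul, coproduct_one]
    exact units_smul_mem _ _ (tmul_mem_refSpan₂ hone hone)
  · intro W h X hX Y hY hXY ih h'
    obtain ⟨u, hu⟩ := exists_isTopDecomp_join ⟨W, h⟩ hX hY hXY
    have hu' : (Finsupp.single (⟨insert (X ∪ Y) W, h'⟩ : Forest I) 1 : Bess I) =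
        u • joinOp X Y (Finsupp.single ⟨W, h⟩ 1) := hu.single_eq
    rw [hu', map_units_smul, coproduct_joinOp_roots ⟨W, h⟩ hX hY hXY]
    have hr : ∀ {A : Finset α}, A ∈ roots I (insert (X ∪ Y) W) ↔ _ :=
      mem_roots_insert h hX hY hXY
    refine units_smul_mem _ _ (joinOp₂_mem (fun B hB => ?_) hu.disjoint
      ⟨X ∪ Y, (hr).2 (Or.inl rfl), Finset.Subset.refl _⟩ (ih h))
    by_cases hBX : B = X
    · exact ⟨X ∪ Y, hr.2 (Or.inl rfl), hBX ▸ Finset.subset_union_left⟩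
    · by_cases hBY : B = Y
      · exact ⟨X ∪ Y, hr.2 (Or.inl rfl), hBY ▸ Finset.subset_union_right⟩
      · exact ⟨B, hr.2 (Or.inr ⟨hB, hBX, hBY⟩), Finset.Subset.refl _⟩

/-- Both sides are split into pairs of trees of `F`: on the left by the definition of the operator,
on the right by additivity, since both factors of the coproduct refine the trees of `F`. -/
lemma coproduct_joinOp_single {R : Finset (Finset α)}
    (hR : ∀ B ∈ R, ∀ C ∈ R, B ≠ C → Disjoint B C) {F : Forest I} (hF : Refines F R)
    {B C : Finset α} (hB : B ∈ R) (hC : C ∈ R) (hBC : B ≠ C) :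
    coproduct I (joinOp B C (Finsupp.single F 1)) =
      joinOp₂ B C (coproduct I (Finsupp.single F 1)) := by
  have hd := hR B hB C hC hBC
  have e : joinOp₂ B C (coproduct I (Finsupp.single F 1)) =
      (∑ X ∈ (roots I F.verts).filter (· ⊆ B), ∑ Y ∈ (roots I F.verts).filter (· ⊆ C),
        joinOp₂ X Y) (coproduct I (Finsupp.single F 1)) := by
    have hmem := cop_mem F
    rw [← coproduct_single] at hmem
    refine refSpan₂_hom_ext (fun F₁ F₂ h₁ h₂ => ?_) hmem
    have hpd : ∀ {B : Finset α}, ∀ X ∈ (roots I F.verts).filter (· ⊆ B),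
        ∀ Y ∈ (roots I F.verts).filter (· ⊆ B), X ≠ Y → Disjoint X Y := fun X hX Y hY hXY =>
      F.isForest.roots_disjoint (Finset.mem_filter.1 hX).1 (Finset.mem_filter.1 hY).1 hXY
    have hcover : ∀ {B}, B ∈ R → ∀ (F' : Forest I), Refines F' (roots I F.verts) →
        ∀ A ∈ roots I F'.verts, A ⊆ B → ∃ X ∈ (roots I F.verts).filter (· ⊆ B), A ⊆ X := by
      intro B hB F' hF' A hA hAB
      obtain ⟨X, hX, hAX⟩ := hF' A hA
      obtain ⟨B', hB', hXB⟩ := hF X hX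
      by_cases hBB : B' = B
      · exact ⟨X, Finset.mem_filter.2 ⟨hX, hBB ▸ hXB⟩, hAX⟩
      · exfalso
        obtain ⟨i, hi⟩ := F'.isForest.root_nonempty hA
        exact Finset.disjoint_left.1 (hR B' hB' B hB hBB) (hXB (hAX hi)) (hAB hi)
    have hsub : ∀ {B : Finset α}, ∀ X ∈ (roots I F.verts).filter (· ⊆ B), X ⊆ B := fun X hX =>
      (Finset.mem_filter.1 hX).2
    simp only [LinearMap.sum_apply, joinOp₂_tmul]
    rw [joinOp_additive F₁ hpd hpd hsub hsub (hcover hB F₁ h₁) (hcover hC F₁ h₁),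
      joinOp_additive F₂ hpd hpd hsub hsub (hcover hB F₂ h₂) (hcover hC F₂ h₂)]
    simp only [Finset.sum_add_distrib, TensorProduct.sum_tmul, TensorProduct.tmul_sum]
  rw [e, joinOp_single_eq_sum]
  simp only [map_sum, LinearMap.sum_apply]
  refine Finset.sum_congr rfl fun X hX => Finset.sum_congr rfl fun Y hY => ?_
  rw [Finset.mem_filter] at hX hY
  exact coproduct_joinOp_roots F hX.1 hY.1 (ne_of_roots_subset hd F.isForest hX.1 hX.2 hY.2)

lemma coproduct_joinOp {R : Finset (Finset α)}
    (hR : ∀ B ∈ R, ∀ C ∈ R, B ≠ C → Disjoint B C) {x : Bess I} (hx : x ∈ refSpan I R)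
    {B C : Finset α} (hB : B ∈ R) (hC : C ∈ R) (hBC : B ≠ C) :
    coproduct I (joinOp B C x) = joinOp₂ B C (coproduct I x) := by
  have : (coproduct I ∘ₗ joinOp B C) x = (joinOp₂ B C ∘ₗ coproduct I) x :=
    refSpan_hom_ext (fun F hF => coproduct_joinOp_single hR hF hB hC hBC) hx
  exact this

/-- Induction over the joins that build the right factor. Composition with `oneForest` commutes with
these joins, both on `Bess` and on its tensor square. -/
lemma coproduct_comp_one {s : α} (hd : Disjoint (I.erase s) J) (hs : s ∈ I) (G : Forest J) :
    coproduct (I.erase s ∪ J) (comp I J s (oneForest I) (Finsupp.single G 1)) =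
      tensorComp I J s (coproduct I (oneForest I)) (coproduct J (Finsupp.single G 1)) := by
  obtain ⟨W, h⟩ := G
  suffices H : ∀ h : IsForest J W, coproduct (I.erase s ∪ J) (comp I J s (oneForest I)
      (Finsupp.single ⟨W, h⟩ 1)) =
      tensorComp I J s (coproduct I (oneForest I)) (coproduct J (Finsupp.single ⟨W, h⟩ 1)) from H h
  refine h.induction (P := fun W => ∀ h : IsForest J W, coproduct (I.erase s ∪ J)
    (comp I J s (oneForest I) (Finsupp.single ⟨W, h⟩ 1)) =
      tensorComp I J s (coproduct I (oneForest I)) (coproduct J (Finsupp.single ⟨W, h⟩ 1))) ?_ ?_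
  · intro hJ h
    obtain ⟨u, hu⟩ := exists_single_empty_eq h
    rw [hu]
    simp only [map_units_smul]
    rw [comp_one_one hd hs hJ, coproduct_one, coproduct_one, coproduct_one,
      tensorComp_one_one hd hs hJ]
  · intro W h X hX Y hY hXY ih h'
    obtain ⟨u, hu⟩ := exists_isTopDecomp_join ⟨W, h⟩ hX hY hXY
    have hu' : (Finsupp.single (⟨insert (X ∪ Y) W, h'⟩ : Forest J) 1 : Bess J) =
        u • joinOp X Y (Finsupp.single ⟨W, h⟩ 1) := hu.single_eq
    have hmono : ∀ A, A ∈ roots (I.erase s ∪ J) W ↔ _ := fun A =>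
      mem_roots_of_subset h (Finset.subset_union_right (s₁ := I.erase s) (s₂ := J)) (A := A)
    obtain ⟨w, hw⟩ := comp_one_single hd hs (⟨W, h⟩ : Forest J)
    have e1 : coproduct (I.erase s ∪ J) (joinOp X Y (comp I J s (oneForest I)
        (Finsupp.single ⟨W, h⟩ 1))) = joinOp₂ X Y (coproduct (I.erase s ∪ J)
          (comp I J s (oneForest I) (Finsupp.single ⟨W, h⟩ 1))) := by
      rw [hw, map_units_smul, map_units_smul, map_units_smul, map_units_smul,
        coproduct_joinOp_roots ⟨W, _⟩ ((hmono X).2 (Or.inl hX)) ((hmono Y).2 (Or.inl hY)) hXY]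
    have e2 := comp_one_joinOp_roots hd hs ⟨W, h⟩ hX hY hXY
    have e3 := coproduct_joinOp_roots ⟨W, h⟩ hX hY hXY
    have e4 := tensorComp_one_joinOp₂ hd hs (h.root_subset hX) (h.root_subset hY) hu.disjoint
      (coproduct J (Finsupp.single ⟨W, h⟩ 1))
    have e5 := ih h
    rw [coproduct_one] at e5
    rw [hu', map_units_smul, map_units_smul, map_units_smul, map_units_smul, e2, e1, e3, e5,
      coproduct_one, e4]

lemma tensorComp_units_smul {s : α} (u : ℤˣ) (x : Bess I ⊗[ℚ] Bess I) (y : Bess J ⊗[ℚ] Bess J) :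
    tensorComp I J s (u • x) y = u • tensorComp I J s x y :=
  map_units_smul ((tensorComp I J s).flip y) u x

/-- The coproduct is compatible with partial compositions. -/
lemma coproduct_comp {s : α} (hd : Disjoint (I.erase s) J) (hs : s ∈ I) (x : Bess I)
    (y : Bess J) :
    coproduct (I.erase s ∪ J) (comp I J s x y) =
      tensorComp I J s (coproduct I x) (coproduct J y) := by
  suffices H : ∀ G : Forest J,
      coproduct (I.erase s ∪ J) ∘ₗ (comp I J s).flip (Finsupp.single G 1) =
      (tensorComp I J s).flip (coproduct J (Finsupp.single G 1)) ∘ₗ coproduct I from by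
    have : coproduct (I.erase s ∪ J) ∘ₗ comp I J s x =
        tensorComp I J s (coproduct I x) ∘ₗ coproduct J :=
      bess_hom_ext fun G => LinearMap.congr_fun (H G) x
    exact LinearMap.congr_fun this y
  refine fun G => bess_hom_ext fun F => ?_
  simp only [LinearMap.comp_apply, LinearMap.flip_apply]
  obtain ⟨W, h⟩ := F
  suffices H : ∀ h : IsForest I W, coproduct (I.erase s ∪ J) (comp I J s (Finsupp.single ⟨W, h⟩ 1)
      (Finsupp.single G 1)) = tensorComp I J s (coproduct I (Finsupp.single ⟨W, h⟩ 1))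
        (coproduct J (Finsupp.single G 1)) from H h
  refine h.induction (P := fun W => ∀ h : IsForest I W, coproduct (I.erase s ∪ J)
      (comp I J s (Finsupp.single ⟨W, h⟩ 1) (Finsupp.single G 1)) =
      tensorComp I J s (coproduct I (Finsupp.single ⟨W, h⟩ 1))
        (coproduct J (Finsupp.single G 1))) ?_ ?_
  · intro _ h
    obtain ⟨u, hu⟩ := exists_single_empty_eq h
    rw [hu, map_units_smul (comp I J s), LinearMap.smul_apply, map_units_smul, map_units_smul,
      tensorComp_units_smul, coproduct_comp_one hd hs]
  · intro W h X hX Y hY hXY ih h'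
    obtain ⟨u, hu⟩ := exists_isTopDecomp_join ⟨W, h⟩ hX hY hXY
    have hu' : (Finsupp.single (⟨insert (X ∪ Y) W, h'⟩ : Forest I) 1 : Bess I) =
        u • joinOp X Y (Finsupp.single ⟨W, h⟩ 1) := hu.single_eq
    have hmem := comp_mem_refSpan hd hs ⟨W, h⟩ G (refines_roots ⟨W, h⟩)
    have hcop := cop_mem (⟨W, h⟩ : Forest I)
    rw [← coproduct_single] at hcop
    have hdisj : Disjoint (substSet J s X) (substSet J s Y) :=
      substSet_disjoint hd (h.root_subset hX) (h.root_subset hY) hu.disjoint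
    have hne : substSet J s X ≠ substSet J s Y := by
      intro e
      rw [e, disjoint_self] at hdisj
      have : (substSet J s Y).Nonempty := by
        unfold substSet
        split_ifs
        · exact G.isForest.nonempty.mono Finset.subset_union_right
        · exact h.root_nonempty hY
      exact this.ne_empty hdisj
    have hR : ∀ B ∈ (roots I W).image (substSet J s), ∀ C ∈ (roots I W).image (substSet J s),
        B ≠ C → Disjoint B C := by
      intro B hB C hC hBC
      obtain ⟨B, hB', rfl⟩ := Finset.mem_image.1 hB
      obtain ⟨C, hC', rfl⟩ := Finset.mem_image.1 hC
      exact substSet_disjoint hd (h.root_subset hB') (h.root_subset hC')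
        (h.roots_disjoint hB' hC' fun e => hBC (by rw [e]))
    -- The join is carried out of the composition (`e1`), through the coproduct of the composite
    -- (`e2`), through that of `F` (`e3`) and out of the tensor composition (`e4`). After this the
    -- induction hypothesis remains.
    have e1 := comp_joinOp_roots hd hs ⟨W, h⟩ G hX hY hXY
    have e2 := coproduct_joinOp hR hmem (Finset.mem_image_of_mem _ hX)
      (Finset.mem_image_of_mem _ hY) hne
    have e3 := coproduct_joinOp_roots ⟨W, h⟩ hX hY hXY
    have e4 := tensorComp_joinOp₂ hd hs (fun B hB C hC hBC => h.roots_disjoint hB hC hBC)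
      (fun B hB => h.root_subset hB) hX hY hXY hcop (y := coproduct J (Finsupp.single G 1))
    rw [hu', map_units_smul (comp I J s), LinearMap.smul_apply, map_units_smul, map_units_smul,
      tensorComp_units_smul, e1, e2, e3, e4, ih h]

end Coproduct

/-! ### Existence and uniqueness of the coproduct -/

section Uniqueness

variable {α : Type*} [DecidableEq α] {I J : Finset α} {W : Finset (Finset α)}

lemma unit_eq (i : α) : unit i = oneForest {i} := by
  rw [oneForest_eq (l := [i]) (by simp)]
  rfl

lemma pair_perm {i j : α} (hij : i ≠ j) : [i, j].Perm ({i, j} : Finset α).toList := by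
  rw [List.perm_ext_iff_of_nodup (by simpa using hij) (Finset.nodup_toList _)]
  simp

lemma genE_eq {i j : α} (hij : i ≠ j) : genE i j = oneForest {i, j} := by
  rw [oneForest_eq (pair_perm hij)]
  rfl

/-- The minus sign reflects the opposite leaf orders in `Ω_{i,j}` and `E_{i,j}`; the normalizing
factor of `joinOp` is trivial on two leaves. -/
lemma genOmega_eq {i j : α} (hij : i ≠ j) :
    genOmega i j = - joinOp {i} {j} (oneForest {i, j}) := by
  have h0 : IsForest ({i, j} : Finset α) ∅ := isForest_empty ⟨i, by simp⟩
  have hp := pair_perm hij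
  rw [oneForest_eq hp]
  have := joinOp_outer h0 [j, i] (isRootList_singletons hp)
  simp only [List.map_nil] at this
  simp only [List.reverse_cons, List.reverse_nil, List.nil_append, List.cons_append, List.map_cons,
    List.map_nil]
  rw [this, outer_perm_left (List.Perm.swap i j []) hp, orSign_swap hij.symm,
    Finset.card_pair hij]
  simp [genOmega]

lemma oneForest_mem_refSpan (hI : I.Nonempty) {R : Finset (Finset α)}
    (hR : ∀ i ∈ I, ∃ B ∈ R, i ∈ B) : oneForest I ∈ refSpan I R := by
  rw [oneForest_eq_smul hI]
  refine units_smul_mem _ _ (single_mem_refSpan fun A hA => ?_)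
  obtain ⟨i, hi, rfl⟩ := roots_empty_iff.1 hA
  simpa using hR i hi

lemma coproduct_genOmega {i j : α} (hij : i ≠ j) : coproduct {i, j} (genOmega i j) =
    genE i j ⊗ₜ[ℚ] genOmega i j + genOmega i j ⊗ₜ[ℚ] genE i j := by
  have h1 : oneForest {i, j} ∈ refSpan {i, j} ({{i}, {j}} : Finset (Finset α)) :=
    oneForest_mem_refSpan ⟨i, by simp⟩ (by simp)
  rw [genE_eq hij, genOmega_eq hij, map_neg, coproduct_joinOp ?_ h1 (by simp) (by simp)
    (by simpa using hij), coproduct_one, joinOp₂_tmul, signOp_one, TensorProduct.tmul_neg,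
    TensorProduct.neg_tmul]
  · abel
  · simp only [Finset.mem_insert, Finset.mem_singleton]
    rintro B (rfl | rfl) C (rfl | rfl) hBC <;> simp_all [eq_comm]

lemma isBessCoproduct_coproduct : IsBessCoproduct (α := α) coproduct where
  map_unit i := by rw [unit_eq, coproduct_one]
  map_comp I J s hs hd x y := coproduct_comp hd hs x y
  map_genE i j hij := by rw [genE_eq hij, coproduct_one]
  map_genOmega i j hij := coproduct_genOmega hij

lemma comp_joinOp_of_mem_refSpan {s : α} (hd : Disjoint (I.erase s) J) (hs : s ∈ I) {x : Bess I}
    (G : Forest J) {R : Finset (Finset α)} (hR : ∀ B ∈ R, ∀ C ∈ R, B ≠ C → Disjoint B C)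
    (hRI : ∀ B ∈ R, B ⊆ I) (hx : x ∈ refSpan I R) {B C : Finset α} (hB : B ∈ R) (hC : C ∈ R)
    (hBC : B ≠ C) :
    comp I J s (joinOp B C x) (Finsupp.single G 1) =
      joinOp (substSet J s B) (substSet J s C) (comp I J s x (Finsupp.single G 1)) := by
  have : ((comp I J s).flip (Finsupp.single G 1) ∘ₗ joinOp B C) x =
      (joinOp (substSet J s B) (substSet J s C) ∘ₗ (comp I J s).flip (Finsupp.single G 1)) x :=
    refSpan_hom_ext (fun F hF => comp_joinOp hd hs F G hR hRI hF hB hC hBC) hx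
  exact this

lemma disjoint_erase_pair {i j : α} (hj : j ∉ I) : Disjoint (I.erase i) {i, j} := by
  simp [hj]

lemma isForest_pair {i j : α} (hij : i ≠ j) :
    IsForest ({i, j} : Finset α) ({{i, j}} : Finset (Finset α)) := by
  have h0 : IsForest ({i, j} : Finset α) ∅ := isForest_empty ⟨i, by simp⟩
  exact h0.join (roots_empty_iff.2 ⟨i, by simp, rfl⟩) (roots_empty_iff.2 ⟨j, by simp, rfl⟩)
    (by simpa using hij)

lemma genOmega_eq_smul {i j : α} (hij : i ≠ j) : ∃ u : ℤˣ, genOmega i j =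
    u • Finsupp.single (⟨{{i, j}}, isForest_pair hij⟩ : Forest {i, j}) (1 : ℚ) :=
  ⟨_, outer_of_isForest (isForest_pair hij) _ _⟩

/-- Because `{i, j}` is a vertex, a tree contains both leaves or neither. Contracting this vertex to
the leaf `i` erases `j`, and substitution for `i` restores it. -/
lemma substSet_erase_root {i j : α} (hj : j ∉ I) {W : Finset (Finset α)}
    (h : IsForest (I.erase i ∪ {i, j}) W) (hv : {i, j} ∈ W) {X : Finset α}
    (hX : X ∈ roots (I.erase i ∪ {i, j}) W) : substSet {i, j} i (X.erase j) = X := by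
  rcases h.node_subset_or_disjoint_root (mem_nodes_of_mem hv) hX with h1 | h1
  · have hi : i ∈ X := h1 (by simp)
    have hj' : j ∈ X := h1 (by simp)
    unfold substSet
    by_cases hij : i = j
    · subst hij
      exact absurd hv (by simpa using h.singleton_notMem i)
    · rw [if_pos (Finset.mem_erase.2 ⟨hij, hi⟩)]
      ext k
      simp only [Finset.mem_union, Finset.mem_erase, Finset.mem_insert, Finset.mem_singleton]
      by_cases hki : k = i
      · simp [hki, hi]
      · by_cases hkj : k = j
        · simp [hkj, hj']
        · simp [hki, hkj]
  · have hi : i ∉ X := fun hx => Finset.disjoint_left.1 h1 (by simp) hx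
    have hj' : j ∉ X := fun hx => Finset.disjoint_left.1 h1 (by simp) hx
    rw [Finset.erase_eq_of_notMem hj', substSet, if_neg hi]

/-- A vertex that is maximal among those different from `{i, j}` is a root: it has at least two
leaves, so it is not strictly below `{i, j}`. -/
lemma exists_top_ne {K : Finset α} {W : Finset (Finset α)} (h : IsForest K W) {i j : α}
    (hv : {i, j} ∈ W) (hc : W.card ≠ 1) : ∃ v ∈ W, v ∈ roots K W ∧ v ≠ {i, j} := by
  have hne : (W.erase {i, j}).Nonempty := by
    rw [Finset.nonempty_iff_ne_empty]
    intro h0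
    apply hc
    rw [← Finset.card_erase_add_one hv, h0]
    rfl
  obtain ⟨v, hm⟩ := (W.erase {i, j}).exists_maximal hne
  have hvm := Finset.mem_erase.1 hm.1
  refine ⟨v, hvm.2, mem_roots.2 ⟨mem_nodes_of_mem hvm.2, fun C hC hlt => ?_⟩, hvm.1⟩
  have hvne := h.nodes_nonempty (mem_nodes_of_mem hvm.2)
  have hcard : 2 ≤ v.card := by
    by_contra hlt
    have : v.card = 1 := by have := hvne.card_pos; omega
    obtain ⟨k, rfl⟩ := Finset.card_eq_one.1 this
    exact h.singleton_notMem k hvm.2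
  have hcl := Finset.card_lt_card hlt
  rcases mem_nodes.1 hC with hC | ⟨k, -, rfl⟩
  · by_cases hCij : C = {i, j}
    · have := Finset.card_le_two (a := i) (b := j)
      rw [hCij] at hcl
      omega
    · exact hlt.2 (hm.2 (Finset.mem_erase.2 ⟨hCij, hC⟩) hlt.1)
  · rw [Finset.card_singleton] at hcl
    omega

/-- Contracting the vertex `{i, j}` to a leaf should give `x`. It is constructed by removing the
other vertices of `F` from the root upwards and redoing the joins on `I`, which avoids analyzing
substitutions directly; membership in `refSpan` is what makes each join commute with the
composition. -/
lemma exists_comp_genOmega {i j : α} (hi : i ∈ I) (hj : j ∉ I)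
    (F : Forest (I.erase i ∪ {i, j})) (hv : {i, j} ∈ F.verts) :
    ∃ x ∈ refSpan I ((roots (I.erase i ∪ {i, j}) F.verts).image fun X => X.erase j),
      comp I {i, j} i x (genOmega i j) = Finsupp.single F 1 := by
  have hij : i ≠ j := fun e => hj (e ▸ hi)
  have hd := disjoint_erase_pair (I := I) (i := i) hj
  obtain ⟨w, hw⟩ := genOmega_eq_smul hij
  induction hn : F.verts.card using Nat.strong_induction_on generalizing F with
  | h n ih =>
  by_cases h1 : F.verts.card = 1
  · have hF : F.verts = {{i, j}} := by
      obtain ⟨a, ha⟩ := Finset.card_eq_one.1 h1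
      rw [ha] at hv ⊢
      rw [Finset.mem_singleton.1 hv]
    obtain ⟨u, hu⟩ := comp_one_single hd hi ⟨{{i, j}}, isForest_pair hij⟩
    -- The factors `w` and `u` cancel the signs by which `genOmega i j` and the composite with
    -- `oneForest I` differ from the basis vectors.
    refine ⟨(w * u) • oneForest I, units_smul_mem _ _ (oneForest_mem_refSpan ⟨i, hi⟩ ?_), ?_⟩
    · intro k hk
      have hkj : k ≠ j := fun e => hj (e ▸ hk)
      obtain ⟨X, hX, hkX⟩ := exists_root_mem (I := I.erase i ∪ {i, j}) (W := F.verts) (i := k) (by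
        by_cases hki : k = i <;> simp [hki, hk])
      exact ⟨X.erase j, Finset.mem_image_of_mem _ hX, Finset.mem_erase.2 ⟨hkj, hkX⟩⟩
    · rw [hw, map_units_smul, map_units_smul, LinearMap.smul_apply, hu, smul_smul, smul_smul]
      have : w * (w * u) * u = 1 := by
        rw [← mul_assoc w, Int.units_mul_self, one_mul, Int.units_mul_self]
      rw [this, one_smul]
      congr 1
      exact Forest.ext hF.symm
  · obtain ⟨v, hvF, hvr, hvne⟩ := exists_top_ne F.isForest hv h1
    obtain ⟨X, Y, hXY, hc, hvXY, hdXY⟩ := F.isForest.exists_children hvF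
    obtain ⟨u, hu⟩ := exists_isTopDecomp F hvF hvr hXY hc hvXY
    set F' : Forest (I.erase i ∪ {i, j}) := ⟨F.verts.erase v, F.isForest.erase hvF hvr⟩ with hF'
    have hv' : {i, j} ∈ F'.verts := Finset.mem_erase.2 ⟨hvne.symm, hv⟩
    obtain ⟨x, hx, hxF⟩ := ih F'.verts.card (by rw [← hn, hu.card_eq]; omega) F' hv' rfl
    set R := (roots (I.erase i ∪ {i, j}) F'.verts).image fun X => X.erase j with hRdef
    have hsub : ∀ {Z}, Z ∈ roots (I.erase i ∪ {i, j}) F'.verts →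
        substSet {i, j} i (Z.erase j) = Z := fun hZ => substSet_erase_root hj F'.isForest hv' hZ
    have hR : ∀ B ∈ R, ∀ C ∈ R, B ≠ C → Disjoint B C := by
      intro B hB C hC hBC
      obtain ⟨B', hB', rfl⟩ := Finset.mem_image.1 hB
      obtain ⟨C', hC', rfl⟩ := Finset.mem_image.1 hC
      exact (F'.isForest.roots_disjoint hB' hC' fun e => hBC (by rw [e])).mono
        (Finset.erase_subset _ _) (Finset.erase_subset _ _)
    have hRI : ∀ B ∈ R, B ⊆ I := by
      intro B hB k hk
      obtain ⟨B', hB', rfl⟩ := Finset.mem_image.1 hB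
      rw [Finset.mem_erase] at hk
      have := F'.isForest.root_subset hB' hk.2
      simp only [Finset.mem_union, Finset.mem_erase, Finset.mem_insert, Finset.mem_singleton] at this
      rcases this with h2 | rfl | h2
      · exact h2.2
      · exact hi
      · exact absurd h2 hk.1
    have hne : X.erase j ≠ Y.erase j := fun e => hXY (by
      rw [← hsub hu.left_mem, ← hsub hu.right_mem, e])
    have hXR : X.erase j ∈ R := Finset.mem_image_of_mem (fun X => X.erase j) hu.left_mem
    have hYR : Y.erase j ∈ R := Finset.mem_image_of_mem (fun X => X.erase j) hu.right_mem
    have hmem : joinOp (X.erase j) (Y.erase j) x ∈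
        refSpan I ((roots (I.erase i ∪ {i, j}) F.verts).image fun X => X.erase j) := by
      refine joinOp_mem ?_ (hR _ hXR _ hYR hne) ⟨(X ∪ Y).erase j,
        Finset.mem_image_of_mem (fun X => X.erase j) hu.mem_roots,
        (Finset.erase_union_distrib X Y j).ge⟩ hx
      intro B hB
      obtain ⟨B', hB', rfl⟩ := Finset.mem_image.1 hB
      obtain ⟨Z, hZ, hBZ⟩ := exists_root_ge (W := F.verts)
        (((mem_nodes_erase F.isForest hvF hvr).1 (mem_roots.1 hB').1).1)
      exact ⟨Z.erase j, Finset.mem_image_of_mem (fun X => X.erase j) hZ,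
        Finset.erase_subset_erase _ hBZ⟩
    refine ⟨u • joinOp (X.erase j) (Y.erase j) x, units_smul_mem _ _ hmem, ?_⟩
    · have e1 : comp I {i, j} i (joinOp (X.erase j) (Y.erase j) x) (genOmega i j) =
          joinOp X Y (comp I {i, j} i x (genOmega i j)) := by
        have := comp_joinOp_of_mem_refSpan hd hi ⟨{{i, j}}, isForest_pair hij⟩ hR hRI hx hXR hYR hne
        rw [hsub hu.left_mem, hsub hu.right_mem] at this
        rw [hw, map_units_smul, map_units_smul, map_units_smul, this]
      rw [map_units_smul, LinearMap.smul_apply, e1, hxF, hu.single_eq]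

/-- A vertex with the fewest leaves has no inner vertex below it, so both of its children are
leaves. -/
lemma exists_cherry {K : Finset α} (F : Forest K) (hF : F.verts.Nonempty) :
    ∃ i j, i ∈ K ∧ j ∈ K ∧ i ≠ j ∧ {i, j} ∈ F.verts := by
  obtain ⟨v, hv, hmin⟩ := F.verts.exists_min_image Finset.card hF
  obtain ⟨X, Y, hXY, hc, hvXY, -⟩ := F.isForest.exists_children hv
  have key : ∀ {Z}, Z ∈ children K F.verts v → ∃ i ∈ K, Z = {i} := by
    intro Z hZ
    rw [mem_children] at hZ
    rcases mem_nodes.1 hZ.1 with h | h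
    · exact absurd (Finset.card_lt_card hZ.2.1) (not_lt.2 (hmin Z h))
    · exact h
  obtain ⟨i, hi, rfl⟩ := key (Z := X) (by simp [hc])
  obtain ⟨j, hj, rfl⟩ := key (Z := Y) (by simp [hc])
  refine ⟨i, j, hi, hj, fun e => hXY (by rw [e]), ?_⟩
  rw [hvXY] at hv
  exact hv

lemma erase_erase_union_pair {K : Finset α} {i j : α} (hi : i ∈ K) (hj : j ∈ K) :
    K = (K.erase j).erase i ∪ {i, j} := by
  ext k
  by_cases hki : k = i
  · simp [hki, hi]
  · by_cases hkj : k = j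
    · simp [hkj, hj]
    · simp [hki, hkj]

namespace IsBessCoproduct

variable {Δ Δ' : ∀ I : Finset α, Bess I →ₗ[ℚ] Bess I ⊗[ℚ] Bess I} (h : IsBessCoproduct Δ)
  (h' : IsBessCoproduct Δ')
include h h'

/-- `oneForest K` is the composite of `oneForest (K.erase j)` with `E_{i,j}` at `i`, and for one
leaf it is the unit. So its image is determined by smaller leaf sets and the generators. -/
lemma apply_oneForest {K : Finset α} (hK : K.Nonempty) (ih : ∀ I, I.card < K.card → Δ I = Δ' I) :
    Δ K (oneForest K) = Δ' K (oneForest K) := by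
  by_cases h1 : K.card = 1
  · obtain ⟨i, rfl⟩ := Finset.card_eq_one.1 h1
    rw [← unit_eq, h.map_unit, h'.map_unit]
  · obtain ⟨i, hi, j, hj, hij⟩ := Finset.one_lt_card.1
      (show 1 < K.card by have := hK.card_pos; omega)
    have hlt : (K.erase j).card < K.card := Finset.card_erase_lt_of_mem hj
    have hiI : i ∈ K.erase j := Finset.mem_erase.2 ⟨hij, hi⟩
    have hjI : j ∉ K.erase j := by simp
    have e := erase_erase_union_pair hi hj
    have e2 := ih _ hlt
    -- The space `Bess K` depends on the set `K`. After this generalization `K` can be replaced by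
    -- `L.erase i ∪ {i, j}`, the leaf set of a composite.
    generalize K.erase j = L at *
    subst e
    have hd := disjoint_erase_pair (i := i) hjI
    rw [← comp_one_one hd hiI ⟨i, by simp⟩, ← genE_eq hij, h.map_comp _ _ _ hiI hd,
      h'.map_comp _ _ _ hiI hd, e2, h.map_genE i j hij, h'.map_genE i j hij]

/-- A morphism of operads is determined by its values on the generators. -/
lemma unique : Δ = Δ' := by
  funext K
  induction hn : K.card using Nat.strong_induction_on generalizing K with
  | h n ih =>
  have ih' : ∀ I : Finset α, I.card < K.card → Δ I = Δ' I := fun I hI => ih _ (hn ▸ hI) I rfl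
  refine bess_hom_ext fun F => ?_
  rcases F.verts.eq_empty_or_nonempty with h0 | hne
  · obtain ⟨W, hW⟩ := F
    obtain rfl : W = ∅ := h0
    obtain ⟨u, hu⟩ := exists_single_empty_eq hW
    rw [hu, map_units_smul, map_units_smul, h.apply_oneForest h' hW.nonempty ih']
  · obtain ⟨i, j, hi, hj, hij, hv⟩ := exists_cherry F hne
    have hlt : (K.erase j).card < K.card := Finset.card_erase_lt_of_mem hj
    have hiI : i ∈ K.erase j := Finset.mem_erase.2 ⟨hij, hi⟩
    have hjI : j ∉ K.erase j := by simp
    have e := erase_erase_union_pair hi hj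
    have e2 := ih' _ hlt
    clear hn ih ih' hlt hi hj
    generalize K.erase j = L at *
    subst e
    have hd := disjoint_erase_pair (i := i) hjI
    obtain ⟨x, -, hx⟩ := exists_comp_genOmega hiI hjI F hv
    rw [← hx, h.map_comp _ _ _ hiI hd, h'.map_comp _ _ _ hiI hd, e2, h.map_genOmega i j hij,
      h'.map_genOmega i j hij]

end IsBessCoproduct

end Uniqueness

/-! ### Signs of inner orientations -/

section PairWords

variable {S T : Type*} [DecidableEq S] [DecidableEq T]

omit [DecidableEq S] in
-- Blocks of even length commute with everything, so the order in which pairs of half-edges are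
-- listed is irrelevant.
lemma orSign_flatMap_pair {g g' : List S} (h : g.Perm g') (L : S → List T)
    (heven : ∀ x ∈ g, Even (L x).length) (hnd : (g.flatMap L).Nodup) :
    orSign (g.flatMap L) (g'.flatMap L) = 1 := by
  induction h with
  | nil => rfl
  | cons x h ih =>
    rw [List.flatMap_cons, List.flatMap_cons, orSign_append_left]
    rw [List.flatMap_cons, List.nodup_append] at hnd
    exact ih (fun y hy => heven y (by simp [hy])) hnd.2.1
  | swap x y l =>
    simp only [List.flatMap_cons, ← List.append_assoc] at hnd ⊢
    rw [orSign_append_comm hnd]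
    exact Even.neg_one_pow ((heven y (by simp)).mul_right _)
  | trans h₁ h₂ ih₁ ih₂ =>
    have hnd₂ := (h₁.flatMap_right L).nodup_iff.1 hnd
    rw [← orSign_trans (h₁.flatMap_right L) (h₂.flatMap_right L)
      ((h₂.flatMap_right L).nodup_iff.1 hnd₂), ih₁ heven hnd,
      ih₂ (fun x hx => heven x (h₁.mem_iff.2 hx)) hnd₂, one_mul]

omit [DecidableEq S] in
-- For each `i`, in the target word both `f i` and `g i` stand behind the reversed `f`-letters of
-- the later elements, so their shifts cancel. This accounts for the reversed leaf word in
-- `oneForest`.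
lemma orSign_pairs_reverse (f g : S → T) (l : List S) (hnd : (l.map f ++ l.map g).Nodup) :
    orSign (l.flatMap fun i => [f i, g i]) (l.reverse.map f ++ l.map g) = 1 := by
  induction l with
  | nil => rfl
  | cons i l ih =>
    have hnd' : (l.map f ++ l.map g).Nodup := by
      refine hnd.sublist ?_
      simp
    have hf : f i ∉ l.reverse.map f := by
      simp only [List.map_cons, List.cons_append, List.nodup_cons] at hnd
      intro h
      exact hnd.1 (List.mem_append_left _ (by simpa using h))
    have hg : g i ∉ l.reverse.map f := by
      rw [List.map_cons, List.map_cons, List.perm_middle.nodup_iff, List.nodup_cons] at hnd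
      intro h
      exact hnd.1 (List.mem_append_left _ (by simp at h ⊢; tauto))
    rw [List.flatMap_cons, List.cons_append, List.cons_append, List.nil_append, orSign_cons,
      orSign_cons, List.reverse_cons, List.map_append, List.append_assoc,
      List.idxOf_append_of_notMem hf, List.erase_append_right _ hf]
    simp only [List.map_cons, List.map_nil, List.cons_append, List.nil_append, List.idxOf_cons_self,
      List.erase_cons_head, add_zero]
    rw [List.idxOf_append_of_notMem hg, List.erase_append_right _ hg]
    simp only [List.idxOf_cons_self, List.erase_cons_head, add_zero]
    rw [ih hnd', mul_one, Int.units_mul_self]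

lemma orSign_cons_erase {a : S} {l : List S} (ha : a ∈ l) (hl : l.Nodup) :
    orSign l (a :: l.erase a) = (-1) ^ l.idxOf a := by
  have hp := List.perm_cons_erase ha
  rw [orSign_erase hp (hp.nodup_iff.1 hl) (List.mem_cons_self (a := a))]
  simp

/-- The half-edge `p` of an outer word becomes inner: it is dropped if the opposite half-edge `m`
was next to it in the inner word (`b = false`), and is moved next to `m` otherwise. -/
lemma orSign_exchange {p m : T} (b : Bool) {x y₁ y₂ : List T}
    (hperm : (x ++ if b then [] else [m, p]).Perm (y₁ ++ p :: y₂)) (hnd : (y₁ ++ p :: y₂).Nodup)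
    (hm : b → m ∉ y₁ ++ p :: y₂) :
    (m :: x).Perm (y₁ ++ y₂ ++ if b then [p, m] else []) ∧
    (y₁ ++ y₂ ++ if b then [p, m] else []).Nodup ∧
    orSign (m :: x) (y₁ ++ y₂ ++ if b then [p, m] else []) =
      -(-1) ^ y₁.length * orSign (x ++ if b then [] else [m, p]) (y₁ ++ p :: y₂) := by
  have hp1 : (p :: (y₁ ++ y₂)).Nodup := List.perm_middle.nodup_iff.1 hnd
  have hpy : p ∉ y₁ := fun h => (List.nodup_cons.1 hp1).1 (by simp [h])
  cases b with
  | true =>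
    simp only [if_true, List.append_nil, forall_const] at *
    have q1 : (y₁ ++ p :: y₂).Perm (y₁ ++ y₂ ++ [p]) := by
      refine List.perm_middle.trans ?_
      exact (List.perm_append_comm (l₁ := [p]))
    have q2 : (m :: x).Perm (m :: (y₁ ++ p :: y₂)) := hperm.cons m
    have q3 : (m :: (y₁ ++ p :: y₂)).Perm (y₁ ++ y₂ ++ [p] ++ [m]) :=
      (q1.cons m).trans (List.perm_append_comm (l₁ := [m]))
    have hnd' : (y₁ ++ y₂ ++ [p] ++ [m]).Nodup :=
      q3.nodup_iff.1 (List.nodup_cons.2 ⟨hm, hnd⟩)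
    have e : y₁ ++ y₂ ++ [p, m] = y₁ ++ y₂ ++ [p] ++ [m] := by simp
    rw [e]
    refine ⟨q2.trans q3, hnd', ?_⟩
    have hmq : m ∉ y₁ ++ y₂ ++ [p] := fun h => hm (q1.mem_iff.2 h)
    have q4 : (m :: (y₁ ++ y₂ ++ [p])).Perm (y₁ ++ y₂ ++ [p] ++ [m]) :=
      List.perm_append_comm (l₁ := [m])
    have s1 : orSign (m :: (y₁ ++ y₂ ++ [p])) (y₁ ++ y₂ ++ [p] ++ [m]) =
        (-1) ^ (y₁ ++ y₂ ++ [p]).length := by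
      have := orSign_cons_middle hmq []
      simpa using this
    have s2 : orSign (m :: (y₁ ++ p :: y₂)) (m :: (y₁ ++ y₂ ++ [p])) = (-1) ^ y₂.length := by
      rw [orSign_cons_cons, List.append_assoc, orSign_append_left]
      have : (p :: y₂).Nodup := (List.nodup_append.1 hnd).2.1
      have := orSign_cons_middle (List.nodup_cons.1 this).1 []
      simpa using this
    rw [← orSign_trans q2 q3 hnd', ← orSign_trans (q1.cons m) q4 hnd', s1, s2, orSign_cons_cons, mul_comm]
    congr 1
    rw [← pow_add, ← mul_neg_one ((-1 : ℤˣ) ^ y₁.length), ← pow_succ]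
    apply units_neg_one_pow_eq
    simp only [List.length_append, List.length_singleton]
    omega
  | false =>
    simp only [Bool.false_eq_true, if_false, List.append_nil, false_implies] at *
    have q1 : (x ++ [m, p]).Perm (p :: m :: x) := by
      refine List.perm_append_comm.trans ?_
      exact List.Perm.swap _ _ _
    have q2 : (p :: m :: x).Perm (p :: (y₁ ++ y₂)) :=
      q1.symm.trans (hperm.trans List.perm_middle)
    refine ⟨q2.cons_inv, (List.nodup_cons.1 hp1).2, ?_⟩
    have hnd1 : (p :: m :: x).Nodup := q2.nodup_iff.2 hp1
    have hnd2 : (m :: p :: x).Nodup := (List.Perm.swap _ _ _).nodup_iff.1 hnd1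
    have hmp : m ≠ p := by
      intro h
      subst h
      simp at hnd1
    have s1 : orSign (x ++ [m, p]) (m :: p :: x) = 1 := by
      have := orSign_append_comm (l := x) (m := [m, p]) (n := [])
        (by simpa using (q1.trans (List.Perm.swap _ _ _)).nodup_iff.2 hnd2)
      simpa using this
    rw [← orSign_trans (q1.trans (List.Perm.swap _ _ _))
      ((List.Perm.swap _ _ _).trans (q1.symm.trans hperm)) hnd, s1, one_mul,
      ← orSign_trans (List.Perm.swap _ _ _) (q1.symm.trans hperm) hnd, orSign_swap hmp,
      orSign_cons p, List.idxOf_append_of_notMem hpy, List.erase_append_right _ hpy]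
    simp only [List.idxOf_cons_self, List.erase_cons_head, add_zero]
    rw [neg_one_mul, neg_mul_neg, ← mul_assoc, Int.units_mul_self, one_mul]

end PairWords

/-! ### Inner orientations and the operators that join two trees -/

section InnerOrientations

variable {α : Type*} [DecidableEq α] {I : Finset α}

/-- Comparison of symbols of global orientations by their decidable equality. -/
instance (priority := 2000) instBEqOptionFinset : BEq (Option (Finset α)) := instBEqOfDecidableEq

namespace InnerData

/-- The local orientation at an inner vertex, and the auxiliary element itself. -/
def block (o : InnerData α) (g : Option (Finset α)) : List (Option (HalfEdge α)) :=
  match g with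
  | none => [none]
  | some v => (o.loc v).map some

/-- Removal of the vertex `X ∪ Y`, whose children are `X` and `Y`, from an inner orientation. -/
def removeJoin (o : InnerData α) (X Y : Finset α) : InnerData α where
  sign := o.sign * ((-1) ^ o.glob.idxOf (some (X ∪ Y)) *
    orSign (o.loc (X ∪ Y)) [(X ∪ Y, true), (X, false), (Y, false)])
  glob := o.glob.erase (some (X ∪ Y))
  loc := o.loc

end InnerData

/-- The two halves of an edge, the upper half first. -/
def upPair (A : Finset α) : List (Option (HalfEdge α)) := [some (A, true), some (A, false)]

/-- The two halves of an edge, the lower half first. -/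
def downPair (A : Finset α) : List (Option (HalfEdge α)) := [some (A, false), some (A, true)]

omit [DecidableEq α] in
lemma even_upPair (A : Finset α) : Even (upPair A).length := even_two

omit [DecidableEq α] in
lemma even_downPair (A : Finset α) : Even (downPair A).length := even_two

lemma outerWord_eq (F : Forest I) (a : List α) (ρ : List (Finset α)) :
    outerWord F a ρ = none :: (a.map (fun i => some ({i}, false)) ++
      ρ.map (fun A => some (A, true)) ++
      (F.verts \ roots I F.verts).toList.flatMap upPair) := rfl

lemma innerWord_eq (F : Forest I) (o : InnerData α) :
    innerWord F o = o.glob.flatMap o.block ++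
      (roots I F.verts \ F.verts).toList.flatMap downPair := rfl

/-- The half-edge words of an inner orientation and of outer orientations are reorderings of each
other, without repetitions. -/
def WordsMatch (F : Forest I) (o : InnerData α) (a : List α) (ρ : List (Finset α)) : Prop :=
  (innerWord F o).Perm (outerWord F a ρ) ∧ (outerWord F a ρ).Nodup

namespace InnerData.IsOrientationOf

variable {F F' : Forest I} {o : InnerData α} {X Y : Finset α} {u : ℤˣ}

lemma loc_perm (ho : o.IsOrientationOf F) (h : IsTopDecomp F F' X Y u) :
    (o.loc (X ∪ Y)).Perm [(X ∪ Y, true), (X, false), (Y, false)] := by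
  have hv := h.mem_verts
  rw [List.perm_ext_iff_of_nodup (ho.loc_nodup _ hv) (by simp [h.ne])]
  intro p
  rw [ho.mem_loc _ hv, h.children_eq]
  simp

lemma removeJoin (ho : o.IsOrientationOf F) (h : IsTopDecomp F F' X Y u) :
    (o.removeJoin X Y).IsOrientationOf F' where
  glob_nodup := ho.glob_nodup.erase _
  mem_glob g := by
    rw [InnerData.removeJoin, ho.glob_nodup.mem_erase_iff, ho.mem_glob, h.verts_eq]
    have := h.notMem
    cases g with
    | none => simp
    | some v =>
      simp only [ne_eq, Option.some.injEq, reduceCtorEq, Finset.mem_insert, false_or]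
      constructor
      · rintro ⟨h1, w, rfl | h2, rfl⟩
        · exact absurd rfl h1
        · exact ⟨_, h2, rfl⟩
      · rintro ⟨w, h2, rfl⟩
        exact ⟨fun e => this (e ▸ h2), _, Or.inr h2, rfl⟩
  loc_nodup v hv := ho.loc_nodup v (by rw [h.verts_eq]; exact Finset.mem_insert_of_mem hv)
  mem_loc v hv p := by
    have hc := children_insert_of_mem F'.isForest h.left_mem h.right_mem h.ne (mem_nodes_of_mem hv)
    have := ho.mem_loc v (by rw [h.verts_eq]; exact Finset.mem_insert_of_mem hv) p
    rw [h.verts_eq, hc] at this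
    exact this

lemma some_mem_glob (ho : o.IsOrientationOf F) {v : Finset α} (hv : v ∈ F.verts) :
    some v ∈ o.glob := (ho.mem_glob _).2 (Or.inr ⟨v, hv, rfl⟩)

lemma length_glob (ho : o.IsOrientationOf F) : o.glob.length = F.verts.card + 1 := by
  have : o.glob.Perm (none :: F.verts.toList.map some) := by
    rw [List.perm_ext_iff_of_nodup ho.glob_nodup]
    · intro g
      rw [ho.mem_glob]
      simp [eq_comm]
    · simp [(Finset.nodup_toList _).map (Option.some_injective _)]
  rw [this.length_eq]
  simp

/-- A block is either `R` alone or the three half-edges at a binary vertex. Its odd length is the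
hypothesis of `orSign_flatMap`. -/
lemma block_length (ho : o.IsOrientationOf F) {g : Option (Finset α)} (hg : g ∈ o.glob) :
    (o.block g).length % 2 = 1 := by
  rw [ho.mem_glob] at hg
  rcases hg with rfl | ⟨v, hv, rfl⟩
  · rfl
  · obtain ⟨X, Y, hXY, hc, -, -⟩ := F.isForest.exists_children hv
    have : (o.loc v).Perm [(v, true), (X, false), (Y, false)] := by
      rw [List.perm_ext_iff_of_nodup (ho.loc_nodup _ hv) (by simp [hXY])]
      intro p
      rw [ho.mem_loc _ hv, hc]
      simp
    simp [InnerData.block, this.length_eq]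

end InnerData.IsOrientationOf

/-- The edge below a root vertex ends in a root, so it contributes its root to the outer word but no
pair of half-edges. The lower half appears only after a join makes the edge an inner one. -/
lemma mem_outerWord_false {F : Forest I} {a : List α} {ρ : List (Finset α)} {X : Finset α}
    (hX : X ∈ roots I F.verts) (hXF : X ∈ F.verts) :
    some (X, false) ∉ outerWord F a ρ := by
  rw [outerWord_eq]
  simp only [List.mem_cons, reduceCtorEq, List.mem_append, List.mem_map, Option.some.injEq,
    Prod.mk.injEq, and_true, Bool.true_eq_false, and_false, exists_false, or_false,
    List.mem_flatMap, Finset.mem_toList, Finset.mem_sdiff, false_or, not_or, not_exists, not_and,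
    upPair, List.not_mem_nil, Bool.false_eq_true]
  refine ⟨fun i _ e => F.isForest.singleton_notMem i (e ▸ hXF), fun A hA e => hA.2 (e ▸ hX)⟩

section Join

variable {F F' : Forest I} {X Y : Finset α} {u : ℤˣ}

/-- Joining creates an inner edge out of `X` precisely when `X` is an inner vertex and not a leaf,
and likewise for `Y`. -/
lemma IsTopDecomp.inner_perm (h : IsTopDecomp F F' X Y u) :
    (F.verts \ roots I F.verts).toList.Perm ((F'.verts \ roots I F'.verts).toList ++
      (if X ∈ F'.verts then [X] else []) ++ if Y ∈ F'.verts then [Y] else []) := by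
  have hXn : X ∉ F'.verts \ roots I F'.verts := fun hx => (Finset.mem_sdiff.1 hx).2 h.left_mem
  have hYn : Y ∉ F'.verts \ roots I F'.verts := fun hx => (Finset.mem_sdiff.1 hx).2 h.right_mem
  have hne := h.ne
  rw [List.perm_ext_iff_of_nodup (Finset.nodup_toList _)]
  · intro A
    have hr := mem_roots_insert F'.isForest h.left_mem h.right_mem h.ne (A := A)
    have hv := h.notMem
    rw [Finset.mem_toList, h.verts_eq, Finset.mem_sdiff, hr, Finset.mem_insert]
    simp only [List.mem_append, Finset.mem_toList, Finset.mem_sdiff]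
    by_cases hA : A = X
    · subst hA
      have := h.left_mem
      have h2 : A ∈ F'.verts → A ≠ A ∪ Y := fun hA e => hv (e ▸ hA)
      split_ifs <;> simp_all
    · by_cases hA' : A = Y
      · subst hA'
        have := h.right_mem
        have h2 : A ∈ F'.verts → A ≠ X ∪ A := fun hA e => hv (e ▸ hA)
        split_ifs <;> simp_all
      · have h2 : A ∈ F'.verts → A ≠ X ∪ Y := fun hA e => hv (e ▸ hA)
        split_ifs <;> simp_all <;> tauto
  · refine List.nodup_append.2 ⟨List.nodup_append.2 ⟨Finset.nodup_toList _, ?_, ?_⟩, ?_, ?_⟩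
    · split_ifs <;> simp
    · intro A hA B hB e
      subst e
      rw [Finset.mem_toList] at hA
      split_ifs at hB <;> simp_all
    · split_ifs <;> simp
    · intro A hA B hB e
      subst e
      rw [List.mem_append, Finset.mem_toList] at hA
      split_ifs at hA hB <;> simp_all

/-- A leaf that was a tree by itself ceases to be one when it is joined, so its pair leaf-root
disappears from the inner word. -/
lemma IsTopDecomp.leaf_perm (h : IsTopDecomp F F' X Y u) :
    (roots I F'.verts \ F'.verts).toList.Perm ((roots I F.verts \ F.verts).toList ++
      (if X ∈ F'.verts then [] else [X]) ++ if Y ∈ F'.verts then [] else [Y]) := by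
  have hXn : X ∉ roots I F.verts := by
    rw [h.verts_eq, mem_roots_insert F'.isForest h.left_mem h.right_mem h.ne]
    simp only [ne_eq, not_true_eq_false, false_and, and_false, or_false]
    exact fun e => absurd (left_ssubset_union F'.isForest h.left_mem h.right_mem h.ne)
      (by rw [← e]; exact irrefl _)
  have hYn : Y ∉ roots I F.verts := by
    rw [h.verts_eq, mem_roots_insert F'.isForest h.left_mem h.right_mem h.ne]
    simp only [ne_eq, not_true_eq_false, and_false, or_false]
    exact fun e => absurd (right_ssubset_union F'.isForest h.left_mem h.right_mem h.ne)
      (by rw [← e]; exact irrefl _)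
  have hne := h.ne
  have hX := h.left_mem
  have hY := h.right_mem
  rw [List.perm_ext_iff_of_nodup (Finset.nodup_toList _)]
  · intro A
    have hr := mem_roots_insert F'.isForest h.left_mem h.right_mem h.ne (A := A)
    simp only [List.mem_append, Finset.mem_toList, Finset.mem_sdiff]
    by_cases hA : A = X
    · subst hA
      split_ifs <;> simp_all
    · by_cases hA' : A = Y
      · subst hA'
        split_ifs <;> simp_all
      · have h1 : A ∉ (if X ∈ F'.verts then [] else [X]) := by split_ifs <;> simp [hA]
        have h2 : A ∉ (if Y ∈ F'.verts then [] else [Y]) := by split_ifs <;> simp [hA']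
        have h3 : A ∈ roots I F'.verts → A ≠ X ∪ Y := fun hA e =>
          union_notMem_nodes F'.isForest h.left_mem h.right_mem h.ne (e ▸ (BesselForests.mem_roots.1 hA).1)
        have e1 : A ∈ roots I F.verts ↔ A = X ∪ Y ∨ A ∈ roots I F'.verts := by
          rw [h.verts_eq, hr]
          simp [hA, hA']
        have e2 : A ∈ F.verts ↔ A = X ∪ Y ∨ A ∈ F'.verts := by
          rw [h.verts_eq, Finset.mem_insert]
        rw [e1, e2]
        clear e1 e2 hr
        tauto
  · refine List.nodup_append.2 ⟨List.nodup_append.2 ⟨Finset.nodup_toList _, ?_, ?_⟩, ?_, ?_⟩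
    · split_ifs <;> simp
    · intro A hA B hB e
      subst e
      rw [Finset.mem_toList] at hA
      split_ifs at hB <;> simp_all
    · split_ifs <;> simp
    · intro A hA B hB e
      subst e
      rw [List.mem_append, Finset.mem_toList] at hA
      split_ifs at hA hB <;> simp_all

end Join

end InnerOrientations

/-! ### Removal of a root vertex: comparison of half-edge words. -/

section InnerSigns

variable {α : Type*} [DecidableEq α] {I : Finset α}

/-- The vertex to be removed is brought to the front of the global orientation, and its local
orientation is put in standard order. The resulting factor is the one recorded in the sign of
`removeJoin`; the tail `z` and the target `t` are arbitrary. -/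
lemma InnerData.IsOrientationOf.glob_word {F F' : Forest I} {o : InnerData α} {X Y : Finset α}
    {u : ℤˣ} (ho : o.IsOrientationOf F) (h : IsTopDecomp F F' X Y u)
    {z : List (Option (HalfEdge α))} {t : List (Option (HalfEdge α))}
    (ht : (some (X ∪ Y, true) :: some (X, false) :: some (Y, false) ::
      ((o.glob.erase (some (X ∪ Y))).flatMap o.block ++ z)).Perm t) (hnd : t.Nodup) :
    (o.glob.flatMap o.block ++ z).Perm t ∧ orSign (o.glob.flatMap o.block ++ z) t =
      ((-1) ^ o.glob.idxOf (some (X ∪ Y)) *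
        orSign (o.loc (X ∪ Y)) [(X ∪ Y, true), (X, false), (Y, false)]) *
      orSign (some (X ∪ Y, true) :: some (X, false) :: some (Y, false) ::
        ((o.glob.erase (some (X ∪ Y))).flatMap o.block ++ z)) t := by
  have hv := ho.some_mem_glob h.mem_verts
  have hl := ho.loc_perm h
  have p1 : o.glob.Perm (some (X ∪ Y) :: o.glob.erase (some (X ∪ Y))) := List.perm_cons_erase hv
  have p2 := p1.flatMap_right o.block
  have e : (some (X ∪ Y) :: o.glob.erase (some (X ∪ Y))).flatMap o.block =
      (o.loc (X ∪ Y)).map some ++ (o.glob.erase (some (X ∪ Y))).flatMap o.block := rfl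
  have p3 := ((hl.map some).append_right
    ((o.glob.erase (some (X ∪ Y))).flatMap o.block ++ z)).trans ht
  have p4 := p2.append_right z
  have s2 : orSign ((o.loc (X ∪ Y)).map some ++
      ((o.glob.erase (some (X ∪ Y))).flatMap o.block ++ z)) t =
      orSign (o.loc (X ∪ Y)) [(X ∪ Y, true), (X, false), (Y, false)] *
      orSign (some (X ∪ Y, true) :: some (X, false) :: some (Y, false) ::
        ((o.glob.erase (some (X ∪ Y))).flatMap o.block ++ z)) t := by
    have q : ((o.loc (X ∪ Y)).map some ++
        ((o.glob.erase (some (X ∪ Y))).flatMap o.block ++ z)).Perm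
        ([(X ∪ Y, true), (X, false), (Y, false)].map some ++
        ((o.glob.erase (some (X ∪ Y))).flatMap o.block ++ z)) := (hl.map some).append_right _
    rw [← orSign_trans q ht hnd, orSign_append_right (hl.map some),
      orSign_map hl (Option.some_injective _).injOn]
    rfl
  have hnd' := p3.nodup_iff.2 hnd
  rw [e, List.append_assoc] at p4
  have s1 : orSign (o.glob.flatMap o.block ++ z) ((o.loc (X ∪ Y)).map some ++
      ((o.glob.erase (some (X ∪ Y))).flatMap o.block ++ z)) =
      (-1) ^ o.glob.idxOf (some (X ∪ Y)) := by
    rw [← List.append_assoc, ← e, orSign_append_right p2, orSign_flatMap p1,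
      orSign_cons_erase hv ho.glob_nodup]
    · exact fun g hg => ho.block_length (p1.mem_iff.2 hg)
    · rw [e]
      rw [← List.append_assoc] at hnd'
      exact (List.nodup_append.1 hnd').1
  exact ⟨p4.trans p3, by rw [← orSign_trans p4 p3 hnd, s1, s2, mul_assoc]⟩

lemma flatMap_ite {S T : Type*} (p : Prop) [Decidable p] (a : S) (L : S → List T) :
    (if p then [a] else []).flatMap L = if p then L a else [] := by
  split_ifs <;> simp

lemma flatMap_ite' {S T : Type*} (p : Prop) [Decidable p] (a : S) (L : S → List T) :
    (if p then [] else [a]).flatMap L = if p then [] else L a := by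
  split_ifs <;> simp

lemma orSign_insert {T : Type*} [DecidableEq T] {q : T} {x y z : List T}
    (hp : x.Perm (y ++ z)) (hnd : (y ++ z).Nodup) (hq : q ∉ y ++ z) :
    (q :: x).Perm (y ++ q :: z) ∧ (y ++ q :: z).Nodup ∧
      orSign (q :: x) (y ++ q :: z) = (-1) ^ y.length * orSign x (y ++ z) := by
  have p1 : (q :: x).Perm (y ++ q :: z) := (hp.cons q).trans List.perm_middle.symm
  refine ⟨p1, List.perm_middle.nodup_iff.2 (List.nodup_cons.2 ⟨hq, hnd⟩), ?_⟩
  have hy : q ∉ y := fun h => hq (List.mem_append_left _ h)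
  rw [orSign_cons, List.idxOf_append_of_notMem hy, List.erase_append_right _ hy]
  simp

/-- Removal of a root vertex from an inner-oriented forest. -/
lemma wordsMatch_join {F F' : Forest I} {o : InnerData α} {X Y : Finset α} {u : ℤˣ}
    (ho : o.IsOrientationOf F) (h : IsTopDecomp F F' X Y u) {a : List α} {ρ : List (Finset α)}
    (hρ : IsRootList I F'.verts (X :: Y :: ρ))
    (hw : WordsMatch F' (o.removeJoin X Y) a (X :: Y :: ρ)) :
    WordsMatch F o a ((X ∪ Y) :: ρ) ∧ innerSign F o a ((X ∪ Y) :: ρ) =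
      (-1) ^ a.length * innerSign F' (o.removeJoin X Y) a (X :: Y :: ρ) := by
  classical
  obtain ⟨hp, hn⟩ := hw
  set A : List (Option (HalfEdge α)) := none :: a.map (fun i => some ({i}, false)) with hA
  set R : List (Option (HalfEdge α)) := ρ.map (fun A => some (A, true)) with hR
  set E' : List (Option (HalfEdge α)) := (F'.verts \ roots I F'.verts).toList.flatMap upPair
    with hE'
  set G : List (Option (HalfEdge α)) := (o.glob.erase (some (X ∪ Y))).flatMap o.block with hG
  set L : List (Option (HalfEdge α)) := (roots I F.verts \ F.verts).toList.flatMap downPair with hL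
  have eo' : outerWord F' a (X :: Y :: ρ) =
      (A ++ [some (X, true)]) ++ some (Y, true) :: (R ++ E') := by
    rw [outerWord_eq, hA, hR, hE']
    simp
  -- the pairs for leaves that are roots
  have hlp := h.leaf_perm
  have hlpd := hlp.flatMap_right downPair
  have hi' : innerWord F' (o.removeJoin X Y) = G ++
      (roots I F'.verts \ F'.verts).toList.flatMap downPair := rfl
  rw [hi'] at hp
  have hnd0 := hp.nodup_iff.2 hn
  have sL : orSign (G ++ (roots I F'.verts \ F'.verts).toList.flatMap downPair)
      (outerWord F' a (X :: Y :: ρ)) = orSign (G ++ ((roots I F.verts \ F.verts).toList ++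
      (if X ∈ F'.verts then [] else [X]) ++ if Y ∈ F'.verts then [] else [Y]).flatMap downPair)
      (outerWord F' a (X :: Y :: ρ)) := by
    rw [← orSign_trans (hlpd.append_left G) ((hlpd.append_left G).symm.trans hp) hn,
      orSign_append_left, orSign_flatMap_pair hlp _ (fun x _ => even_downPair x)
      (List.nodup_append.1 hnd0).2.1, one_mul]
  have hp1 := (hlpd.append_left G).symm.trans hp
  rw [List.flatMap_append, List.flatMap_append, flatMap_ite', flatMap_ite', ← hL] at hp1 sL
  -- the exchange for `Y`
  have hYm : (decide (Y ∈ F'.verts) : Bool) → some (Y, false) ∉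
      (A ++ [some (X, true)]) ++ some (Y, true) :: (R ++ E') := by
    intro hY
    rw [← eo']
    exact mem_outerWord_false h.right_mem (by simpa using hY)
  have hXm : X ∈ F'.verts → some (X, false) ∉ outerWord F' a (X :: Y :: ρ) :=
    mem_outerWord_false h.left_mem
  rw [eo'] at hp1 sL hn hXm
  have eY := orSign_exchange (p := some (Y, true)) (m := some (Y, false)) (decide (Y ∈ F'.verts))
    (x := G ++ (L ++ if X ∈ F'.verts then [] else downPair X)) (y₁ := A ++ [some (X, true)])
    (y₂ := R ++ E') (by simpa [downPair] using hp1) hn hYm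
  simp only [decide_eq_true_eq] at eY
  obtain ⟨pY, nY, sY⟩ := eY
  -- the exchange for `X`
  set UY : List (Option (HalfEdge α)) := if Y ∈ F'.verts then [some (Y, true), some (Y, false)]
    else [] with hUY
  set UX : List (Option (HalfEdge α)) := if X ∈ F'.verts then [some (X, true), some (X, false)]
    else [] with hUX
  have t1 : A ++ [some (X, true)] ++ (R ++ E') ++ UY = A ++ some (X, true) :: (R ++ E' ++ UY) := by
    simp
  rw [t1] at pY nY sY
  have hXm' : (decide (X ∈ F'.verts) : Bool) → some (X, false) ∉
      A ++ some (X, true) :: (R ++ E' ++ UY) := by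
    intro hX hmem
    have h1 := hXm (by simpa using hX)
    have hne := h.ne
    simp only [List.mem_append, List.mem_cons, not_or] at h1 hmem
    have hU : some (X, false) ∉ UY := by
      rw [hUY]
      split_ifs <;> simp [hne]
    tauto
  have eX := orSign_exchange (p := some (X, true)) (m := some (X, false)) (decide (X ∈ F'.verts))
    (x := some (Y, false) :: (G ++ L)) (y₁ := A)
    (y₂ := R ++ E' ++ UY) (by simpa [downPair] using pY) nY hXm'
  simp only [decide_eq_true_eq] at eX
  obtain ⟨pX, nX, sX⟩ := eX
  -- the new vertex
  have hvn := union_notMem_nodes F'.isForest h.left_mem h.right_mem h.ne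
  have hvX : X ∪ Y ≠ X := fun e => hvn (e.symm ▸ (mem_roots.1 h.left_mem).1)
  have hvY : X ∪ Y ≠ Y := fun e => hvn (e.symm ▸ (mem_roots.1 h.right_mem).1)
  have hq : some (X ∪ Y, true) ∉ A ++ (R ++ E' ++ UY ++ UX) := by
    have h1 : some (X ∪ Y, true) ∉ A := by simp [hA]
    have h2 : some (X ∪ Y, true) ∉ R := by
      simp only [hR, List.mem_map, Option.some.injEq, Prod.mk.injEq, and_true, exists_eq_right]
      exact fun hm => hvn (mem_roots.1 ((hρ.2 _).1 (by simp [hm]))).1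
    have h3 : some (X ∪ Y, true) ∉ E' := by
      simp only [hE', List.mem_flatMap, upPair, Finset.mem_toList, Finset.mem_sdiff, not_exists,
        not_and, List.mem_cons, Option.some.injEq, Prod.mk.injEq, and_true, Bool.true_eq_false,
        and_false, List.not_mem_nil, or_false]
      rintro B ⟨hB, -⟩ rfl
      exact h.notMem hB
    have h4 : some (X ∪ Y, true) ∉ UY := by rw [hUY]; split_ifs <;> simp [hvY]
    have h5 : some (X ∪ Y, true) ∉ UX := by rw [hUX]; split_ifs <;> simp [hvX]
    simp only [List.mem_append, not_or]
    exact ⟨h1, ⟨⟨h2, h3⟩, h4⟩, h5⟩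
  have t2 : A ++ (R ++ E' ++ UY) ++ UX = A ++ (R ++ E' ++ UY ++ UX) := by simp
  rw [t2] at pX nX sX
  obtain ⟨pV, nV, sV⟩ := orSign_insert pX nX hq
  -- the pairs for inner edges
  have hip : ((F'.verts \ roots I F'.verts).toList ++ (if Y ∈ F'.verts then [Y] else []) ++
      if X ∈ F'.verts then [X] else []).Perm (F.verts \ roots I F.verts).toList := by
    refine List.Perm.trans ?_ h.inner_perm.symm
    rw [List.append_assoc, List.append_assoc]
    exact List.perm_append_comm.append_left _
  have eE : E' ++ UY ++ UX = ((F'.verts \ roots I F'.verts).toList ++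
      (if Y ∈ F'.verts then [Y] else []) ++ if X ∈ F'.verts then [X] else []).flatMap upPair := by
    rw [List.flatMap_append, List.flatMap_append, flatMap_ite, flatMap_ite]
    rfl
  have t3 : A ++ some (X ∪ Y, true) :: (R ++ E' ++ UY ++ UX) =
      (A ++ some (X ∪ Y, true) :: R) ++ (E' ++ UY ++ UX) := by simp
  have eo : outerWord F a ((X ∪ Y) :: ρ) = (A ++ some (X ∪ Y, true) :: R) ++
      (F.verts \ roots I F.verts).toList.flatMap upPair := by
    rw [outerWord_eq, hA, hR]
    simp
  rw [t3, eE] at pV nV sV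
  have pE := (hip.flatMap_right upPair).append_left (A ++ some (X ∪ Y, true) :: R)
  rw [← eo] at pE
  have nO := pE.nodup_iff.1 nV
  have sE := orSign_trans pV pE nO
  rw [sV, sX] at sE
  have sE' : orSign ((A ++ some (X ∪ Y, true) :: R) ++ ((F'.verts \ roots I F'.verts).toList ++
      (if Y ∈ F'.verts then [Y] else []) ++ if X ∈ F'.verts then [X] else []).flatMap upPair)
      (outerWord F a ((X ∪ Y) :: ρ)) = 1 := by
    rw [eo, orSign_append_left]
    exact orSign_flatMap_pair hip _ (fun x _ => even_upPair x) (List.nodup_append.1 nV).2.1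
  obtain ⟨pG, sG⟩ := ho.glob_word h (pV.trans pE) nO
  refine ⟨⟨pG, nO⟩, ?_⟩
  have eYX : (some (Y, false) :: (G ++ L) ++ if X ∈ F'.verts then []
      else [some (X, false), some (X, true)]) = some (Y, false) :: (G ++ (L ++
        if X ∈ F'.verts then [] else downPair X)) := by
    simp [downPair]
  have sL' : orSign (G ++ (L ++ if X ∈ F'.verts then [] else downPair X) ++ if Y ∈ F'.verts then []
      else [some (Y, false), some (Y, true)]) (A ++ [some (X, true)] ++ some (Y, true) :: (R ++ E')) =
      orSign (G ++ (roots I F'.verts \ F'.verts).toList.flatMap downPair)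
        (A ++ [some (X, true)] ++ some (Y, true) :: (R ++ E')) := by
    rw [sL]
    congr 1
    simp [downPair]
  have hlen : A.length = a.length + 1 := by simp [hA]
  rw [sE', mul_one, eYX, sY, sL'] at sE
  rw [innerSign, innerSign, hi', eo', innerWord_eq, sG, ← sE, InnerData.removeJoin,
    List.length_append, List.length_singleton, hlen]
  generalize orSign (o.loc (X ∪ Y)) [(X ∪ Y, true), (X, false), (Y, false)] = s₁
  generalize orSign (G ++ (roots I F'.verts \ F'.verts).toList.flatMap downPair)
        (A ++ [some (X, true)] ++ some (Y, true) :: (R ++ E')) = s₂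
  generalize List.idxOf (some (X ∪ Y)) o.glob = k
  -- The letter of the new root passes `R` and the leaf labels, `a.length + 1` letters in all. The
  -- exchanges at `X` and at `Y` occur behind `a.length + 1` and `a.length + 2` letters, and their
  -- minus signs cancel.
  have : (-1 : ℤˣ) ^ (a.length + 1) * (-(-1) ^ (a.length + 1) * (-(-1) ^ (a.length + 1 + 1) * s₂)) =
      (-1) ^ a.length * s₂ := by
    simp only [neg_mul, mul_neg, neg_neg, ← mul_assoc, ← pow_add]
    congr 1
    apply units_neg_one_pow_eq
    omega
  rw [this]
  simp only [mul_assoc, mul_comm, mul_left_comm]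

end InnerSigns

/-! ### Dual basis elements and the transpose of the joining operators. -/

section DualForests

variable {α : Type*} [DecidableEq α] {I : Finset α}

lemma Forest.induction {P : Forest I → Prop} (h₀ : ∀ F, F.verts = ∅ → P F)
    (h₁ : ∀ F F' X Y u, IsTopDecomp F F' X Y u → P F' → P F) (F : Forest I) : P F := by
  induction hn : F.verts.card using Nat.strong_induction_on generalizing F with
  | h n ih =>
  rcases F.verts.eq_empty_or_nonempty with h0 | hne
  · exact h₀ F h0
  · obtain ⟨v, hv, hr⟩ := F.isForest.exists_top hne
    obtain ⟨X, Y, hXY, hc, hvXY, -⟩ := F.isForest.exists_children hv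
    obtain ⟨u, hu⟩ := exists_isTopDecomp F hv hr hXY hc hvXY
    exact h₁ _ _ _ _ _ hu (ih _ (by rw [← hn, hu.card_eq]; omega) _ rfl)

lemma outerWord_perm (F : Forest I) {a a' : List α} {ρ ρ' : List (Finset α)} (ha : a.Perm a')
    (hρ : ρ.Perm ρ') : (outerWord F a ρ).Perm (outerWord F a' ρ') ∧
    orSign (outerWord F a ρ) (outerWord F a' ρ') = orSign a a' * orSign ρ ρ' := by
  have h1 := ha.map fun i => (some ({i}, false) : Option (HalfEdge α))
  have h2 := hρ.map fun A => (some (A, true) : Option (HalfEdge α))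
  rw [outerWord_eq, outerWord_eq]
  refine ⟨((h1.append h2).append_right _).cons _, ?_⟩
  rw [orSign_cons_cons, orSign_append_right (h1.append h2), orSign_append h1,
    orSign_map ha (Function.Injective.injOn fun i j h => by simpa using h),
    orSign_map hρ (Function.Injective.injOn fun i j h => by simpa using h)]

lemma WordsMatch.perm {F : Forest I} {o : InnerData α} {a a' : List α} {ρ ρ' : List (Finset α)}
    (h : WordsMatch F o a ρ) (ha : a.Perm a') (hρ : ρ.Perm ρ') : WordsMatch F o a' ρ' :=
  ⟨h.1.trans (outerWord_perm F ha hρ).1, (outerWord_perm F ha hρ).1.nodup_iff.1 h.2⟩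

lemma innerSign_perm {F : Forest I} {o : InnerData α} {a a' : List α} {ρ ρ' : List (Finset α)}
    (h : WordsMatch F o a ρ) (ha : a.Perm a') (hρ : ρ.Perm ρ') :
    innerSign F o a' ρ' = innerSign F o a ρ * (orSign a a' * orSign ρ ρ') := by
  obtain ⟨p, s⟩ := outerWord_perm F ha hρ
  rw [innerSign, innerSign, ← orSign_trans h.1 p (p.nodup_iff.1 h.2), s, mul_assoc]

/-- Without inner vertices both words consist of `R` and of one leaf-root pair per leaf. With the
reversed leaf order there is no sign, so `oneForest` corresponds to the inner orientation `R` with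
sign one. -/
lemma wordsMatch_empty {F : Forest I} (hF : F.verts = ∅) {o : InnerData α}
    (ho : o.IsOrientationOf F) :
    WordsMatch F o I.toList.reverse (I.toList.map fun i => {i}) ∧
      innerSign F o I.toList.reverse (I.toList.map fun i => {i}) = o.sign := by
  have hg : o.glob = [none] := by
    have hl := ho.length_glob
    rw [hF, Finset.card_empty, zero_add] at hl
    obtain ⟨g, hg⟩ := List.length_eq_one_iff.1 hl
    have : none ∈ o.glob := (ho.mem_glob none).2 (Or.inl rfl)
    rw [hg] at this ⊢
    simp only [List.mem_singleton] at this
    rw [← this]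
  have hr : (roots I F.verts \ F.verts).toList.Perm (I.toList.map fun i => ({i} : Finset α)) := by
    rw [hF, Finset.sdiff_empty]
    exact (isRootList_singletons (List.Perm.refl _)).perm_toList.symm
  have ei : innerWord F o = none :: (roots I F.verts \ F.verts).toList.flatMap downPair := by
    rw [innerWord_eq, hg]
    rfl
  have eo : outerWord F I.toList.reverse (I.toList.map fun i => {i}) =
      none :: (I.toList.reverse.map (fun i => some ({i}, false)) ++
        I.toList.map (fun i => some ({i}, true))) := by
    rw [outerWord_eq, hF]
    simp
  have ef : (I.toList.map fun i => ({i} : Finset α)).flatMap downPair =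
      I.toList.flatMap fun i => [some ({i}, false), some ({i}, true)] := by
    rw [List.flatMap_map]
    rfl
  have hnd : (I.toList.map (fun i => (some ({i}, false) : Option (HalfEdge α))) ++
      I.toList.map (fun i => some ({i}, true))).Nodup := by
    refine List.nodup_append.2 ⟨(Finset.nodup_toList _).map fun i j h => by simpa using h,
      (Finset.nodup_toList _).map fun i j h => by simpa using h, ?_⟩
    intro x hx y hy e
    simp only [List.mem_map] at hx hy
    obtain ⟨i, -, rfl⟩ := hx
    obtain ⟨j, -, rfl⟩ := hy
    simp at e
  have hpr : (I.toList.reverse.map (fun i => (some ({i}, false) : Option (HalfEdge α))) ++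
      I.toList.map (fun i => some ({i}, true))).Perm (I.toList.map (fun i => some ({i}, false)) ++
      I.toList.map (fun i => some ({i}, true))) :=
    ((List.reverse_perm _).map _).append_right _
  have hpf : (I.toList.flatMap fun i => [(some ({i}, false) : Option (HalfEdge α)),
      some ({i}, true)]).Perm (I.toList.map (fun i => some ({i}, false)) ++
      I.toList.map (fun i => some ({i}, true))) := by
    generalize I.toList = l
    induction l with
    | nil => rfl
    | cons i l ih =>
      simp only [List.flatMap_cons, List.map_cons, List.cons_append, List.nil_append]
      exact ((ih.cons _).trans List.perm_middle.symm).cons _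
  have hd := hr.flatMap_right downPair
  rw [ef] at hd
  have hp : (innerWord F o).Perm
      (outerWord F I.toList.reverse (I.toList.map fun i => {i})) := by
    rw [ei, eo]
    exact (hd.trans (hpf.trans hpr.symm)).cons _
  have hn : (outerWord F I.toList.reverse (I.toList.map fun i => {i})).Nodup := by
    rw [eo, List.nodup_cons]
    exact ⟨by simp, hpr.nodup_iff.2 hnd⟩
  refine ⟨⟨hp, hn⟩, ?_⟩
  have hn' := hp.nodup_iff.2 hn
  rw [ei, List.nodup_cons] at hn'
  have s1 := orSign_flatMap_pair hr _ (fun x _ => even_downPair x) hn'.2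
  rw [ef] at s1
  rw [eo, List.nodup_cons] at hn
  rw [innerSign, ei, eo, orSign_cons_cons, ← orSign_trans hd (hpf.trans hpr.symm) hn.2, s1,
    orSign_pairs_reverse _ _ _ hnd, one_mul, mul_one]

/-- `orSign` has its meaning only for reorderings of the same word without repetitions. This is
inherited through `wordsMatch_join` from the forest without inner vertices. -/
lemma InnerData.IsOrientationOf.wordsMatch {F : Forest I} {o : InnerData α}
    (ho : o.IsOrientationOf F) {a : List α} (ha : a.Perm I.toList) {ρ : List (Finset α)}
    (hρ : IsRootList I F.verts ρ) : WordsMatch F o a ρ := by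
  induction F using Forest.induction generalizing o ρ with
  | h₀ F hF =>
    refine (wordsMatch_empty hF ho).1.perm ((List.reverse_perm _).trans ha.symm)
      (IsRootList.perm ?_ hρ)
    rw [hF]
    exact isRootList_singletons (List.Perm.refl _)
  | h₁ F F' X Y u h ih =>
    obtain ⟨ρ₀, hρ₀⟩ := exists_rootList h.left_mem h.right_mem h.ne
    have hj := hρ₀.join F'.isForest
    rw [← h.verts_eq] at hj
    exact (wordsMatch_join ho h hρ₀ (ih (ho.removeJoin h) hρ₀)).1.perm (List.Perm.refl _)
      (hj.perm hρ)

lemma dualForest_single_self (F : Forest I) (o : InnerData α) :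
    dualForest F o (Finsupp.single F 1) =
      ((innerSign F o I.toList (roots I F.verts).toList : ℤ) : ℚ) := by
  rw [dualForest, LinearMap.smul_apply, Finsupp.lapply_apply, Finsupp.single_eq_same,
    Units.smul_def, zsmul_eq_mul, mul_one]

lemma dualForest_single_of_ne {F G : Forest I} (o : InnerData α) (h : F ≠ G) :
    dualForest F o (Finsupp.single G 1) = 0 := by
  rw [dualForest, LinearMap.smul_apply, Finsupp.lapply_apply, Finsupp.single_eq_of_ne h, smul_zero]

lemma dualForest_outer {F : Forest I} {o : InnerData α} (ho : o.IsOrientationOf F) {a : List α}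
    (ha : a.Perm I.toList) {ρ : List (Finset α)} (hρ : IsRootList I F.verts ρ) :
    dualForest F o (outer I F.verts a ρ) = ((innerSign F o a ρ : ℤ) : ℚ) := by
  rw [outer_of_isForest F.isForest, map_units_smul, dualForest_single_self,
    innerSign_perm (ho.wordsMatch ha hρ) ha hρ.perm_toList, Units.smul_def, zsmul_eq_mul,
    ← Int.cast_mul, ← Units.val_mul, mul_comm, mul_assoc, Int.units_mul_self, mul_one]

lemma dualForest_oneForest {F : Forest I} (hF : F.verts = ∅) {o : InnerData α}
    (ho : o.IsOrientationOf F) : dualForest F o (oneForest I) = ((o.sign : ℤ) : ℚ) := by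
  have hr : IsRootList I F.verts (I.toList.map fun i => {i}) := by
    rw [hF]
    exact isRootList_singletons (List.Perm.refl _)
  have := dualForest_outer ho (List.reverse_perm I.toList) hr
  rw [(wordsMatch_empty hF ho).2, hF] at this
  exact this

/-- Evaluation on a join removes the new vertex from the inner orientation. -/
lemma dualForest_joinOp_single {F F' : Forest I} {X Y : Finset α} {u : ℤˣ}
    (h : IsTopDecomp F F' X Y u) {o : InnerData α} (ho : o.IsOrientationOf F) :
    dualForest F o (joinOp X Y (Finsupp.single F' 1)) =
      dualForest F' (o.removeJoin X Y) (Finsupp.single F' 1) := by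
  obtain ⟨ρ, hρ⟩ := exists_rootList h.left_mem h.right_mem h.ne
  have hj := hρ.join F'.isForest
  rw [← h.verts_eq] at hj
  have hR := List.Perm.refl I.toList
  have e : (Finsupp.single F' 1 : Bess I) = orSign (roots I F'.verts).toList (X :: Y :: ρ) •
      outer I F'.verts I.toList (X :: Y :: ρ) := by
    rw [single_eq_outer, outer_perm _ isRootList_toList hρ]
  have hw := (wordsMatch_join ho h hρ ((ho.removeJoin h).wordsMatch hR hρ)).2
  rw [Finset.length_toList] at hw
  rw [e, map_units_smul, map_units_smul, map_units_smul, joinOp_outer F'.isForest _ hρ,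
    ← h.verts_eq, map_units_smul, dualForest_outer ho hR hj,
    dualForest_outer (ho.removeJoin h) hR hρ, hw]
  congr 1
  rw [Units.smul_def, zsmul_eq_mul, ← Int.cast_mul, ← Units.val_mul, ← mul_assoc,
    Int.units_mul_self, one_mul]

/-- With equal local orientations the inner words differ by a permutation of blocks of odd length,
so only the global orientations contribute. -/
lemma dualForest_congr {F : Forest I} {o o' : InnerData α} (ho : o.IsOrientationOf F)
    (ho' : o'.IsOrientationOf F) (hloc : ∀ v ∈ F.verts, o.loc v = o'.loc v)
    {c : ℤˣ} (hs : o.sign * orSign o.glob o'.glob = c * o'.sign) :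
    dualForest F o = c • dualForest F o' := by
  have hg : o.glob.Perm o'.glob := by
    rw [List.perm_ext_iff_of_nodup ho.glob_nodup ho'.glob_nodup]
    intro g
    rw [ho.mem_glob, ho'.mem_glob]
  have hw := ho.wordsMatch (List.Perm.refl I.toList) isRootList_toList
  have hw' := ho'.wordsMatch (List.Perm.refl I.toList) isRootList_toList
  have hb : ∀ g ∈ o'.glob, o.block g = o'.block g := by
    intro g hg
    rw [ho'.mem_glob] at hg
    rcases hg with rfl | ⟨v, hv, rfl⟩
    · rfl
    · simp only [InnerData.block, hloc v hv]
  have hf : o'.glob.flatMap o.block = o'.glob.flatMap o'.block := List.flatMap_congr hb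
  have hpf := hg.flatMap_right o.block
  have hnd' := hw'.1.nodup_iff.2 hw'.2
  rw [innerWord_eq] at hnd'
  have s1 : orSign (innerWord F o) (innerWord F o') = orSign o.glob o'.glob := by
    rw [innerWord_eq, innerWord_eq, ← hf, orSign_append_right hpf, orSign_flatMap hg]
    · exact fun g hg' => ho.block_length (hg.mem_iff.2 hg')
    · rw [hf]
      exact (List.nodup_append.1 hnd').1
  have p1 : (innerWord F o).Perm (innerWord F o') := hw.1.trans hw'.1.symm
  rw [dualForest, dualForest, innerSign, innerSign, ← orSign_trans p1 hw'.1 hw'.2, s1, smul_smul,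
    ← mul_assoc, hs, mul_assoc]

open Classical in
/-- The pairs of children of a root vertex, the first one contained in `B` and the second one
in `C`. -/
def topPairs (F : Forest I) (B C : Finset α) : Finset (Finset α × Finset α) :=
  (nodes I F.verts ×ˢ nodes I F.verts).filter fun p =>
    (p.1 ⊆ B ∧ p.2 ⊆ C) ∧ ∃ F' u, IsTopDecomp F F' p.1 p.2 u

open Classical in
/-- Removal of the root vertex with the given children. -/
def prune (F : Forest I) (p : Finset α × Finset α) : Forest I :=
  if h : ∃ F' u, IsTopDecomp F F' p.1 p.2 u then h.choose else F

lemma IsTopDecomp.prune_eq {F F' : Forest I} {X Y : Finset α} {u : ℤˣ}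
    (h : IsTopDecomp F F' X Y u) : prune F (X, Y) = F' := by
  have hex : ∃ F' u, IsTopDecomp F F' X Y u := ⟨F', u, h⟩
  rw [prune, dif_pos hex]
  obtain ⟨w, hw⟩ := hex.choose_spec
  exact Forest.ext (by rw [hw.verts_eq_erase, h.verts_eq_erase])

lemma mem_topPairs {F : Forest I} {B C : Finset α} {p : Finset α × Finset α} :
    p ∈ topPairs F B C ↔ (p.1 ⊆ B ∧ p.2 ⊆ C) ∧ ∃ u, IsTopDecomp F (prune F p) p.1 p.2 u := by
  classical
  rw [topPairs, Finset.mem_filter, Finset.mem_product]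
  constructor
  · rintro ⟨-, h1, F', u, h2⟩
    have := h2.prune_eq
    exact ⟨h1, u, by rwa [this]⟩
  · rintro ⟨h1, u, h2⟩
    have hn : ∀ A ∈ nodes I (prune F p).verts, A ∈ nodes I F.verts := by
      intro A hA
      rw [mem_nodes] at hA ⊢
      rw [h2.verts_eq, Finset.mem_insert]
      tauto
    exact ⟨⟨hn _ (mem_roots.1 h2.left_mem).1, hn _ (mem_roots.1 h2.right_mem).1⟩, h1, _, u, h2⟩

/-- The join of `X` and `Y` in `G` is `F` exactly when `G` arises from `F` by deleting a root vertex
with children `X` and `Y`. Thus the transpose of a join deletes root vertices. For given `G` at most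
the pairs with `prune F p = G` contribute, on either side. -/
lemma dualForest_comp_joinOp {F : Forest I} {o : InnerData α} (ho : o.IsOrientationOf F)
    {B C : Finset α} (hBC : Disjoint B C) :
    dualForest F o ∘ₗ joinOp B C =
      ∑ p ∈ topPairs F B C, dualForest (prune F p) (o.removeJoin p.1 p.2) := by
  classical
  refine bess_hom_ext fun G => ?_
  rw [LinearMap.comp_apply, joinOp_single_eq_sum, LinearMap.sum_apply]
  simp only [map_sum]
  rw [← Finset.sum_product']
  set S := (roots I G.verts).filter (· ⊆ B) ×ˢ (roots I G.verts).filter (· ⊆ C) with hS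
  set Q := S.filter fun p => ∃ u, IsTopDecomp F G p.1 p.2 u with hQ
  have hQt : Q ⊆ topPairs F B C := by
    intro p hp
    rw [hQ, Finset.mem_filter, hS, Finset.mem_product, Finset.mem_filter, Finset.mem_filter] at hp
    obtain ⟨⟨h1, h2⟩, u, hu⟩ := hp
    rw [mem_topPairs]
    refine ⟨⟨h1.2, h2.2⟩, u, ?_⟩
    have : prune F p = G := hu.prune_eq
    rwa [this]
  rw [← Finset.sum_subset (Finset.filter_subset _ S : Q ⊆ S), ← Finset.sum_subset hQt]
  · refine Finset.sum_congr rfl fun p hp => ?_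
    obtain ⟨u, hu⟩ := (Finset.mem_filter.1 hp).2
    have : prune F p = G := hu.prune_eq
    rw [dualForest_joinOp_single hu ho, this]
  · intro p hp hpQ
    refine dualForest_single_of_ne _ fun e => ?_
    obtain ⟨h1, u, hu⟩ := mem_topPairs.1 hp
    rw [e] at hu
    refine hpQ (Finset.mem_filter.2 ⟨?_, u, hu⟩)
    exact Finset.mem_product.2 ⟨Finset.mem_filter.2 ⟨hu.left_mem, h1.1⟩,
      Finset.mem_filter.2 ⟨hu.right_mem, h1.2⟩⟩
  · intro p hp hpQ
    rw [hS, Finset.mem_product, Finset.mem_filter, Finset.mem_filter] at hp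
    have hne := ne_of_roots_subset hBC G.isForest hp.1.1 hp.1.2 hp.2.2
    obtain ⟨u, hu⟩ := exists_isTopDecomp_join G hp.1.1 hp.2.1 hne
    rw [hu.join_eq, map_units_smul, dualForest_single_of_ne _ ?_, smul_zero]
    intro e
    refine hpQ (Finset.mem_filter.2 ⟨?_, u, e ▸ hu⟩)
    rw [hS]
    exact Finset.mem_product.2 ⟨Finset.mem_filter.2 hp.1, Finset.mem_filter.2 hp.2⟩

end DualForests

/-! ### Maps of forests -/

section ForestMaps

variable {α : Type*} [DecidableEq α] {I : Finset α}

lemma exists_parent {W : Finset (Finset α)} (h : IsForest I W) {A : Finset α}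
    (hA : A ∈ nodes I W) (hr : A ∉ roots I W) : ∃ w ∈ W, A ∈ children I W w := by
  have hne : ((nodes I W).filter fun C => A ⊂ C).Nonempty := by
    rw [mem_roots] at hr
    push Not at hr
    obtain ⟨C, hC, hAC⟩ := hr hA
    exact ⟨C, Finset.mem_filter.2 ⟨hC, hAC⟩⟩
  obtain ⟨w, hw, hmin⟩ := Finset.exists_min_image _ Finset.card hne
  rw [Finset.mem_filter] at hw
  refine ⟨w, ?_, mem_children.2 ⟨hA, hw.2, fun C hC hCw hAC => ?_⟩⟩
  · rcases mem_nodes.1 hw.1 with h1 | ⟨i, -, rfl⟩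
    · exact h1
    · rw [Finset.ssubset_singleton_iff] at hw
      exact absurd (h.nodes_nonempty hA) (by simp [hw.2])
  · exact absurd (Finset.card_lt_card hCw) (not_lt.2 (hmin C (Finset.mem_filter.2 ⟨hC, hAC⟩)))

lemma IsTopDecomp.mem_nodes_iff {F G : Forest I} {X Y : Finset α} {u : ℤˣ}
    (h : IsTopDecomp F G X Y u) {A : Finset α} :
    A ∈ nodes I F.verts ↔ A = X ∪ Y ∨ A ∈ nodes I G.verts := by
  rw [h.verts_eq, nodes_insert, Finset.mem_insert]

lemma IsTopDecomp.children_of_mem {F G : Forest I} {X Y : Finset α} {u : ℤˣ}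
    (h : IsTopDecomp F G X Y u) {A : Finset α} (hA : A ∈ G.verts) :
    children I F.verts A = children I G.verts A := by
  rw [h.verts_eq]
  exact children_insert_of_mem G.isForest h.left_mem h.right_mem h.ne (mem_nodes_of_mem hA)

/-- A node that meets both children of a root vertex is this vertex. -/
lemma IsTopDecomp.eq_union {F G : Forest I} {X Y : Finset α} {u : ℤˣ}
    (h : IsTopDecomp F G X Y u) {A : Finset α} (hA : A ∈ nodes I F.verts) {i j : α} (hiA : i ∈ A)
    (hiX : i ∈ X) (hjA : j ∈ A) (hjY : j ∈ Y) : A = X ∪ Y := by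
  rcases h.mem_nodes_iff.1 hA with rfl | hA
  · rfl
  · obtain ⟨Z, hZ, hAZ⟩ := exists_root_ge hA
    exact absurd ((G.isForest.root_eq_of_mem h.left_mem hZ hiX (hAZ hiA)).trans
      (G.isForest.root_eq_of_mem hZ h.right_mem (hAZ hjA) hjY)) h.ne

namespace IsForestMap

variable {F' F : Forest I} {φ : Finset α → Finset α} (hφ : IsForestMap F' F φ)
include hφ

lemma map_node {A : Finset α} (hA : A ∈ nodes I F'.verts) : φ A ∈ nodes I F.verts := by
  rcases mem_nodes.1 hA with h | ⟨i, hi, rfl⟩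
  · exact mem_nodes_of_mem (hφ.vertex A h)
  · rw [hφ.leaf i hi]
    exact singleton_mem_nodes hi

/-- The map fixes the leaves and increases towards the root, so the image of a node still has all of
its leaves above it. -/
lemma subset_map {A : Finset α} (hA : A ∈ nodes I F'.verts) : A ⊆ φ A := by
  induction hn : A.card using Nat.strong_induction_on generalizing A with
  | h n ih =>
  rcases mem_nodes.1 hA with h | ⟨i, hi, rfl⟩
  · obtain ⟨B, C, hBC, hc, hA', -⟩ := F'.isForest.exists_children h
    have key : ∀ {D}, D ∈ children I F'.verts A → D ⊆ φ A := by
      intro D hD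
      have hD' := mem_children.1 hD
      exact (ih _ (hn ▸ Finset.card_lt_card hD'.2.1) hD'.1 rfl).trans
        (hφ.increasing A h D hD).1
    have hB := key (D := B) (by simp [hc])
    have hC := key (D := C) (by simp [hc])
    have := Finset.union_subset hB hC
    rwa [← hA'] at this
  · rw [hφ.leaf i hi]

variable {G : Forest I} {X Y : Finset α} {u : ℤˣ} (h : IsTopDecomp F G X Y u)
include h

lemma of_notMem (hv : ∀ w ∈ F'.verts, φ w ≠ X ∪ Y) : IsForestMap F' G φ where
  leaf := hφ.leaf
  vertex w hw := by
    have := hφ.vertex w hw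
    rw [h.verts_eq, Finset.mem_insert] at this
    exact this.resolve_left (hv w hw)
  injOn := hφ.injOn
  increasing := hφ.increasing
  branches w hw B hB C hC hBC D hD := by
    have hm := hφ.vertex w hw
    rw [h.verts_eq, Finset.mem_insert] at hm
    refine hφ.branches w hw B hB C hC hBC D ?_
    rwa [h.children_of_mem (hm.resolve_left (hv w hw))]

omit hφ in
lemma insert (hφ : IsForestMap F' G φ) : IsForestMap F' F φ where
  leaf := hφ.leaf
  vertex w hw := by
    rw [h.verts_eq]
    exact Finset.mem_insert_of_mem (hφ.vertex w hw)
  injOn := hφ.injOn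
  increasing := hφ.increasing
  branches w hw B hB C hC hBC D hD := by
    rw [h.children_of_mem (hφ.vertex w hw)] at hD
    exact hφ.branches w hw B hB C hC hBC D hD

/-- A parent of `w` would be mapped strictly below the root vertex `X ∪ Y`, in the direction of the
root. -/
lemma mem_roots_of_map_eq {w : Finset α} (hw : w ∈ F'.verts) (hφw : φ w = X ∪ Y) :
    w ∈ roots I F'.verts := by
  by_contra hr
  obtain ⟨z, hz, hwz⟩ := exists_parent F'.isForest (mem_nodes_of_mem hw) hr
  have := hφ.increasing z hz w hwz
  rw [hφw] at this
  exact (mem_roots.1 h.mem_roots).2 _ (mem_nodes_of_mem (hφ.vertex z hz)) this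

/-- The `branches` condition sends the two children of `w` into different children of `X ∪ Y`. As a
node is contained in its image, one child lies in `X` and the other in `Y`. -/
lemma exists_topPair {w : Finset α} (hw : w ∈ F'.verts) (hφw : φ w = X ∪ Y) :
    ∃ p ∈ topPairs F' X Y, p.1 ∪ p.2 = w := by
  have hr := hφ.mem_roots_of_map_eq h hw hφw
  obtain ⟨B, C, hBC, hc, hwBC, -⟩ := F'.isForest.exists_children hw
  have key : ∀ {D}, D ∈ children I F'.verts w → φ D ⊆ X ∨ φ D ⊆ Y := by
    intro D hD
    have h1 := hφ.increasing w hw D hD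
    rw [hφw] at h1
    have h2 := hφ.map_node (mem_children.1 hD).1
    rcases h.mem_nodes_iff.1 h2 with h3 | h3
    · rw [h3] at h1
      exact absurd h1 (irrefl _)
    · exact node_ssubset_union G.isForest h.left_mem h3 h1
  have hBm : B ∈ children I F'.verts w := by simp [hc]
  have hCm : C ∈ children I F'.verts w := by simp [hc]
  have hbr : ∀ D ∈ ({X, Y} : Finset (Finset α)), ¬ (φ B ⊆ D ∧ φ C ⊆ D) := by
    have := hφ.branches w hw B hBm C hCm hBC
    rw [hφw, h.children_eq] at this
    exact this
  have hbX := hbr X (by simp)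
  have hbY := hbr Y (by simp)
  have hBs := hφ.subset_map (mem_children.1 hBm).1
  have hCs := hφ.subset_map (mem_children.1 hCm).1
  obtain ⟨a, ha⟩ := exists_isTopDecomp F' hw hr hBC hc hwBC
  have hc' : children I F'.verts w = {C, B} := by rw [hc, Finset.pair_comm]
  obtain ⟨b, hb⟩ := exists_isTopDecomp F' hw hr hBC.symm hc' (by rw [hwBC, Finset.union_comm])
  rcases key hBm with hB | hB <;> rcases key hCm with hC | hC
  · exact absurd ⟨hB, hC⟩ hbX
  · refine ⟨(B, C), mem_topPairs.2 ⟨⟨hBs.trans hB, hCs.trans hC⟩, a, ?_⟩, hwBC.symm⟩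
    rwa [ha.prune_eq]
  · refine ⟨(C, B), mem_topPairs.2 ⟨⟨hCs.trans hC, hBs.trans hB⟩, b, ?_⟩, ?_⟩
    · rwa [hb.prune_eq]
    · rw [hwBC, Finset.union_comm]
  · exact absurd ⟨hB, hC⟩ hbY

/-- The image of `p.1 ∪ p.2` contains leaves of both `X` and `Y`, and `X ∪ Y` is the only such node
of `F`. So the vertex over the root vertex is visible in `F'` without knowing the map. -/
lemma map_topPair {p : Finset α × Finset α} (hp : p ∈ topPairs F' X Y) :
    φ (p.1 ∪ p.2) = X ∪ Y := by
  obtain ⟨⟨h1, h2⟩, w, hw⟩ := mem_topPairs.1 hp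
  obtain ⟨i, hi⟩ := (prune F' p).isForest.root_nonempty hw.left_mem
  obtain ⟨j, hj⟩ := (prune F' p).isForest.root_nonempty hw.right_mem
  have hn := mem_nodes_of_mem (I := I) hw.mem_verts
  have hs := hφ.subset_map hn
  exact h.eq_union (hφ.map_node hn) (hs (Finset.mem_union_left _ hi)) (h1 hi)
    (hs (Finset.mem_union_right _ hj)) (h2 hj)

/-- Both vertices are mapped to `X ∪ Y`, so injectivity makes them equal. The two children are
recovered by intersecting this vertex with the disjoint sets `X` and `Y`. -/
lemma topPair_unique {p q : Finset α × Finset α} (hp : p ∈ topPairs F' X Y)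
    (hq : q ∈ topPairs F' X Y) : p = q := by
  have e1 := hφ.map_topPair h hp
  have e2 := hφ.map_topPair h hq
  obtain ⟨⟨h1, h2⟩, w, hw⟩ := mem_topPairs.1 hp
  obtain ⟨⟨h1', h2'⟩, w', hw'⟩ := mem_topPairs.1 hq
  have e := hφ.injOn hw.mem_verts hw'.mem_verts (e1.trans e2.symm)
  have hd := h.disjoint
  refine Prod.ext (Finset.ext fun i => ?_) (Finset.ext fun i => ?_)
  · have hi := Finset.ext_iff.1 e i
    rw [Finset.mem_union, Finset.mem_union] at hi
    have d : i ∈ X → i ∉ Y := fun hx => Finset.disjoint_left.1 hd hx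
    have a1 : i ∈ p.1 → i ∈ X := fun hx => h1 hx
    have a2 : i ∈ p.2 → i ∈ Y := fun hx => h2 hx
    have a3 : i ∈ q.1 → i ∈ X := fun hx => h1' hx
    have a4 : i ∈ q.2 → i ∈ Y := fun hx => h2' hx
    tauto
  · have hi := Finset.ext_iff.1 e i
    rw [Finset.mem_union, Finset.mem_union] at hi
    have d : i ∈ X → i ∉ Y := fun hx => Finset.disjoint_left.1 hd hx
    have a1 : i ∈ p.1 → i ∈ X := fun hx => h1 hx
    have a2 : i ∈ p.2 → i ∈ Y := fun hx => h2 hx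
    have a3 : i ∈ q.1 → i ∈ X := fun hx => h1' hx
    have a4 : i ∈ q.2 → i ∈ Y := fun hx => h2' hx
    tauto

lemma restrict {p : Finset α × Finset α} (hp : p ∈ topPairs F' X Y) :
    IsForestMap (prune F' p) G φ := by
  have e1 := hφ.map_topPair h hp
  obtain ⟨-, w, hw⟩ := mem_topPairs.1 hp
  have hsub : ∀ z ∈ (prune F' p).verts, z ∈ F'.verts := fun z hz => by
    rw [hw.verts_eq]
    exact Finset.mem_insert_of_mem hz
  refine IsForestMap.of_notMem (F := F) ⟨hφ.leaf, fun z hz => hφ.vertex z (hsub z hz),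
    hφ.injOn.mono fun z hz => hsub z hz, fun z hz B hB => ?_, fun z hz B hB C hC => ?_⟩ h ?_
  · rw [← hw.children_of_mem hz] at hB
    exact hφ.increasing z (hsub z hz) B hB
  · rw [← hw.children_of_mem hz] at hB hC
    exact hφ.branches z (hsub z hz) B hB C hC
  · intro z hz e
    have := hφ.injOn (hsub z hz) hw.mem_verts (e.trans e1.symm)
    exact hw.notMem (this ▸ hz)

omit hφ in
/-- Extension of a map of forests by a root vertex. -/
lemma extend {p : Finset α × Finset α} (hp : p ∈ topPairs F' X Y)
    (hφ : IsForestMap (prune F' p) G φ) :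
    IsForestMap F' F (Function.update φ (p.1 ∪ p.2) (X ∪ Y)) := by
  obtain ⟨⟨h1, h2⟩, w, hw⟩ := mem_topPairs.1 hp
  have hn := union_notMem_nodes (prune F' p).isForest hw.left_mem hw.right_mem hw.ne
  have hold : ∀ A ∈ nodes I (prune F' p).verts,
      Function.update φ (p.1 ∪ p.2) (X ∪ Y) A = φ A := fun A hA =>
    Function.update_of_ne (ne_of_mem_of_not_mem hA hn) _ _
  have hchild : ∀ z, ∀ B ∈ children I (prune F' p).verts z,
      Function.update φ (p.1 ∪ p.2) (X ∪ Y) B = φ B := fun z B hB => hold B (mem_children.1 hB).1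
  -- The image of `B` lies in some root, which contains the leaves of `B` and so is the root `Z`.
  have hroot : ∀ {B Z}, B ∈ roots I (prune F' p).verts → Z ∈ roots I G.verts →
      B ⊆ Z → φ B ⊆ Z := by
    intro B Z hB hZ hBZ
    have hBn := (mem_roots.1 hB).1
    obtain ⟨Z', hZ', hs⟩ := exists_root_ge (hφ.map_node hBn)
    obtain ⟨i, hi⟩ := (prune F' p).isForest.root_nonempty hB
    rw [G.isForest.root_eq_of_mem hZ hZ' (hBZ hi) (hs (hφ.subset_map hBn hi))]
    exact hs
  have hX := hroot hw.left_mem h.left_mem h1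
  have hY := hroot hw.right_mem h.right_mem h2
  have hXv := left_ssubset_union G.isForest h.left_mem h.right_mem h.ne
  have hYv := right_ssubset_union G.isForest h.left_mem h.right_mem h.ne
  have hne1 := G.isForest.nodes_nonempty (hφ.map_node (mem_roots.1 hw.left_mem).1)
  have hne2 := G.isForest.nodes_nonempty (hφ.map_node (mem_roots.1 hw.right_mem).1)
  have hcase : ∀ {z}, z ∈ F'.verts → z = p.1 ∪ p.2 ∨ z ∈ (prune F' p).verts := by
    intro z hz
    rwa [hw.verts_eq, Finset.mem_insert] at hz
  constructor
  · intro i hi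
    rw [hold _ (singleton_mem_nodes hi), hφ.leaf i hi]
  · intro z hz
    rcases hcase hz with rfl | hz
    · rw [Function.update_self]
      exact h.mem_verts
    · rw [hold _ (mem_nodes_of_mem hz), h.verts_eq]
      exact Finset.mem_insert_of_mem (hφ.vertex z hz)
  · intro z hz z' hz' e
    rcases hcase hz with rfl | hz <;> rcases hcase hz' with rfl | hz'
    · rfl
    · rw [Function.update_self, hold _ (mem_nodes_of_mem hz')] at e
      exact absurd (hφ.vertex z' hz') (e ▸ h.notMem)
    · rw [Function.update_self, hold _ (mem_nodes_of_mem hz)] at e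
      exact absurd (hφ.vertex z hz) (e ▸ h.notMem)
    · rw [hold _ (mem_nodes_of_mem hz), hold _ (mem_nodes_of_mem hz')] at e
      exact hφ.injOn hz hz' e
  · intro z hz B hB
    rcases hcase hz with rfl | hz
    · rw [hw.children_eq, Finset.mem_insert, Finset.mem_singleton] at hB
      rw [Function.update_self]
      rcases hB with rfl | rfl
      · rw [hold _ (mem_roots.1 hw.left_mem).1]
        exact lt_of_le_of_lt hX hXv
      · rw [hold _ (mem_roots.1 hw.right_mem).1]
        exact lt_of_le_of_lt hY hYv
    · rw [hw.children_of_mem hz] at hB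
      rw [hchild z B hB, hold _ (mem_nodes_of_mem hz)]
      exact hφ.increasing z hz B hB
  · intro z hz B hB C hC hBC D hD
    rcases hcase hz with rfl | hz
    · rw [Function.update_self, h.children_eq] at hD
      rw [hw.children_eq] at hB hC
      have hkey : ¬ (φ p.1 ⊆ D ∧ φ p.2 ⊆ D) := by
        rintro ⟨hs1, hs2⟩
        simp only [Finset.mem_insert, Finset.mem_singleton] at hD
        obtain ⟨i, hi⟩ := hne1
        obtain ⟨j, hj⟩ := hne2
        rcases hD with rfl | rfl
        · exact Finset.disjoint_left.1 h.disjoint (hs2 hj) (hY hj)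
        · exact Finset.disjoint_left.1 h.disjoint (hX hi) (hs1 hi)
      simp only [Finset.mem_insert, Finset.mem_singleton] at hB hC
      have e1 := hold _ (mem_roots.1 hw.left_mem).1
      have e2 := hold _ (mem_roots.1 hw.right_mem).1
      rcases hB with rfl | rfl <;> rcases hC with rfl | rfl
      · exact absurd rfl hBC
      · rw [e1, e2]
        exact hkey
      · rw [e1, e2, and_comm]
        exact hkey
      · exact absurd rfl hBC
    · rw [hw.children_of_mem hz] at hB hC
      rw [hold _ (mem_nodes_of_mem hz), h.children_of_mem (hφ.vertex z hz)] at hD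
      rw [hchild z B hB, hchild z C hC]
      exact hφ.branches z hz B hB C hC hBC D hD

end IsForestMap

/-- A map of forests is determined by its image. -/
lemma IsForestMap.eq_of_image_eq {F F' : Forest I} {φ ψ : Finset α → Finset α}
    (hφ : IsForestMap F' F φ) (hψ : IsForestMap F' F ψ)
    (he : F'.verts.image φ = F'.verts.image ψ) {A : Finset α} (hA : A ∈ nodes I F'.verts) :
    φ A = ψ A := by
  induction F using Forest.induction generalizing F' A with
  | h₀ F hF =>
    rcases mem_nodes.1 hA with h | ⟨i, hi, rfl⟩
    · have := hφ.vertex A h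
      simp [hF] at this
    · rw [hφ.leaf i hi, hψ.leaf i hi]
  | h₁ F G X Y u h ih =>
    -- As the images agree, either both maps reach `X ∪ Y` or neither does. In the first case they
    -- do so at the same vertex by `map_topPair`, and both restrict to maps into `G`; in the second
    -- case they are maps into `G` already.
    by_cases hv : ∃ w ∈ F'.verts, φ w = X ∪ Y
    · obtain ⟨w, hw, hφw⟩ := hv
      obtain ⟨p, hp, rfl⟩ := hφ.exists_topPair h hw hφw
      obtain ⟨-, a, ha⟩ := mem_topPairs.1 hp
      have hψw := hψ.map_topPair h hp
      rcases ha.mem_nodes_iff.1 hA with rfl | hA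
      · rw [hφw, hψw]
      · refine ih (hφ.restrict h hp) (hψ.restrict h hp) ?_ hA
        have key : ∀ {χ : Finset α → Finset α}, IsForestMap F' F χ → χ (p.1 ∪ p.2) = X ∪ Y →
            (prune F' p).verts.image χ = (F'.verts.image χ).erase (X ∪ Y) := by
          intro χ hχ hχw
          ext D
          simp only [Finset.mem_image, Finset.mem_erase, ha.verts_eq_erase]
          constructor
          · rintro ⟨z, ⟨hz1, hz2⟩, rfl⟩
            exact ⟨fun e => hz1 (hχ.injOn hz2 ha.mem_verts (e.trans hχw.symm)), z, hz2, rfl⟩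
          · rintro ⟨h1, z, hz, rfl⟩
            exact ⟨z, ⟨fun e => h1 (by rw [e, hχw]), hz⟩, rfl⟩
        rw [key hφ hφw, key hψ hψw, he]
    · push Not at hv
      have hv' : ∀ w ∈ F'.verts, ψ w ≠ X ∪ Y := by
        intro w hw e
        have : X ∪ Y ∈ F'.verts.image φ := by
          rw [he]
          exact Finset.mem_image.2 ⟨w, hw, e⟩
        obtain ⟨z, hz, hze⟩ := Finset.mem_image.1 this
        exact hv z hz hze
      exact ih (hφ.of_notMem h hv) (hψ.of_notMem h hv') he hA

/-! ### Recursion for `γ(F, V)` when a root vertex is removed. -/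

section MemGamma

variable {F F' : Forest I} {V : Finset (Finset α)}

lemma MemGamma.nodeMap_spec (h : MemGamma F V F') :
    IsForestMap F' F (nodeMap F V F') ∧ F'.verts.image (nodeMap F V F') = V := by
  rw [nodeMap, dif_pos h]
  exact h.choose_spec

/-- `nodeMap` is obtained by choice. Since the image determines the map on nodes, it may be computed
from any map at hand. -/
lemma IsForestMap.nodeMap_eq {φ : Finset α → Finset α} (hφ : IsForestMap F' F φ)
    (hi : F'.verts.image φ = V) {A : Finset α} (hA : A ∈ nodes I F'.verts) :
    nodeMap F V F' A = φ A := by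
  have hm : MemGamma F V F' := ⟨φ, hφ, hi⟩
  exact hm.nodeMap_spec.1.eq_of_image_eq hφ (hm.nodeMap_spec.2.trans hi.symm) hA

variable {G : Forest I} {X Y : Finset α} {u : ℤˣ} (h : IsTopDecomp F G X Y u)
  (hV : V ⊆ G.verts)
include h hV

/-- A root vertex outside `V` is not hit, so it may be added or removed freely. -/
lemma memGamma_iff : MemGamma F V F' ↔ MemGamma G V F' := by
  constructor
  · rintro ⟨φ, hφ, hi⟩
    refine ⟨φ, hφ.of_notMem h fun w hw e => h.notMem (hV ?_), hi⟩
    rw [← hi, ← e]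
    exact Finset.mem_image_of_mem _ hw
  · rintro ⟨φ, hφ, hi⟩
    exact ⟨φ, IsForestMap.insert h hφ, hi⟩

omit hV in
lemma nodeMap_eq_of_memGamma (hm : MemGamma G V F') {A : Finset α} (hA : A ∈ nodes I F'.verts) :
    nodeMap F V F' A = nodeMap G V F' A :=
  (IsForestMap.insert h hm.nodeMap_spec.1).nodeMap_eq hm.nodeMap_spec.2 hA

omit h hV in
lemma image_update {p : Finset α × Finset α} (hp : p ∈ topPairs F' X Y)
    {φ : Finset α → Finset α} (hi : (prune F' p).verts.image φ = V) :
    F'.verts.image (Function.update φ (p.1 ∪ p.2) (X ∪ Y)) = insert (X ∪ Y) V := by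
  obtain ⟨-, a, ha⟩ := mem_topPairs.1 hp
  rw [ha.verts_eq, Finset.image_insert, Function.update_self, ← hi]
  congr 1
  refine Finset.image_congr fun A hA => Function.update_of_ne (ne_of_mem_of_not_mem hA ha.notMem) _ _

/-- The vertex of `F'` over `X ∪ Y` is a root vertex with children in `X` and in `Y`; deleting it
restricts the map, and adding it extends the map. This is the combinatorial counterpart of
`dualForest_comp_joinOp`. -/
lemma memGamma_insert_iff : MemGamma F (insert (X ∪ Y) V) F' ↔
    ∃ p ∈ topPairs F' X Y, MemGamma G V (prune F' p) := by
  constructor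
  · rintro ⟨φ, hφ, hi⟩
    obtain ⟨w, hw, hφw⟩ := Finset.mem_image.1
      (hi.symm ▸ Finset.mem_insert_self (X ∪ Y) V : X ∪ Y ∈ F'.verts.image φ)
    obtain ⟨p, hp, rfl⟩ := hφ.exists_topPair h hw hφw
    obtain ⟨-, a, ha⟩ := mem_topPairs.1 hp
    refine ⟨p, hp, φ, hφ.restrict h hp, ?_⟩
    have hvV : X ∪ Y ∉ V := fun hm => h.notMem (hV hm)
    rw [← Finset.erase_insert hvV, ← hi]
    ext D
    simp only [Finset.mem_image, Finset.mem_erase, ha.verts_eq_erase]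
    constructor
    · rintro ⟨z, ⟨hz1, hz2⟩, rfl⟩
      exact ⟨fun e => hz1 (hφ.injOn hz2 ha.mem_verts (e.trans hφw.symm)), z, hz2, rfl⟩
    · rintro ⟨h1, z, hz, rfl⟩
      exact ⟨z, ⟨fun e => h1 (by rw [e, hφw]), hz⟩, rfl⟩
  · rintro ⟨p, hp, φ, hφ, hi⟩
    exact ⟨_, IsForestMap.extend h hp hφ, image_update hp hi⟩

omit hV in
lemma nodeMap_insert {p : Finset α × Finset α} (hp : p ∈ topPairs F' X Y)
    (hm : MemGamma G V (prune F' p)) :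
    nodeMap F (insert (X ∪ Y) V) F' (p.1 ∪ p.2) = X ∪ Y ∧
    ∀ A ∈ nodes I (prune F' p).verts,
      nodeMap F (insert (X ∪ Y) V) F' A = nodeMap G V (prune F' p) A := by
  obtain ⟨-, a, ha⟩ := mem_topPairs.1 hp
  have hE := IsForestMap.extend h hp hm.nodeMap_spec.1
  have hI := image_update hp hm.nodeMap_spec.2
  have hn := union_notMem_nodes (prune F' p).isForest ha.left_mem ha.right_mem ha.ne
  constructor
  · rw [hE.nodeMap_eq hI (mem_nodes_of_mem ha.mem_verts), Function.update_self]
  · intro A hA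
    rw [hE.nodeMap_eq hI (ha.mem_nodes_iff.2 (Or.inr hA)),
      Function.update_of_ne (ne_of_mem_of_not_mem hA hn)]

omit hV in
lemma topPair_unique {p q : Finset α × Finset α} (hp : p ∈ topPairs F' X Y)
    (hq : q ∈ topPairs F' X Y) (hm : MemGamma G V (prune F' p)) : p = q :=
  (IsForestMap.extend h hp hm.nodeMap_spec.1).topPair_unique h hp hq

end MemGamma

end ForestMaps

/-! ### Glued orientations -/

section Glue

variable {α : Type*} [DecidableEq α] {I : Finset α}

namespace IsForestMap

variable {F' F : Forest I} {φ : Finset α → Finset α} (hφ : IsForestMap F' F φ)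
include hφ

/-- The `branches` condition provides different, hence disjoint, children `D` and `E` over the
images of `B` and `C`. Each filter in `transportLoc` then has a single member, and its `sup` is that
member. -/
lemma transportLoc_eq {w B C : Finset α} (hw : w ∈ F'.verts)
    (hc : children I F'.verts w = {B, C}) (hBC : B ≠ C) :
    ∃ D E, φ B ⊆ D ∧ φ C ⊆ E ∧ D ≠ E ∧ children I F.verts (φ w) = {D, E} ∧
      transportLoc F φ (φ w) [(w, true), (B, false), (C, false)] =
        [(φ w, true), (D, false), (E, false)] := by
  have hBm : B ∈ children I F'.verts w := by simp [hc]
  have hCm : C ∈ children I F'.verts w := by simp [hc]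
  have hBn := hφ.map_node (mem_children.1 hBm).1
  have hCn := hφ.map_node (mem_children.1 hCm).1
  obtain ⟨D, hD, hBD⟩ := exists_child_ge hBn (hφ.increasing w hw B hBm)
  obtain ⟨E, hE, hCE⟩ := exists_child_ge hCn (hφ.increasing w hw C hCm)
  have hDE : D ≠ E := by
    rintro rfl
    exact hφ.branches w hw B hBm C hCm hBC D hD ⟨hBD, hCE⟩
  have hch : children I F.verts (φ w) = {D, E} := by
    refine (Finset.eq_of_subset_of_card_le ?_ ?_).symm
    · intro Z hZ
      simp only [Finset.mem_insert, Finset.mem_singleton] at hZ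
      rcases hZ with rfl | rfl <;> assumption
    · rw [F.isForest.binary _ (hφ.vertex w hw), Finset.card_pair hDE]
  have hdis := F.isForest.children_disjoint hD hE hDE
  obtain ⟨i, hi⟩ := F.isForest.nodes_nonempty hBn
  obtain ⟨j, hj⟩ := F.isForest.nodes_nonempty hCn
  have f1 : (children I F.verts (φ w)).filter (fun Z => φ B ⊆ Z) = {D} := by
    rw [hch]
    ext Z
    simp only [Finset.mem_filter, Finset.mem_insert, Finset.mem_singleton]
    constructor
    · rintro ⟨rfl | rfl, h⟩
      · rfl
      · exact absurd (h hi) (Finset.disjoint_left.1 hdis (hBD hi))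
    · rintro rfl
      exact ⟨Or.inl rfl, hBD⟩
  have f2 : (children I F.verts (φ w)).filter (fun Z => φ C ⊆ Z) = {E} := by
    rw [hch]
    ext Z
    simp only [Finset.mem_filter, Finset.mem_insert, Finset.mem_singleton]
    constructor
    · rintro ⟨rfl | rfl, h⟩
      · exact absurd (hCE hj) (Finset.disjoint_left.1 hdis (h hj))
      · rfl
    · rintro rfl
      exact ⟨Or.inr rfl, hCE⟩
  refine ⟨D, E, hBD, hCE, hDE, hch, ?_⟩
  simp [transportLoc, f1, f2]

end IsForestMap

lemma InnerData.IsOrientationOf.loc_perm_children {F : Forest I} {o : InnerData α}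
    (ho : o.IsOrientationOf F) {w B C : Finset α} (hw : w ∈ F.verts)
    (hc : children I F.verts w = {B, C}) (hBC : B ≠ C) :
    (o.loc w).Perm [(w, true), (B, false), (C, false)] := by
  rw [List.perm_ext_iff_of_nodup (ho.loc_nodup _ hw) (by simp [hBC])]
  intro p
  rw [ho.mem_loc _ hw, hc]
  simp

lemma transportLoc_perm {F : Forest I} {φ : Finset α → Finset α} {v : Finset α}
    {l m : List (HalfEdge α)} (h : l.Perm m) (hnd : (transportLoc F φ v m).Nodup) :
    (transportLoc F φ v l).Perm (transportLoc F φ v m) ∧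
      orSign (transportLoc F φ v l) (transportLoc F φ v m) = orSign l m :=
  ⟨h.map _, orSign_map h fun _ hx _ hy e => List.inj_on_of_nodup_map hnd hx hy e⟩

/-- The local orientation at `v` that comes from the vertex of `F'` mapped to `v`. -/
def pushLoc (F F' : Forest I) (φ : Finset α → Finset α) (o : InnerData α) (v : Finset α) :
    List (HalfEdge α) :=
  transportLoc F φ v (o.loc (Function.invFunOn φ (F'.verts : Set (Finset α)) v))

namespace IsForestMap

variable {F' F : Forest I} {φ : Finset α → Finset α} (hφ : IsForestMap F' F φ)
include hφ

lemma invFunOn_map {w : Finset α} (hw : w ∈ F'.verts) :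
    Function.invFunOn φ (F'.verts : Set (Finset α)) (φ w) = w := by
  have hex : ∃ a ∈ (F'.verts : Set (Finset α)), φ a = φ w := ⟨w, hw, rfl⟩
  exact hφ.injOn (Function.invFunOn_mem hex) hw (Function.invFunOn_eq hex)

lemma pushLoc_map (o : InnerData α) {w : Finset α} (hw : w ∈ F'.verts) :
    pushLoc F F' φ o (φ w) = transportLoc F φ (φ w) (o.loc w) := by
  rw [pushLoc, hφ.invFunOn_map hw]

lemma pushLoc_isOrientation {o : InnerData α} (ho : o.IsOrientationOf F') {w : Finset α}
    (hw : w ∈ F'.verts) : (pushLoc F F' φ o (φ w)).Nodup ∧ ∀ p, p ∈ pushLoc F F' φ o (φ w) ↔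
      p = (φ w, true) ∨ ∃ B ∈ children I F.verts (φ w), p = (B, false) := by
  obtain ⟨B, C, hBC, hc, -, -⟩ := F'.isForest.exists_children hw
  obtain ⟨D, E, -, -, hDE, hch, ht⟩ := hφ.transportLoc_eq hw hc hBC
  have hnd : (transportLoc F φ (φ w) [(w, true), (B, false), (C, false)]).Nodup := by
    rw [ht]
    simp [hDE]
  obtain ⟨hp, -⟩ := transportLoc_perm (ho.loc_perm_children hw hc hBC) hnd
  rw [hφ.pushLoc_map o hw]
  refine ⟨hp.nodup_iff.2 hnd, fun p => ?_⟩
  rw [hp.mem_iff, ht, hch]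
  simp

/-- A transported local orientation only depends on the children of the vertex and of its image, and
on the map there. The removal of another vertex at the root leaves these unchanged. -/
lemma pushLoc_congr {o : InnerData α} (ho : o.IsOrientationOf F') {F'' G : Forest I}
    {ψ : Finset α → Finset α} (hψ : IsForestMap F'' G ψ) (hsub : F''.verts ⊆ F'.verts)
    (hc' : ∀ z ∈ F''.verts, children I F''.verts z = children I F'.verts z)
    (hc : ∀ z ∈ G.verts, children I F.verts z = children I G.verts z)
    (he : ∀ A ∈ nodes I F''.verts, φ A = ψ A) {z : Finset α} (hz : z ∈ F''.verts) :
    pushLoc F F' φ o (ψ z) = pushLoc G F'' ψ o (ψ z) := by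
  rw [hψ.pushLoc_map o hz, ← he z (mem_nodes_of_mem hz), hφ.pushLoc_map o (hsub hz),
    he z (mem_nodes_of_mem hz)]
  refine List.map_congr_left fun p hp => ?_
  rw [ho.mem_loc z (hsub hz), ← hc' z hz] at hp
  rcases hp with rfl | ⟨B, hB, rfl⟩
  · rfl
  · simp only [Bool.false_eq_true, if_false]
    rw [he B (mem_children.1 hB).1, hc _ (hψ.vertex z hz)]

/-- The local orientation at a root vertex is transported without sign. -/
lemma pushLoc_topPair {o : InnerData α} (ho : o.IsOrientationOf F') {G : Forest I}
    {X Y : Finset α} {u : ℤˣ} (h : IsTopDecomp F G X Y u) {p : Finset α × Finset α}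
    (hp : p ∈ topPairs F' X Y) :
    orSign (pushLoc F F' φ o (X ∪ Y)) [(X ∪ Y, true), (X, false), (Y, false)] =
      orSign (o.loc (p.1 ∪ p.2)) [(p.1 ∪ p.2, true), (p.1, false), (p.2, false)] := by
  have hv := hφ.map_topPair h hp
  obtain ⟨⟨h1, h2⟩, w, hw⟩ := mem_topPairs.1 hp
  obtain ⟨D, E, hD, hE, hDE, hch, ht⟩ := hφ.transportLoc_eq hw.mem_verts hw.children_eq hw.ne
  rw [hv, h.children_eq] at hch
  have hm1 : p.1 ∈ nodes I F'.verts := hw.mem_nodes_iff.2 (Or.inr (mem_roots.1 hw.left_mem).1)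
  have hm2 : p.2 ∈ nodes I F'.verts := hw.mem_nodes_iff.2 (Or.inr (mem_roots.1 hw.right_mem).1)
  obtain ⟨i, hi⟩ := (prune F' p).isForest.root_nonempty hw.left_mem
  obtain ⟨j, hj⟩ := (prune F' p).isForest.root_nonempty hw.right_mem
  have hDm : D ∈ ({X, Y} : Finset (Finset α)) := by simp [hch]
  have hEm : E ∈ ({X, Y} : Finset (Finset α)) := by simp [hch]
  have hDX : D = X := by
    simp only [Finset.mem_insert, Finset.mem_singleton] at hDm
    rcases hDm with e | e
    · exact e
    · exact absurd (e ▸ hD (hφ.subset_map hm1 hi)) (Finset.disjoint_left.1 h.disjoint (h1 hi))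
  have hEY : E = Y := by
    simp only [Finset.mem_insert, Finset.mem_singleton] at hEm
    rcases hEm with e | e
    · exact absurd (h2 hj) (Finset.disjoint_left.1 h.disjoint (e ▸ hE (hφ.subset_map hm2 hj)))
    · exact e
  subst hDX hEY
  have hnd : (transportLoc F φ (φ (p.1 ∪ p.2))
      [(p.1 ∪ p.2, true), (p.1, false), (p.2, false)]).Nodup := by
    rw [ht]
    simp [hDE]
  obtain ⟨-, hs⟩ := transportLoc_perm (ho.loc_perm hw) hnd
  rw [← hs, ht, ← hv, hφ.pushLoc_map o hw.mem_verts]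

end IsForestMap

/-- The reference global orientation. -/
def refGlob (F : Forest I) : List (Option (Finset α)) := none :: F.verts.toList.map some

lemma refGlob_nodup (F : Forest I) : (refGlob F).Nodup := by
  rw [refGlob, List.nodup_cons]
  exact ⟨by simp, (Finset.nodup_toList _).map (Option.some_injective _)⟩

lemma mem_refGlob {F : Forest I} {g : Option (Finset α)} :
    g ∈ refGlob F ↔ g = none ∨ ∃ v ∈ F.verts, g = some v := by
  simp [refGlob, eq_comm]

section GlueData

variable {F F₁ F₂ : Forest I} {o₁ o₂ : InnerData α} {V : Finset (Finset α)}

lemma glue_loc (v : Finset α) : (glue F₁ F₂ o₁ o₂ F V).loc v =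
    if v ∈ V then pushLoc F F₁ (nodeMap F V F₁) o₁ v
      else pushLoc F F₂ (nodeMap F (F.verts \ V) F₂) o₂ v := rfl

lemma glue_glob : (glue F₁ F₂ o₁ o₂ F V).glob = refGlob F := rfl

lemma glue_sign : (glue F₁ F₂ o₁ o₂ F V).sign = o₁.sign * o₂.sign *
    orSign (gluedWord (nodeMap F V F₁) (nodeMap F (F.verts \ V) F₂) o₁ o₂)
      (expandR (refGlob F)) := rfl

lemma glue_isOrientationOf (ho₁ : o₁.IsOrientationOf F₁) (ho₂ : o₂.IsOrientationOf F₂)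
    (h₁ : MemGamma F V F₁) (h₂ : MemGamma F (F.verts \ V) F₂) :
    (glue F₁ F₂ o₁ o₂ F V).IsOrientationOf F := by
  obtain ⟨m₁, i₁⟩ := h₁.nodeMap_spec
  obtain ⟨m₂, i₂⟩ := h₂.nodeMap_spec
  have key : ∀ v ∈ F.verts, ((glue F₁ F₂ o₁ o₂ F V).loc v).Nodup ∧
      ∀ p, p ∈ (glue F₁ F₂ o₁ o₂ F V).loc v ↔
        p = (v, true) ∨ ∃ B ∈ children I F.verts v, p = (B, false) := by
    intro v hv
    rw [glue_loc]
    split_ifs with hvV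
    · obtain ⟨w, hw, hwv⟩ := Finset.mem_image.1 (i₁.symm ▸ hvV)
      have := m₁.pushLoc_isOrientation ho₁ hw
      rwa [hwv] at this
    · have hv2 : v ∈ F.verts \ V := Finset.mem_sdiff.2 ⟨hv, hvV⟩
      obtain ⟨w, hw, hwv⟩ := Finset.mem_image.1 (i₂.symm ▸ hv2)
      have := m₂.pushLoc_isOrientation ho₂ hw
      rwa [hwv] at this
  exact ⟨refGlob_nodup F, fun g => mem_refGlob, fun v hv => (key v hv).1, fun v hv => (key v hv).2⟩

end GlueData

/-- The symbol of a global orientation in a glued word. -/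
def glueSymbol (φ : Finset α → Finset α) (s : GlueSymbol (Finset α)) (g : Option (Finset α)) :
    GlueSymbol (Finset α) :=
  match g with
  | none => s
  | some v => .vertex (φ v)

/-- The symbols that replace an element of a global orientation. -/
def expandSymbol (g : Option (Finset α)) : List (GlueSymbol (Finset α)) :=
  match g with
  | none => [.R₁, .r, .R₂]
  | some v => [.vertex v]

omit [DecidableEq α] in
lemma gluedWord_eq (φ₁ φ₂ : Finset α → Finset α) (o₁ o₂ : InnerData α) :
    gluedWord φ₁ φ₂ o₁ o₂ = o₁.glob.map (glueSymbol φ₁ .R₁) ++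
      .r :: o₂.glob.map (glueSymbol φ₂ .R₂) := rfl

omit [DecidableEq α] in
lemma expandR_eq (l : List (Option (Finset α))) : expandR l = l.flatMap expandSymbol := rfl

lemma expandR_refGlob (F : Forest I) : expandR (refGlob F) =
    .R₁ :: .r :: .R₂ :: F.verts.toList.map .vertex := by
  rw [expandR_eq, refGlob, List.flatMap_cons, List.flatMap_map]
  simp only [expandSymbol, List.cons_append, List.nil_append]
  congr 3
  exact List.flatMap_pure_eq_map _ _

lemma expandR_refGlob_nodup (F : Forest I) : (expandR (refGlob F)).Nodup := by
  rw [expandR_refGlob]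
  have : (F.verts.toList.map (GlueSymbol.vertex (β := Finset α))).Nodup :=
    (Finset.nodup_toList _).map fun a b h => by simpa using h
  simp [this]

lemma IsForestMap.injOn_glueSymbol {F F' : Forest I} {φ : Finset α → Finset α}
    (hφ : IsForestMap F' F φ) {o : InnerData α} (ho : o.IsOrientationOf F')
    {s : GlueSymbol (Finset α)} (hs : ∀ v, s ≠ .vertex v) :
    Set.InjOn (glueSymbol φ s) {g | g ∈ o.glob} := by
  intro g hg g' hg' e
  rw [Set.mem_ofPred_eq, ho.mem_glob] at hg hg'
  rcases hg with rfl | ⟨v, hv, rfl⟩ <;> rcases hg' with rfl | ⟨v', hv', rfl⟩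
  · rfl
  · exact absurd e (hs _)
  · exact absurd e.symm (hs _)
  · simp only [glueSymbol, GlueSymbol.vertex.injEq] at e
    rw [hφ.injOn hv hv' e]

lemma mem_map_glueSymbol {F' : Forest I} {φ : Finset α → Finset α}
    {o : InnerData α} (ho : o.IsOrientationOf F')
    {s : GlueSymbol (Finset α)} {g : GlueSymbol (Finset α)} :
    g ∈ o.glob.map (glueSymbol φ s) ↔ g = s ∨ ∃ v ∈ F'.verts.image φ, g = .vertex v := by
  simp only [List.mem_map, ho.mem_glob, Finset.mem_image]
  constructor
  · rintro ⟨_, rfl | ⟨v, hv, rfl⟩, rfl⟩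
    · exact Or.inl rfl
    · exact Or.inr ⟨φ v, ⟨v, hv, rfl⟩, rfl⟩
  · rintro (rfl | ⟨_, ⟨v, hv, rfl⟩, rfl⟩)
    · exact ⟨none, Or.inl rfl, rfl⟩
    · exact ⟨some v, Or.inr ⟨v, hv, rfl⟩, rfl⟩

/-- `V` and its complement are the images of the two vertex sets, so each vertex of `F` occurs once.
The symbols `R₁`, `r`, `R₂` occur once each by construction. -/
lemma gluedWord_perm {F F₁ F₂ : Forest I} {o₁ o₂ : InnerData α} {V : Finset (Finset α)}
    {φ₁ φ₂ : Finset α → Finset α} (ho₁ : o₁.IsOrientationOf F₁) (ho₂ : o₂.IsOrientationOf F₂)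
    (hV : V ⊆ F.verts) (m₁ : IsForestMap F₁ F φ₁) (i₁ : F₁.verts.image φ₁ = V)
    (m₂ : IsForestMap F₂ F φ₂) (i₂ : F₂.verts.image φ₂ = F.verts \ V) :
    (gluedWord φ₁ φ₂ o₁ o₂).Perm (expandR (refGlob F)) := by
  have n₁ : (o₁.glob.map (glueSymbol φ₁ .R₁)).Nodup :=
    List.Nodup.map_on (fun x hx y hy e => m₁.injOn_glueSymbol ho₁ (by simp) hx hy e) ho₁.glob_nodup
  have n₂ : (o₂.glob.map (glueSymbol φ₂ .R₂)).Nodup :=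
    List.Nodup.map_on (fun x hx y hy e => m₂.injOn_glueSymbol ho₂ (by simp) hx hy e) ho₂.glob_nodup
  have hn : (gluedWord φ₁ φ₂ o₁ o₂).Nodup := by
    rw [gluedWord_eq, List.nodup_append, List.nodup_cons]
    refine ⟨n₁, ⟨?_, n₂⟩, ?_⟩
    · rw [mem_map_glueSymbol ho₂]
      simp
    · intro a ha b hb e
      subst e
      rw [mem_map_glueSymbol ho₁, i₁] at ha
      rw [List.mem_cons, mem_map_glueSymbol ho₂, i₂] at hb
      rcases ha with rfl | ⟨v, hv, rfl⟩
      · simp at hb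
      · simp only [reduceCtorEq, GlueSymbol.vertex.injEq, exists_eq_right', Finset.mem_sdiff,
          false_or] at hb
        exact hb.2 hv
  rw [List.perm_ext_iff_of_nodup hn (expandR_refGlob_nodup F)]
  intro g
  rw [gluedWord_eq, List.mem_append, List.mem_cons, mem_map_glueSymbol ho₁, mem_map_glueSymbol ho₂,
    i₁, i₂, expandR_refGlob]
  simp only [List.mem_cons, List.mem_map, Finset.mem_toList, Finset.mem_sdiff]
  cases g with
  | vertex v =>
    simp only [reduceCtorEq, GlueSymbol.vertex.injEq, exists_eq_right', false_or, exists_eq_right]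
    have := @hV v
    tauto
  | R₁ => simp
  | r => simp
  | R₂ => simp

end Glue

/-! ### Removal of a root vertex from a glued orientation. -/

section GlueSigns

variable {α : Type*} [DecidableEq α] {I : Finset α}

/-- The shift by two comes from `R`, one letter in front of all vertices, being replaced by three
letters. -/
lemma refGlob_erase {F : Forest I} {v : Finset α} (hv : v ∈ F.verts) :
    (expandR (refGlob F)).idxOf (.vertex v) = (refGlob F).idxOf (some v) + 2 ∧
      (expandR (refGlob F)).erase (.vertex v) = expandR ((refGlob F).erase (some v)) := by
  have hv' : v ∈ F.verts.toList := Finset.mem_toList.2 hv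
  obtain ⟨i1, e1⟩ := idxOf_erase_map (f := GlueSymbol.vertex (β := Finset α)) hv'
    (Function.Injective.injOn fun a b h => by simpa using h)
  obtain ⟨i2, e2⟩ := idxOf_erase_map (f := some) hv' (Option.some_injective _).injOn
  have e3 : expandR (none :: (F.verts.toList.erase v).map some) =
      .R₁ :: .r :: .R₂ :: (F.verts.toList.erase v).map .vertex := by
    rw [expandR_eq, List.flatMap_cons, List.flatMap_map]
    simp only [expandSymbol, List.cons_append, List.nil_append]
    congr 3
    exact List.flatMap_pure_eq_map _ _
  rw [expandR_refGlob, refGlob, List.erase_cons_tail (by simp), List.erase_cons_tail (by simp),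
    List.erase_cons_tail (by simp), List.erase_cons_tail (by simp), e1, e2, e3]
  refine ⟨?_, rfl⟩
  rw [List.idxOf_cons_ne _ (by simp), List.idxOf_cons_ne _ (by simp),
    List.idxOf_cons_ne _ (by simp), List.idxOf_cons_ne _ (by simp), i1, i2]

variable {F G F₁ F₂ : Forest I} {X Y : Finset α} {u : ℤˣ} {o₁ o₂ : InnerData α}
  {V : Finset (Finset α)}

lemma IsTopDecomp.refGlob_perm (h : IsTopDecomp F G X Y u) :
    ((refGlob F).erase (some (X ∪ Y))).Perm (refGlob G) := by
  rw [List.perm_ext_iff_of_nodup ((refGlob_nodup F).erase _) (refGlob_nodup G)]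
  intro g
  rw [(refGlob_nodup F).mem_erase_iff, mem_refGlob, mem_refGlob, h.verts_eq_erase]
  constructor
  · rintro ⟨h1, rfl | ⟨v, hv, rfl⟩⟩
    · exact Or.inl rfl
    · exact Or.inr ⟨v, Finset.mem_erase.2 ⟨fun e => h1 (by rw [e]), hv⟩, rfl⟩
  · rintro (rfl | ⟨v, hv, rfl⟩)
    · exact ⟨by simp, Or.inl rfl⟩
    · rw [Finset.mem_erase] at hv
      exact ⟨by simpa using hv.1, Or.inr ⟨v, hv.2, rfl⟩⟩

/-- The vertex is erased from both words, at the cost of its two positions. Its positions in the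
reference word before and after the expansion of `R` have the same parity, and the expansion uses
blocks of odd length, so only the position in `w` survives. -/
lemma IsTopDecomp.orSign_expandR (h : IsTopDecomp F G X Y u) {w : List (GlueSymbol (Finset α))}
    (hw : w.Perm (expandR (refGlob F))) :
    orSign w (expandR (refGlob F)) * ((-1) ^ (refGlob F).idxOf (some (X ∪ Y)) *
      orSign ((refGlob F).erase (some (X ∪ Y))) (refGlob G)) =
      (-1) ^ w.idxOf (.vertex (X ∪ Y)) *
        orSign (w.erase (.vertex (X ∪ Y))) (expandR (refGlob G)) := by
  obtain ⟨e1, e2⟩ := refGlob_erase h.mem_verts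
  have hn := expandR_refGlob_nodup F
  have hm : GlueSymbol.vertex (X ∪ Y) ∈ expandR (refGlob F) := by
    rw [expandR_refGlob]
    simp [h.mem_verts]
  have p1 := hw.erase (.vertex (X ∪ Y))
  rw [e2] at p1
  have p2 : (expandR ((refGlob F).erase (some (X ∪ Y)))).Perm (expandR (refGlob G)) := by
    rw [expandR_eq, expandR_eq]
    exact h.refGlob_perm.flatMap_right _
  have s2 : orSign (expandR ((refGlob F).erase (some (X ∪ Y)))) (expandR (refGlob G)) =
      orSign ((refGlob F).erase (some (X ∪ Y))) (refGlob G) := by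
    have hn' := expandR_refGlob_nodup G
    rw [expandR_eq] at hn'
    rw [expandR_eq, expandR_eq]
    refine orSign_flatMap h.refGlob_perm _ (fun g _ => ?_) hn'
    cases g <;> simp [expandSymbol]
  rw [orSign_erase hw hn hm, e1, e2, ← orSign_trans p1 p2 (expandR_refGlob_nodup G), s2]
  have : (-1 : ℤˣ) ^ (w.idxOf (.vertex (X ∪ Y)) + ((refGlob F).idxOf (some (X ∪ Y)) + 2)) *
      (-1) ^ (refGlob F).idxOf (some (X ∪ Y)) = (-1) ^ w.idxOf (.vertex (X ∪ Y)) := by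
    rw [← pow_add]
    apply units_neg_one_pow_eq
    omega
  rw [← this]
  simp only [mul_assoc, mul_comm, mul_left_comm]

lemma map_glueSymbol_congr {F' : Forest I} {φ ψ : Finset α → Finset α} {o : InnerData α}
    (ho : o.IsOrientationOf F') (he : ∀ v ∈ F'.verts, φ v = ψ v) (s : GlueSymbol (Finset α)) :
    o.glob.map (glueSymbol φ s) = o.glob.map (glueSymbol ψ s) := by
  refine List.map_congr_left fun g hg => ?_
  rw [ho.mem_glob] at hg
  rcases hg with rfl | ⟨v, hv, rfl⟩
  · rfl
  · simp only [glueSymbol, he v hv]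

/-- The vertex of `F₁` over `X ∪ Y` stands at the same place in the global orientation as its image
in the glued word. So erasing before or after the transport agrees. -/
lemma IsForestMap.glob_erase {φ ψ : Finset α → Finset α} (hφ : IsForestMap F₁ F φ)
    (ho : o₁.IsOrientationOf F₁) {p : Finset α × Finset α} (h : IsTopDecomp F G X Y u)
    (hp : p ∈ topPairs F₁ X Y) (he : ∀ v ∈ (prune F₁ p).verts, φ v = ψ v)
    {s : GlueSymbol (Finset α)} (hs : ∀ v, s ≠ .vertex v) :
    GlueSymbol.vertex (X ∪ Y) ∈ o₁.glob.map (glueSymbol φ s) ∧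
    (o₁.glob.map (glueSymbol φ s)).idxOf (.vertex (X ∪ Y)) =
      o₁.glob.idxOf (some (p.1 ∪ p.2)) ∧
    (o₁.glob.map (glueSymbol φ s)).erase (.vertex (X ∪ Y)) =
      (o₁.removeJoin p.1 p.2).glob.map (glueSymbol ψ s) := by
  obtain ⟨-, a, ha⟩ := mem_topPairs.1 hp
  have hv := hφ.map_topPair h hp
  have hm := ho.some_mem_glob ha.mem_verts
  have e : GlueSymbol.vertex (X ∪ Y) = glueSymbol φ s (some (p.1 ∪ p.2)) := by
    rw [← hv]
    rfl
  obtain ⟨e1, e2⟩ := idxOf_erase_map hm (hφ.injOn_glueSymbol ho hs)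
  rw [e]
  refine ⟨List.mem_map_of_mem hm, e1, ?_⟩
  rw [e2, ← map_glueSymbol_congr (ho.removeJoin ha) he]
  rfl

section

variable (ho₁ : o₁.IsOrientationOf F₁) (ho₂ : o₂.IsOrientationOf F₂)
  (h : IsTopDecomp F G X Y u) (hV : V ⊆ G.verts) {p : Finset α × Finset α}
include ho₁ ho₂ h hV

omit ho₁ ho₂ hV in
lemma IsTopDecomp.sdiff_insert : F.verts \ insert (X ∪ Y) V = G.verts \ V := by
  rw [h.verts_eq]
  ext A
  simp only [Finset.mem_sdiff, Finset.mem_insert, not_or]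
  have : A = X ∪ Y → A ∉ G.verts := fun e => e ▸ h.notMem
  tauto

omit ho₁ ho₂ in
lemma IsTopDecomp.sdiff : F.verts \ V = insert (X ∪ Y) (G.verts \ V) := by
  rw [h.verts_eq]
  ext A
  simp only [Finset.mem_sdiff, Finset.mem_insert]
  have h1 : A = X ∪ Y → A ∉ G.verts := fun e => e ▸ h.notMem
  have h2 := @hV A
  tauto

/-- Removal of a root vertex that comes from the first forest. -/
lemma dualForest_removeJoin_glue_left (hp : p ∈ topPairs F₁ X Y)
    (h₁ : MemGamma G V (prune F₁ p)) (h₂ : MemGamma G (G.verts \ V) F₂) :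
    dualForest G ((glue F₁ F₂ o₁ o₂ F (insert (X ∪ Y) V)).removeJoin X Y) =
      dualForest G (glue (prune F₁ p) F₂ (o₁.removeJoin p.1 p.2) o₂ G V) := by
  have hsd := h.sdiff_insert (V := V)
  have h₁' : MemGamma F (insert (X ∪ Y) V) F₁ := (memGamma_insert_iff h hV).2 ⟨p, hp, h₁⟩
  have h₂' : MemGamma F (F.verts \ insert (X ∪ Y) V) F₂ := by
    rw [hsd]
    exact (memGamma_iff h Finset.sdiff_subset).2 h₂
  have hVF : insert (X ∪ Y) V ⊆ F.verts := by
    rw [h.verts_eq]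
    exact Finset.insert_subset_insert _ hV
  obtain ⟨-, a, ha⟩ := mem_topPairs.1 hp
  obtain ⟨-, n₁⟩ := nodeMap_insert h hp h₁
  have n₂ : ∀ A ∈ nodes I F₂.verts, nodeMap F (G.verts \ V) F₂ A = nodeMap G (G.verts \ V) F₂ A :=
    fun A hA => nodeMap_eq_of_memGamma h h₂ hA
  obtain ⟨m₁, i₁⟩ := h₁'.nodeMap_spec
  obtain ⟨m₂, i₂⟩ := h₂'.nodeMap_spec
  obtain ⟨q₁, j₁⟩ := h₁.nodeMap_spec
  obtain ⟨q₂, j₂⟩ := h₂.nodeMap_spec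
  have hoF := glue_isOrientationOf ho₁ ho₂ h₁' h₂'
  have hoG := glue_isOrientationOf (ho₁.removeJoin ha) ho₂ h₁ h₂
  have hP := gluedWord_perm ho₁ ho₂ hVF m₁ i₁ m₂ i₂
  have hvV : X ∪ Y ∉ V := fun hm => h.notMem (hV hm)
  rw [← one_smul ℤˣ (dualForest G (glue (prune F₁ p) F₂ (o₁.removeJoin p.1 p.2) o₂ G V))]
  refine dualForest_congr (hoF.removeJoin h) hoG ?_ ?_
  · intro v hv
    have hne : v ≠ X ∪ Y := ne_of_mem_of_not_mem hv h.notMem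
    rw [glue_loc]
    show (glue F₁ F₂ o₁ o₂ F (insert (X ∪ Y) V)).loc v = _
    rw [glue_loc, hsd]
    by_cases hvV : v ∈ V
    · rw [if_pos hvV, if_pos (Finset.mem_insert_of_mem hvV)]
      obtain ⟨z, hz, rfl⟩ := Finset.mem_image.1 (j₁.symm ▸ hvV)
      refine m₁.pushLoc_congr ho₁ q₁ ?_ (fun z hz => (ha.children_of_mem hz).symm)
        (fun z hz => h.children_of_mem hz) n₁ hz
      rw [ha.verts_eq]
      exact Finset.subset_insert _ _
    · rw [if_neg hvV, if_neg (by simp [hne, hvV])]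
      have hv2 : v ∈ G.verts \ V := Finset.mem_sdiff.2 ⟨hv, hvV⟩
      obtain ⟨z, hz, rfl⟩ := Finset.mem_image.1 (j₂.symm ▸ hv2)
      rw [hsd] at m₂
      exact m₂.pushLoc_congr ho₂ q₂ (Finset.Subset.refl _) (fun _ _ => rfl)
        (fun z hz => h.children_of_mem hz) n₂ hz
  · obtain ⟨hm, hi, he⟩ := m₁.glob_erase ho₁ h hp (ψ := nodeMap G V (prune F₁ p))
      (fun v hv => n₁ v (mem_nodes_of_mem hv)) (s := .R₁) (by simp)
    have hx := h.orSign_expandR hP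
    have hiw : (gluedWord (nodeMap F (insert (X ∪ Y) V) F₁)
        (nodeMap F (F.verts \ insert (X ∪ Y) V) F₂) o₁ o₂).idxOf (.vertex (X ∪ Y)) =
        o₁.glob.idxOf (some (p.1 ∪ p.2)) := by
      rw [gluedWord_eq, List.idxOf_append_of_mem hm, hi]
    have hew : (gluedWord (nodeMap F (insert (X ∪ Y) V) F₁)
        (nodeMap F (F.verts \ insert (X ∪ Y) V) F₂) o₁ o₂).erase (.vertex (X ∪ Y)) =
        gluedWord (nodeMap G V (prune F₁ p)) (nodeMap G (G.verts \ V) F₂)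
          (o₁.removeJoin p.1 p.2) o₂ := by
      rw [gluedWord_eq, List.erase_append_left _ hm, he, gluedWord_eq, hsd,
        map_glueSymbol_congr ho₂ fun v hv => n₂ v (mem_nodes_of_mem hv)]
    rw [hiw, hew] at hx
    have hl : orSign ((glue F₁ F₂ o₁ o₂ F (insert (X ∪ Y) V)).loc (X ∪ Y))
        [(X ∪ Y, true), (X, false), (Y, false)] = orSign (o₁.loc (p.1 ∪ p.2))
          [(p.1 ∪ p.2, true), (p.1, false), (p.2, false)] := by
      rw [glue_loc, if_pos (Finset.mem_insert_self _ _)]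
      exact m₁.pushLoc_topPair ho₁ h hp
    simp only [InnerData.removeJoin] at hl hx ⊢
    rw [glue_glob, glue_glob, hl, glue_sign, glue_sign]
    simp only [one_mul]
    generalize orSign (o₁.loc (p.1 ∪ p.2)) [(p.1 ∪ p.2, true), (p.1, false), (p.2, false)] = c at *
    rw [show ∀ a b d e f g : ℤˣ, a * b * d * (e * f) * g = a * b * f * (d * (e * g)) from
      fun a b d e f g => by simp only [mul_comm, mul_left_comm], hx]
    simp only [mul_assoc, mul_comm, mul_left_comm]

/-- Removal of a root vertex that comes from the second forest. -/
lemma dualForest_removeJoin_glue_right (hp : p ∈ topPairs F₂ X Y)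
    (h₁ : MemGamma G V F₁) (h₂ : MemGamma G (G.verts \ V) (prune F₂ p)) :
    dualForest G ((glue F₁ F₂ o₁ o₂ F V).removeJoin X Y) =
      (-1 : ℤˣ) ^ F₁.verts.card •
        dualForest G (glue F₁ (prune F₂ p) o₁ (o₂.removeJoin p.1 p.2) G V) := by
  have hsd := h.sdiff hV
  have h₁' : MemGamma F V F₁ := (memGamma_iff h hV).2 h₁
  have h₂' : MemGamma F (F.verts \ V) F₂ := by
    rw [hsd]
    exact (memGamma_insert_iff h Finset.sdiff_subset).2 ⟨p, hp, h₂⟩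
  have hVF : V ⊆ F.verts := by
    rw [h.verts_eq]
    exact hV.trans (Finset.subset_insert _ _)
  obtain ⟨-, a, ha⟩ := mem_topPairs.1 hp
  obtain ⟨-, n₂⟩ := nodeMap_insert h hp h₂
  rw [← hsd] at n₂
  have n₁ : ∀ A ∈ nodes I F₁.verts, nodeMap F V F₁ A = nodeMap G V F₁ A :=
    fun A hA => nodeMap_eq_of_memGamma h h₁ hA
  obtain ⟨m₁, i₁⟩ := h₁'.nodeMap_spec
  obtain ⟨m₂, i₂⟩ := h₂'.nodeMap_spec
  obtain ⟨q₁, j₁⟩ := h₁.nodeMap_spec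
  obtain ⟨q₂, j₂⟩ := h₂.nodeMap_spec
  have hoF := glue_isOrientationOf ho₁ ho₂ h₁' h₂'
  have hoG := glue_isOrientationOf ho₁ (ho₂.removeJoin ha) h₁ h₂
  have hP := gluedWord_perm ho₁ ho₂ hVF m₁ i₁ m₂ i₂
  have hvV : X ∪ Y ∉ V := fun hm => h.notMem (hV hm)
  refine dualForest_congr (hoF.removeJoin h) hoG ?_ ?_
  · intro v hv
    rw [glue_loc]
    show (glue F₁ F₂ o₁ o₂ F V).loc v = _
    rw [glue_loc]
    by_cases hvV : v ∈ V
    · rw [if_pos hvV, if_pos hvV]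
      obtain ⟨z, hz, rfl⟩ := Finset.mem_image.1 (j₁.symm ▸ hvV)
      exact m₁.pushLoc_congr ho₁ q₁ (Finset.Subset.refl _) (fun _ _ => rfl)
        (fun z hz => h.children_of_mem hz) n₁ hz
    · rw [if_neg hvV, if_neg hvV]
      have hv2 : v ∈ G.verts \ V := Finset.mem_sdiff.2 ⟨hv, hvV⟩
      obtain ⟨z, hz, rfl⟩ := Finset.mem_image.1 (j₂.symm ▸ hv2)
      refine m₂.pushLoc_congr ho₂ q₂ ?_ (fun z hz => (ha.children_of_mem hz).symm)
        (fun z hz => h.children_of_mem hz) n₂ hz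
      rw [ha.verts_eq]
      exact Finset.subset_insert _ _
  · obtain ⟨hm, hi, he⟩ := m₂.glob_erase ho₂ h hp (ψ := nodeMap G (G.verts \ V) (prune F₂ p))
      (fun v hv => n₂ v (mem_nodes_of_mem hv)) (s := .R₂) (by simp)
    have hn : GlueSymbol.vertex (X ∪ Y) ∉ o₁.glob.map (glueSymbol (nodeMap F V F₁) .R₁) := by
      rw [mem_map_glueSymbol ho₁]
      simp [i₁, hvV]
    have hx := h.orSign_expandR hP
    -- In front of the part from `o₂` stand the `F₁.verts.card + 1` letters of `o₁` and the letter
    -- `r`. The total `F₁.verts.card + 2` gives the sign in the statement.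
    have hiw : (gluedWord (nodeMap F V F₁) (nodeMap F (F.verts \ V) F₂) o₁ o₂).idxOf
        (.vertex (X ∪ Y)) = F₁.verts.card + 2 + o₂.glob.idxOf (some (p.1 ∪ p.2)) := by
      rw [gluedWord_eq, List.idxOf_append_of_notMem hn, List.idxOf_cons_ne _ (by simp), hi,
        List.length_map, ho₁.length_glob]
      omega
    have hew : (gluedWord (nodeMap F V F₁) (nodeMap F (F.verts \ V) F₂) o₁ o₂).erase
        (.vertex (X ∪ Y)) =
        gluedWord (nodeMap G V F₁) (nodeMap G (G.verts \ V) (prune F₂ p))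
          o₁ (o₂.removeJoin p.1 p.2) := by
      rw [gluedWord_eq, List.erase_append_right _ hn, List.erase_cons_tail (by simp), he,
        gluedWord_eq, map_glueSymbol_congr ho₁ fun v hv => n₁ v (mem_nodes_of_mem hv)]
    rw [hiw, hew] at hx
    have hl : orSign ((glue F₁ F₂ o₁ o₂ F V).loc (X ∪ Y))
        [(X ∪ Y, true), (X, false), (Y, false)] = orSign (o₂.loc (p.1 ∪ p.2))
          [(p.1 ∪ p.2, true), (p.1, false), (p.2, false)] := by
      rw [glue_loc, if_neg hvV]
      exact m₂.pushLoc_topPair ho₂ h hp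
    simp only [InnerData.removeJoin] at hl hx ⊢
    rw [glue_glob, glue_glob, hl, glue_sign, glue_sign]
    generalize orSign (o₂.loc (p.1 ∪ p.2)) [(p.1 ∪ p.2, true), (p.1, false), (p.2, false)] = c at *
    rw [show ∀ a b d e f g : ℤˣ, a * b * d * (e * f) * g = a * b * f * (d * (e * g)) from
      fun a b d e f g => by simp only [mul_comm, mul_left_comm], hx, pow_add, pow_add,
      neg_one_sq, mul_one]
    simp only [mul_assoc, mul_comm, mul_left_comm]

end

end GlueSigns

/-! ### The dual product as a pairing on the tensor square. -/

section Pairing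

variable {α : Type*} [DecidableEq α] {I : Finset α}

/-- The opposite product `f₁ × f₂`, as a linear form on the tensor square. -/
def pairing (f₁ f₂ : Module.Dual ℚ (Bess I)) : Bess I ⊗[ℚ] Bess I →ₗ[ℚ] ℚ :=
  LinearMap.mul' ℚ ℚ ∘ₗ TensorProduct.map f₂ f₁ ∘ₗ koszulTwist I

lemma oppDualMul_eq (δ : Bess I →ₗ[ℚ] Bess I ⊗[ℚ] Bess I) (f₁ f₂ : Module.Dual ℚ (Bess I)) :
    oppDualMul δ f₁ f₂ = pairing f₁ f₂ ∘ₗ δ := rfl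

lemma pairing_single (f₁ f₂ : Module.Dual ℚ (Bess I)) (F G : Forest I) :
    pairing f₁ f₂ (Finsupp.single F 1 ⊗ₜ Finsupp.single G 1) =
      (-1 : ℤˣ) ^ (deg F * deg G) • (f₂ (Finsupp.single F 1) * f₁ (Finsupp.single G 1)) := by
  simp only [pairing, LinearMap.comp_apply, koszulTwist, TensorProduct.lift.tmul, bilin_single,
    map_units_smul, TensorProduct.map_tmul, LinearMap.mul'_apply]

lemma signOp_pow_joinOp {B C : Finset α} (hBC : Disjoint B C) (n : ℕ) (F : Forest I) :
    ((signOp : Bess I →ₗ[ℚ] Bess I) ^ n) (joinOp B C (Finsupp.single F 1)) =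
      (-1 : ℤˣ) ^ ((deg F + 1) * n) • joinOp B C (Finsupp.single F 1) := by
  have h0 := LinearMap.congr_fun (joinOp_comp_signOp hBC) (Finsupp.single F (1 : ℚ))
  rw [LinearMap.comp_apply, signOp_single, map_units_smul, LinearMap.neg_apply,
    LinearMap.comp_apply, eq_neg_iff_add_eq_zero, ← neg_eq_iff_add_eq_zero] at h0
  induction n with
  | zero => simp
  | succ n ih =>
    rw [pow_succ', Module.End.mul_apply, ih, map_units_smul, ← h0, ← Units.neg_smul, smul_smul]
    congr 1
    rw [mul_add, pow_add, mul_one, pow_succ _ (deg F), mul_neg_one]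

/-- The Koszul sign becomes a power of `signOp`, so that the other argument may be a sum of forests,
such as the result of a join. -/
lemma pairing_tmul_single (f₁ f₂ : Module.Dual ℚ (Bess I)) (x : Bess I) (G : Forest I) :
    pairing f₁ f₂ (x ⊗ₜ Finsupp.single G 1) =
      f₂ (((signOp : Bess I →ₗ[ℚ] Bess I) ^ deg G) x) * f₁ (Finsupp.single G 1) := by
  have h : pairing f₁ f₂ ∘ₗ (TensorProduct.mk ℚ (Bess I) (Bess I)).flip (Finsupp.single G 1) =
      f₁ (Finsupp.single G 1) • (f₂ ∘ₗ (signOp ^ deg G)) := by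
    refine bess_hom_ext fun F => ?_
    simp only [LinearMap.comp_apply, LinearMap.flip_apply, TensorProduct.mk_apply, pairing_single,
      LinearMap.smul_apply, signOp_pow_single, map_units_smul, smul_eq_mul]
    rw [mul_smul_comm, mul_comm (deg F), mul_comm (f₂ _)]
  rw [mul_comm]
  exact LinearMap.congr_fun h x

lemma pairing_single_tmul (f₁ f₂ : Module.Dual ℚ (Bess I)) (F : Forest I) (y : Bess I) :
    pairing f₁ f₂ (Finsupp.single F 1 ⊗ₜ y) =
      f₂ (Finsupp.single F 1) * f₁ (((signOp : Bess I →ₗ[ℚ] Bess I) ^ deg F) y) := by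
  have h : pairing f₁ f₂ ∘ₗ TensorProduct.mk ℚ (Bess I) (Bess I) (Finsupp.single F 1) =
      f₂ (Finsupp.single F 1) • (f₁ ∘ₗ (signOp ^ deg F)) := by
    refine bess_hom_ext fun G => ?_
    simp only [LinearMap.comp_apply, TensorProduct.mk_apply, pairing_single,
      LinearMap.smul_apply, signOp_pow_single, map_units_smul, smul_eq_mul]
    rw [mul_smul_comm, mul_comm (deg F)]
  exact LinearMap.congr_fun h y

/-- This is the Leibniz rule for the product dual to a coproduct. Because the product is the
opposite one, `f₂` is evaluated on the first tensor factor, and the sign arises when the operator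
acting there is moved past `F₁`. -/
lemma pairing_comp_joinOp₂ {F₁ : Forest I} {o₁ : InnerData α} (f₂ : Module.Dual ℚ (Bess I))
    {B C : Finset α} (hBC : Disjoint B C) :
    pairing (dualForest F₁ o₁) f₂ ∘ₗ joinOp₂ B C =
      pairing (dualForest F₁ o₁ ∘ₗ joinOp B C) f₂ +
        (-1 : ℤˣ) ^ F₁.verts.card • pairing (dualForest F₁ o₁) (f₂ ∘ₗ joinOp B C) := by
  refine bess₂_hom_ext fun F G => ?_
  rw [LinearMap.comp_apply, joinOp₂_tmul, map_add, pairing_tmul_single, signOp_single,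
    units_smul_tmul, map_units_smul, pairing_single_tmul, signOp_pow_joinOp hBC,
    signOp_pow_joinOp hBC, map_units_smul, map_units_smul, LinearMap.add_apply, pairing_single,
    LinearMap.smul_apply, pairing_single, LinearMap.comp_apply, LinearMap.comp_apply, add_comm]
  congr 1
  · rw [mul_smul_comm, smul_smul, ← pow_add]
    congr 1
    apply units_neg_one_pow_eq
    rw [add_mul, mul_comm (deg G)]
    omega
  -- The extra sign is `(-1) ^ deg G`. The form `dualForest F₁ o₁` vanishes unless `G = F₁`, so it
  -- can be replaced by `(-1) ^ F₁.verts.card`.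
  · by_cases hG : F₁ = G
    · subst hG
      rw [smul_mul_assoc, smul_smul, ← pow_add]
      congr 1
      apply units_neg_one_pow_eq
      rw [add_mul, one_mul, add_comm]
      rfl
    · rw [dualForest_single_of_ne _ hG]
      simp

lemma pairing_sum_left {ι : Type*} (s : Finset ι) (f : ι → Module.Dual ℚ (Bess I))
    (f₂ : Module.Dual ℚ (Bess I)) :
    pairing (∑ i ∈ s, f i) f₂ = ∑ i ∈ s, pairing (f i) f₂ := by
  refine bess₂_hom_ext fun F G => ?_
  simp only [pairing_single, LinearMap.sum_apply, Finset.mul_sum, Finset.smul_sum]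

lemma pairing_sum_right {ι : Type*} (s : Finset ι) (f : ι → Module.Dual ℚ (Bess I))
    (f₁ : Module.Dual ℚ (Bess I)) :
    pairing f₁ (∑ i ∈ s, f i) = ∑ i ∈ s, pairing f₁ (f i) := by
  refine bess₂_hom_ext fun F G => ?_
  simp only [pairing_single, LinearMap.sum_apply, Finset.sum_mul, Finset.smul_sum]

end Pairing

/-! ### The product formula. -/

section ProductFormula

variable {α : Type*} [DecidableEq α] {I : Finset α}

open Classical in
/-- The sets `V` of inner vertices of `F` such that `F₁` appears in `γ(F, V)` and `F₂` appears in
`γ(F, V(F) \ V)`. -/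
def gluingSets (F₁ F₂ F : Forest I) : Finset (Finset (Finset α)) :=
  F.verts.powerset.filter fun V => MemGamma F V F₁ ∧ MemGamma F (F.verts \ V) F₂

lemma mem_gluingSets {F₁ F₂ F : Forest I} {V : Finset (Finset α)} :
    V ∈ gluingSets F₁ F₂ F ↔
      V ⊆ F.verts ∧ MemGamma F V F₁ ∧ MemGamma F (F.verts \ V) F₂ := by
  simp only [gluingSets, Finset.mem_filter, Finset.mem_powerset]

lemma MemGamma.verts_eq_empty {F F' : Forest I} {V : Finset (Finset α)} (h : MemGamma F V F')
    (hV : V ⊆ ∅) : F'.verts = ∅ := by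
  obtain ⟨φ, -, hφ⟩ := h
  rw [← Finset.image_eq_empty (f := φ), hφ, ← Finset.subset_empty]
  exact hV

lemma memGamma_self {F : Forest I} (hF : F.verts = ∅) : MemGamma F ∅ F := by
  refine ⟨id, ⟨fun _ _ => rfl, fun v hv => hv, fun _ _ _ _ e => e, ?_, ?_⟩, by simp [hF]⟩ <;>
  · intro v hv
    simp [hF] at hv

lemma InnerData.IsOrientationOf.glob_eq {F : Forest I} {o : InnerData α} (ho : o.IsOrientationOf F)
    (hF : F.verts = ∅) : o.glob = [none] := by
  obtain ⟨g, hg⟩ := List.length_eq_one_iff.1 (by rw [ho.length_glob, hF]; rfl)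
  have := (ho.mem_glob none).2 (Or.inl rfl)
  rw [hg, List.mem_singleton] at this
  rw [hg, this]

lemma glue_sign_of_empty {F : Forest I} (hF : F.verts = ∅) {o₁ o₂ : InnerData α}
    (ho₁ : o₁.IsOrientationOf F) (ho₂ : o₂.IsOrientationOf F) (V : Finset (Finset α)) :
    (glue F F o₁ o₂ F V).sign = o₁.sign * o₂.sign := by
  rw [glue_sign, gluedWord_eq, ho₁.glob_eq hF, ho₂.glob_eq hF, expandR_refGlob, hF,
    Finset.toList_empty]
  simp only [List.map_cons, List.map_nil, List.cons_append, List.nil_append, glueSymbol]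
  rw [orSign_self, mul_one]

/-- Only `F₁ = F₂ = F` contributes, with the empty partition. The glued word is then `R₁ ∧ r ∧ R₂`,
so no sign arises beyond those of `o₁` and `o₂`. -/
lemma pairing_coproduct_of_empty {F : Forest I} (hF : F.verts = ∅) (F₁ F₂ : Forest I)
    {o₁ o₂ : InnerData α} (ho₁ : o₁.IsOrientationOf F₁) (ho₂ : o₂.IsOrientationOf F₂) :
    pairing (dualForest F₁ o₁) (dualForest F₂ o₂) (coproduct I (Finsupp.single F 1)) =
      ∑ V ∈ gluingSets F₁ F₂ F, dualForest F (glue F₁ F₂ o₁ o₂ F V) (Finsupp.single F 1) := by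
  obtain ⟨u, hu⟩ : ∃ u : ℤˣ, (Finsupp.single F 1 : Bess I) = u • oneForest I := by
    obtain ⟨W, h⟩ := F
    obtain rfl : W = ∅ := hF
    exact exists_single_empty_eq h
  have hu' : oneForest I = u • (Finsupp.single F 1 : Bess I) := by
    rw [hu, smul_smul, Int.units_mul_self, one_smul]
  have hc : coproduct I (Finsupp.single F 1) =
      u • (Finsupp.single F 1 ⊗ₜ[ℚ] Finsupp.single F 1) := by
    rw [hu, map_units_smul, coproduct_one, ← hu, hu', units_smul_tmul, units_tmul_smul, smul_smul,
      Int.units_mul_self, one_smul]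
  have hd : deg F = 0 := by rw [deg, hF]; rfl
  rw [hc, map_units_smul, pairing_single, hd, mul_zero, pow_zero, one_smul]
  by_cases h₁ : F₁ = F
  · by_cases h₂ : F₂ = F
    · subst h₁
      subst h₂
      have hg : gluingSets F₂ F₂ F₂ = {∅} := by
        ext V
        rw [mem_gluingSets, hF, Finset.subset_empty, Finset.mem_singleton]
        refine ⟨fun h => h.1, ?_⟩
        rintro rfl
        exact ⟨rfl, memGamma_self hF, by simpa using memGamma_self hF⟩
      have hm := memGamma_self hF
      have hm' : MemGamma F₂ (F₂.verts \ ∅) F₂ := by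
        rw [Finset.sdiff_empty, hF]
        exact hm
      rw [hg, Finset.sum_singleton, hu, map_units_smul, map_units_smul, map_units_smul,
        dualForest_oneForest hF ho₁, dualForest_oneForest hF ho₂,
        dualForest_oneForest hF (glue_isOrientationOf ho₁ ho₂ hm hm'),
        glue_sign_of_empty hF ho₁ ho₂, smul_mul_smul_comm, Int.units_mul_self, one_smul,
        mul_comm o₁.sign]
      push_cast
      rfl
    · rw [dualForest_single_of_ne o₂ h₂, zero_mul, smul_zero]
      refine (Finset.sum_eq_zero fun V hV => absurd ?_ h₂).symm
      rw [mem_gluingSets] at hV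
      exact Forest.ext ((hV.2.2.verts_eq_empty (by simp [hF])).trans hF.symm)
  · rw [dualForest_single_of_ne o₁ h₁, mul_zero, smul_zero]
    refine (Finset.sum_eq_zero fun V hV => absurd ?_ h₁).symm
    rw [mem_gluingSets, hF] at hV
    exact Forest.ext ((hV.2.1.verts_eq_empty hV.1).trans hF.symm)

section Step

variable {F G F₁ F₂ : Forest I} {X Y : Finset α} {u : ℤˣ} (h : IsTopDecomp F G X Y u)
include h

/-- The partitions are divided according to the part that contains `X ∪ Y`, and
`memGamma_insert_iff` is applied to this part. The vertex `p` over `X ∪ Y` is determined by the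
forest, so the unions over `p` are disjoint. -/
lemma IsTopDecomp.sum_gluingSets {M : Type*} [AddCommMonoid M] (f : Finset (Finset α) → M) :
    ∑ V ∈ gluingSets F₁ F₂ F, f V =
      ∑ p ∈ topPairs F₁ X Y, ∑ V ∈ gluingSets (prune F₁ p) F₂ G, f (insert (X ∪ Y) V) +
      ∑ p ∈ topPairs F₂ X Y, ∑ V ∈ gluingSets F₁ (prune F₂ p) G, f V := by
  classical
  rw [← Finset.sum_filter_add_sum_filter_not _ (fun V => X ∪ Y ∈ V)]
  congr 1
  · rw [← Finset.sum_biUnion]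
    · refine (Finset.sum_nbij (fun V => insert (X ∪ Y) V) ?_ ?_ ?_ fun _ _ => rfl).symm
      · intro V hV
        obtain ⟨p, hp, hV⟩ := Finset.mem_biUnion.1 hV
        obtain ⟨hs, m₁, m₂⟩ := mem_gluingSets.1 hV
        refine Finset.mem_filter.2 ⟨mem_gluingSets.2 ⟨?_, ?_, ?_⟩, Finset.mem_insert_self _ _⟩
        · rw [h.verts_eq]
          exact Finset.insert_subset_insert _ hs
        · exact (memGamma_insert_iff h hs).2 ⟨p, hp, m₁⟩
        · rw [h.sdiff_insert]
          exact (memGamma_iff h Finset.sdiff_subset).2 m₂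
      · intro V hV V' hV' e
        have hn : ∀ V, V ∈ (topPairs F₁ X Y).biUnion (fun p => gluingSets (prune F₁ p) F₂ G) →
            X ∪ Y ∉ V := by
          intro V hV hm
          obtain ⟨p, hp, hV⟩ := Finset.mem_biUnion.1 hV
          exact h.notMem ((mem_gluingSets.1 hV).1 hm)
        have h1 := congrArg (fun W => W.erase (X ∪ Y)) e
        simpa [Finset.erase_insert (hn _ hV), Finset.erase_insert (hn _ hV')] using h1
      · intro V hV
        obtain ⟨hV, hm⟩ := Finset.mem_filter.1 hV
        obtain ⟨hs, m₁, m₂⟩ := mem_gluingSets.1 hV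
        obtain ⟨W, hW, rfl⟩ : ∃ W, X ∪ Y ∉ W ∧ V = insert (X ∪ Y) W :=
          ⟨V.erase (X ∪ Y), Finset.notMem_erase _ _, (Finset.insert_erase hm).symm⟩
        have hWG : W ⊆ G.verts := by
          rw [h.verts_eq] at hs
          exact (Finset.insert_subset_insert_iff hW).1 hs
        obtain ⟨p, hp, m₁⟩ := (memGamma_insert_iff h hWG).1 m₁
        rw [h.sdiff_insert, memGamma_iff h Finset.sdiff_subset] at m₂
        exact ⟨W, Finset.mem_coe.2 (Finset.mem_biUnion.2
          ⟨p, hp, mem_gluingSets.2 ⟨hWG, m₁, m₂⟩⟩), rfl⟩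
    · intro p hp q hq hpq
      refine Finset.disjoint_left.2 fun V hV _ => hpq ?_
      exact topPair_unique h hp hq (mem_gluingSets.1 hV).2.1
  · rw [← Finset.sum_biUnion]
    · refine Finset.sum_congr ?_ fun _ _ => rfl
      ext V
      rw [Finset.mem_filter, Finset.mem_biUnion, mem_gluingSets]
      constructor
      · rintro ⟨⟨hs, m₁, m₂⟩, hm⟩
        have hVG : V ⊆ G.verts := by
          rw [h.verts_eq] at hs
          exact (Finset.subset_insert_iff_of_notMem hm).1 hs
        rw [h.sdiff hVG] at m₂
        obtain ⟨p, hp, m₂⟩ := (memGamma_insert_iff h Finset.sdiff_subset).1 m₂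
        exact ⟨p, hp, mem_gluingSets.2 ⟨hVG, (memGamma_iff h hVG).1 m₁, m₂⟩⟩
      · rintro ⟨p, hp, hV⟩
        obtain ⟨hs, m₁, m₂⟩ := mem_gluingSets.1 hV
        refine ⟨⟨?_, (memGamma_iff h hs).2 m₁, ?_⟩, fun hm => h.notMem (hs hm)⟩
        · rw [h.verts_eq]
          exact hs.trans (Finset.subset_insert _ _)
        · rw [h.sdiff hs]
          exact (memGamma_insert_iff h Finset.sdiff_subset).2 ⟨p, hp, m₂⟩
    · intro p hp q hq hpq
      refine Finset.disjoint_left.2 fun V hV _ => hpq ?_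
      exact topPair_unique h hp hq (mem_gluingSets.1 hV).2.2

end Step

/-- Both sides satisfy the same recursion under removal of a root vertex of `F`. The derivation
property splits the left side as `sum_gluingSets` splits the right side, and the lemmas on
`removeJoin` and `glue` match the signs in the two parts. -/
theorem pairing_coproduct (F F₁ F₂ : Forest I) {o₁ o₂ : InnerData α}
    (ho₁ : o₁.IsOrientationOf F₁) (ho₂ : o₂.IsOrientationOf F₂) :
    pairing (dualForest F₁ o₁) (dualForest F₂ o₂) (coproduct I (Finsupp.single F 1)) =
      ∑ V ∈ gluingSets F₁ F₂ F, dualForest F (glue F₁ F₂ o₁ o₂ F V) (Finsupp.single F 1) := by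
  induction F using Forest.induction generalizing F₁ F₂ o₁ o₂ with
  | h₀ F hF => exact pairing_coproduct_of_empty hF F₁ F₂ ho₁ ho₂
  | h₁ F G X Y u h ih =>
    have hc : coproduct I (Finsupp.single F 1) =
        u • joinOp₂ X Y (coproduct I (Finsupp.single G 1)) := by
      rw [h.single_eq, map_units_smul, coproduct_joinOp_roots G h.left_mem h.right_mem h.ne]
    rw [hc, map_units_smul, ← LinearMap.comp_apply (pairing _ _),
      pairing_comp_joinOp₂ _ h.disjoint, dualForest_comp_joinOp ho₁ h.disjoint,
      dualForest_comp_joinOp ho₂ h.disjoint, pairing_sum_left, pairing_sum_right,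
      LinearMap.add_apply, LinearMap.smul_apply, LinearMap.sum_apply, LinearMap.sum_apply,
      h.sum_gluingSets, smul_add, Finset.smul_sum, Finset.smul_sum, Finset.smul_sum]
    congr 1
    · refine Finset.sum_congr rfl fun p hp => ?_
      obtain ⟨-, a, ha⟩ := mem_topPairs.1 hp
      rw [ih _ _ (ho₁.removeJoin ha) ho₂, Finset.smul_sum]
      refine Finset.sum_congr rfl fun V hV => ?_
      obtain ⟨hs, m₁, m₂⟩ := mem_gluingSets.1 hV
      have ho : (glue F₁ F₂ o₁ o₂ F (insert (X ∪ Y) V)).IsOrientationOf F := by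
        refine glue_isOrientationOf ho₁ ho₂ ((memGamma_insert_iff h hs).2 ⟨p, hp, m₁⟩) ?_
        rw [h.sdiff_insert]
        exact (memGamma_iff h Finset.sdiff_subset).2 m₂
      rw [h.single_eq, map_units_smul, dualForest_joinOp_single h ho,
        dualForest_removeJoin_glue_left ho₁ ho₂ h hs hp m₁ m₂]
    · refine Finset.sum_congr rfl fun p hp => ?_
      obtain ⟨-, a, ha⟩ := mem_topPairs.1 hp
      rw [ih _ _ ho₁ (ho₂.removeJoin ha), Finset.smul_sum, Finset.smul_sum]
      refine Finset.sum_congr rfl fun V hV => ?_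
      obtain ⟨hs, m₁, m₂⟩ := mem_gluingSets.1 hV
      have ho : (glue F₁ F₂ o₁ o₂ F V).IsOrientationOf F := by
        refine glue_isOrientationOf ho₁ ho₂ ((memGamma_iff h hs).2 m₁) ?_
        rw [h.sdiff hs]
        exact (memGamma_insert_iff h Finset.sdiff_subset).2 ⟨p, hp, m₂⟩
      rw [h.single_eq, map_units_smul, dualForest_joinOp_single h ho,
        dualForest_removeJoin_glue_right ho₁ ho₂ h hs hp m₁ m₂, LinearMap.smul_apply]

/-- The opposite of the dual product in terms of glued forests. -/
theorem oppDualMul_coproduct (F₁ F₂ : Forest I) {o₁ o₂ : InnerData α}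
    (ho₁ : o₁.IsOrientationOf F₁) (ho₂ : o₂.IsOrientationOf F₂) :
    oppDualMul (coproduct I) (dualForest F₁ o₁) (dualForest F₂ o₂) =
      ∑ p ∈ gluingPairs F₁ F₂, dualForest p.1 (glue F₁ F₂ o₁ o₂ p.1 p.2) := by
  classical
  refine bess_hom_ext fun F => ?_
  rw [oppDualMul_eq, LinearMap.comp_apply, pairing_coproduct F F₁ F₂ ho₁ ho₂, LinearMap.sum_apply]
  refine Finset.sum_of_injOn (fun V => (F, V)) (fun V _ V' _ e => (Prod.ext_iff.1 e).2) ?_ ?_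
    fun _ _ => rfl
  · intro V hV
    obtain ⟨hs, hm⟩ := mem_gluingSets.1 hV
    refine Finset.mem_filter.2 ⟨Finset.mem_product.2 ⟨Finset.mem_univ _, ?_⟩, hs, hm⟩
    exact Finset.mem_powerset.2 fun A hA =>
      Finset.mem_powerset.2 (F.isForest.subset A (hs hA))
  · rintro ⟨G, V⟩ hp hn
    refine dualForest_single_of_ne _ ?_
    rintro rfl
    exact hn ⟨V, mem_gluingSets.2 (Finset.mem_filter.1 hp).2, rfl⟩

end ProductFormula

end BesselForests

end

/-- There is exactly one morphism of operads `Δ : Bess → Bess ⊗ Bess` with the prescribed values on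
the generators, and the opposite of the dual product on `Bess*(I)` is given by the sum over the
pairs `(F, V(F) = V₁ ⊔ V₂)` of the dual basis elements with glued orientations. Finite sets are
finite subsets of an infinite set of labels. -/
theorem mainTheorem6 {α : Type*} [DecidableEq α] [Infinite α] :
    (∃! Δ : ∀ I : Finset α, BesselForests.Bess I →ₗ[ℚ]
        TensorProduct ℚ (BesselForests.Bess I) (BesselForests.Bess I),
      BesselForests.IsBessCoproduct Δ) ∧
    ∀ Δ : ∀ I : Finset α, BesselForests.Bess I →ₗ[ℚ]
        TensorProduct ℚ (BesselForests.Bess I) (BesselForests.Bess I),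
      BesselForests.IsBessCoproduct Δ →
      ∀ (I : Finset α) (F₁ F₂ : BesselForests.Forest I) (o₁ o₂ : BesselForests.InnerData α),
        o₁.IsOrientationOf F₁ → o₂.IsOrientationOf F₂ →
        BesselForests.oppDualMul (Δ I)
            (BesselForests.dualForest F₁ o₁) (BesselForests.dualForest F₂ o₂) =
          ∑ p ∈ BesselForests.gluingPairs F₁ F₂,
            BesselForests.dualForest p.1 (BesselForests.glue F₁ F₂ o₁ o₂ p.1 p.2) := by
  refine ⟨⟨BesselForests.coproduct, BesselForests.isBessCoproduct_coproduct, fun Δ hΔ =>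
    hΔ.unique BesselForests.isBessCoproduct_coproduct⟩, fun Δ hΔ I F₁ F₂ o₁ o₂ h₁ h₂ => ?_⟩
  rw [hΔ.unique BesselForests.isBessCoproduct_coproduct]
  exact BesselForests.oppDualMul_coproduct F₁ F₂ h₁ h₂
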